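/- Let $K$ be a field of characteristic $0$ and let $M$ be a supermanifold of dimension $p|q$ over $K$: a topological space with a sheaf $\mathcal O_M$ of supercommutative $K$-superalgebras which around every point admits local coordinates $x_a = z_1,\dots,z_p\,|\,\theta_1,\dots,\theta_q$ ($z_i$ even, $\theta_\alpha$ odd), i.e. homogeneous functions together with coordinate vector fields $\partial_a$ (superderivations of $\mathcal O_M$ of parity $|x_a|$) such that $\partial_a x_b=\delta_{ab}$ and every vector field $X$ equals $\sum_a X(x_a)\partial_a$. (Real smooth, complex analytic and smooth algebraic supermanifolds are examples.) Let * $\mathcal D_M\subset \mathcal End_K(\mathcal O_M)$ be the sheaf of differential operators, the sheaf of subalgebras generated by functions and vector fields; * $(\Omega^\bullet_{M,odd},d)$ be the de Rham algebra, the supercommutative $\mathcal O_M$-algebra locally freely generated by the $dx_a$, of parity $|x_a|+1$, with the odd derivation $d$, $df=\sum_a dx_a\,\partial_a f$; * $\Omega^\bullet_{M,odd}\otimes_{\mathcal O_M}\mathcal D_M$ be the universal de Rham complex, a right $\mathcal D_M$-module through multiplication on the second factor, with the ($\mathcal D_M$-linear, coordinate independent) differential $D(\omega\otimes F)=d\omega\otimes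 F+\sum_a(-1)^{|\omega||x_a|}dx_a\,\omega\otimes\partial_a F$, and let $H_\bullet$ be its (total) homology sheaf, a right $\mathcal D_M$-module; * $\mathcal Ber(M)$ be the Berezinian sheaf: the sheaf of right $\mathcal O_M$-modules with a free generator $\varphi(x)$, of parity $p+q$, for every system of local coordinates $x$, and with $\varphi(x')=\varphi(x)\,\mathrm{Ber}\big(\partial x'_b/\partial x_a\big)_{ab}$ for two systems on the same open set, where the Berezinian of an even invertible supermatrix is $\mathrm{Ber}\begin{pmatrix}A&B\\C&E\end{pmatrix}=\det(A-BE^{-1}C)\det(E)^{-1}$. For a homogeneous vector field $X=\sum_a X^a\partial_a$ and a homogeneous section $\varphi$ of $\mathcal Ber(M)$, written locally as $\varphi=\varphi(x)f$, the Lie derivative is given by $$\mathcal L_X(\varphi)=(-1)^{|\varphi(x)||X|}\,\varphi(x)\sum_a(-1)^{|X^a|(|x_a|+|f|)}\,\partial_a(fX^a).$$ Then: 1. For every system of local coordinates, the element $dz_1\cdots dz_p\otimes\partial_{\theta_1}\cdots\partial_{\theta_q}$ is a cycle, and $[dz_1\cdots dz_p\otimes\partial_{\theta_1}\cdots\partial_{\theta_q}]\cdot\partial_a=0$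 in homology for all $a$. 2. There is a unique morphism of right $\mathcal O_M$-modules $H_\bullet\to\mathcal Ber(M)$ which sends $[dz_1\cdots dz_p\otimes\partial_{\theta_1}\cdots\partial_{\theta_q}]$ to $\varphi(x)$ for every system of local coordinates $x$, and it is an isomorphism. 3. The right $\mathcal D_M$-action on $\mathcal Ber(M)$ which corresponds under this isomorphism to the right $\mathcal D_M$-action on $H_\bullet$ extends the right $\mathcal O_M$-module structure and satisfies $\varphi(x)\cdot\partial_a=0$ for every system of local coordinates $x$ and every $a$. It is uniquely characterized by this: a right $\mathcal D_M$-module structure on the sheaf $\mathcal Ber(M)$ that extends the right $\mathcal O_M$-module structure and satisfies $\varphi(x)\cdot\partial_a=0$ for all $a$, for the coordinate systems $x$ of one atlas, is equal to it. 4. This action is Penkov's right action: for homogeneous $\varphi$ and $X$ the formula for $\mathcal L_X(\varphi)$ does not depend on the coordinates, i.e. it defines a section of $\mathcal Ber(M)$, and $$\varphi\cdot X=-(-1)^{|\varphi||X|}\,\mathcal L_X(\varphi).$$ -/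

import Mathlib

open CategoryTheory TopologicalSpace Opposite TensorProduct

universe u

noncomputable section

/-- A superspace over a field of characteristic zero: a topological space with a sheaf of
supercommutative `K`-superalgebras. Since `2` is invertible, the `ℤ/2`-grading is encoded by the
parity involution, the automorphism which is `+1` on even and `-1` on odd sections. -/
structure SuperSpace (K : Type u) [Field K] [CharZero K] where
  space : TopCat.{u}
  struct : TopCat.Sheaf (AlgCat.{u} K) space
  parity : struct.presheaf ⟶ struct.presheaf
  parity_comp_parity : parity ≫ parity = 𝟙 struct.presheaf
  supercomm : ∀ (U : Opens space) (m n : ℕ) (f g : struct.presheaf.obj (op U)),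
    (parity.app (op U)).hom f = (-1 : ℤ) ^ m • f → (parity.app (op U)).hom g = (-1 : ℤ) ^ n • g →
    f * g = (-1 : ℤ) ^ (m * n) • (g * f)

namespace SuperSpace

variable {K : Type u} [Field K] [CharZero K] (M : SuperSpace K)

/-- Sections of the structure sheaf. -/
abbrev Sec (U : Opens M.space) : Type u := M.struct.presheaf.obj (op U)

/-- The parity involution on sections over `U`. -/
def σ (U : Opens M.space) : M.Sec U →ₐ[K] M.Sec U := (M.parity.app (op U)).hom

/-- Restriction of functions. -/
def res {U V : Opens M.space} (h : V ≤ U) : M.Sec U →ₐ[K] M.Sec V :=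
  (M.struct.presheaf.map (homOfLE h).op).hom

theorem res_res {U V W : Opens M.space} (h : V ≤ U) (h' : W ≤ V) (f : M.Sec U) :
    M.res h' (M.res h f) = M.res (h'.trans h) f := by
  have := M.struct.presheaf.map_comp (homOfLE h).op (homOfLE h').op
  exact (congrArg (fun k => (AlgCat.Hom.hom k) f) this).symm

theorem res_self {U : Opens M.space} (h : U ≤ U) (f : M.Sec U) : M.res h f = f := by
  have := M.struct.presheaf.map_id (op U)
  exact congrArg (fun k => (AlgCat.Hom.hom k) f) this

theorem res_σ {U V : Opens M.space} (h : V ≤ U) (f : M.Sec U) :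
    M.res h (M.σ U f) = M.σ V (M.res h f) := by
  have := M.parity.naturality (homOfLE h).op
  exact (congrArg (fun k => (AlgCat.Hom.hom k) f) this).symm

theorem σ_σ {U : Opens M.space} (f : M.Sec U) : M.σ U (M.σ U f) = f := by
  have := congrArg (fun k => k.app (op U)) M.parity_comp_parity
  exact congrArg (fun k => (AlgCat.Hom.hom k) f) this

/-- `f` is homogeneous of parity `n` mod `2`. -/
def HasParity {U : Opens M.space} (n : ℕ) (f : M.Sec U) : Prop := M.σ U f = (-1 : ℤ) ^ n • f

/-- `K`-linear endomorphisms of the sheaf `O_M|_U`: families of endomorphisms of the section spaces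
over all open subsets of `U` that commute with restriction. -/
def endoSubalgebra (U : Opens M.space) :
    Subalgebra K (∀ V : {V : Opens M.space // V ≤ U}, Module.End K (M.Sec V.1)) where
  carrier := {P | ∀ (V W : {V : Opens M.space // V ≤ U}) (h : W.1 ≤ V.1) (f : M.Sec V.1),
    M.res h (P V f) = P W (M.res h f)}
  mul_mem' {P Q} hP hQ := fun V W h f => by
    simp only [Set.mem_ofPred_eq] at hP hQ
    simp [hP V W h, hQ V W h]
  add_mem' {P Q} hP hQ := fun V W h f => by
    simp only [Set.mem_ofPred_eq] at hP hQ
    simp [hP V W h, hQ V W h]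
  algebraMap_mem' r := fun V W h f => by simp [Module.algebraMap_end_apply]

/-- The algebra `End_K(O_M)(U)`. -/
def Endo (U : Opens M.space) : Type u := M.endoSubalgebra U

instance (U : Opens M.space) : Ring (M.Endo U) := inferInstanceAs (Ring (M.endoSubalgebra U))

instance (U : Opens M.space) : Algebra K (M.Endo U) :=
  inferInstanceAs (Algebra K (M.endoSubalgebra U))

section Endo

variable {M} {U V : Opens M.space}

/-- The action of an endomorphism of `O_M|_U` on functions over an open subset of `U`. -/
def Endo.app (P : M.Endo U) (h : V ≤ U) : M.Sec V →ₗ[K] M.Sec V := Subtype.val P ⟨V, h⟩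

/-- The action of an endomorphism of `O_M|_U` on functions over `U`. -/
abbrev Endo.ev (P : M.Endo U) : M.Sec U →ₗ[K] M.Sec U := P.app le_rfl

theorem Endo.ext {P Q : M.Endo U}
    (h : ∀ (V : Opens M.space) (hV : V ≤ U) (f : M.Sec V), P.app hV f = Q.app hV f) : P = Q :=
  Subtype.ext (funext fun V => LinearMap.ext (h V.1 V.2))

theorem Endo.res_app (P : M.Endo U) {W : Opens M.space} (hV : V ≤ U) (hW : W ≤ V) (f : M.Sec V) :
    M.res hW (P.app hV f) = P.app (hW.trans hV) (M.res hW f) :=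
  P.2 ⟨V, hV⟩ ⟨W, hW.trans hV⟩ hW f

theorem Endo.add_app (P Q : M.Endo U) (h : V ≤ U) (f : M.Sec V) :
    (P + Q).app h f = P.app h f + Q.app h f := rfl

theorem Endo.sub_app (P Q : M.Endo U) (h : V ≤ U) (f : M.Sec V) :
    (P - Q).app h f = P.app h f - Q.app h f := rfl

theorem Endo.zero_app (h : V ≤ U) (f : M.Sec V) : (0 : M.Endo U).app h f = 0 := rfl

theorem Endo.one_app (h : V ≤ U) (f : M.Sec V) : (1 : M.Endo U).app h f = f := rfl

theorem Endo.mul_app (P Q : M.Endo U) (h : V ≤ U) (f : M.Sec V) :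
    (P * Q).app h f = P.app h (Q.app h f) := rfl

theorem Endo.sum_app {ι : Type*} (s : Finset ι) (P : ι → M.Endo U) (h : V ≤ U) (f : M.Sec V) :
    (∑ i ∈ s, P i).app h f = ∑ i ∈ s, (P i).app h f := by
  classical
  induction s using Finset.induction_on with
  | empty => rfl
  | insert i s hi ih => rw [Finset.sum_insert hi, Finset.sum_insert hi, Endo.add_app, ih]

end Endo

/-- Restriction of endomorphisms of the structure sheaf. -/
def resEndo {U V : Opens M.space} (h : V ≤ U) : M.Endo U →ₐ[K] M.Endo V where
  toFun P := ⟨fun W => P.app (W.2.trans h), fun W _ h' f => P.res_app (W.2.trans h) h' f⟩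
  map_one' := rfl
  map_mul' _ _ := rfl
  map_zero' := rfl
  map_add' _ _ := rfl
  commutes' _ := rfl

theorem resEndo_app {U V W : Opens M.space} (h : V ≤ U) (hW : W ≤ V) (P : M.Endo U)
    (f : M.Sec W) : (M.resEndo h P).app hW f = P.app (hW.trans h) f := rfl

/-- The operator of left multiplication by a function. -/
def mulOp (U : Opens M.space) : M.Sec U →ₐ[K] M.Endo U where
  toFun f := ⟨fun V => Algebra.lmul K (M.Sec V.1) (M.res V.2 f), fun V W h g => by
    simp [res_res]⟩
  map_one' := Endo.ext fun V hV g => by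
    change M.res hV 1 * g = g
    simp
  map_mul' f f' := Endo.ext fun V hV g => by
    change M.res hV (f * f') * g = M.res hV f * (M.res hV f' * g)
    simp [mul_assoc]
  map_zero' := Endo.ext fun V hV g => by
    change M.res hV 0 * g = 0
    simp
  map_add' f f' := Endo.ext fun V hV g => by
    change M.res hV (f + f') * g = M.res hV f * g + M.res hV f' * g
    simp [add_mul]
  commutes' r := Endo.ext fun V hV g => by
    change M.res hV (algebraMap K _ r) * g = r • g
    simp [Algebra.smul_def]

theorem mulOp_app {U V : Opens M.space} (f : M.Sec U) (h : V ≤ U) (g : M.Sec V) :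
    (M.mulOp U f).app h g = M.res h f * g := rfl

/-- `X` is a vector field over `U`, homogeneous of parity `n`: a parity `n` superderivation of the
sheaf `O_M|_U`, so that `X(fg) = X(f) g + (-1)^{n|f|} f X(g)`. -/
structure IsDerivation {U : Opens M.space} (n : ℕ) (X : M.Endo U) : Prop where
  parity : ∀ {V : Opens M.space} (h : V ≤ U) (f : M.Sec V),
    M.σ V (X.app h f) = (-1 : ℤ) ^ n • X.app h (M.σ V f)
  leibniz : ∀ {V : Opens M.space} (h : V ≤ U) (f g : M.Sec V),
    X.app h (f * g) = X.app h f * g + (M.σ V ^ n) f * X.app h g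

theorem IsDerivation.restrict {M : SuperSpace K} {U V : Opens M.space} (h : V ≤ U) {n : ℕ}
    {X : M.Endo U} (hX : M.IsDerivation n X) : M.IsDerivation n (M.resEndo h X) :=
  ⟨fun hW f => hX.parity (hW.trans h) f, fun hW f g => hX.leibniz (hW.trans h) f g⟩

theorem resEndo_mulOp {U V : Opens M.space} (h : V ≤ U) (f : M.Sec U) :
    M.resEndo h (M.mulOp U f) = M.mulOp V (M.res h f) :=
  Endo.ext fun W hW g => by rw [resEndo_app, mulOp_app, mulOp_app, res_res]

/-- The subalgebra of `End_K(O_M)(U)` generated by functions and vector fields over `U`. -/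
def genDiff (U : Opens M.space) : Subalgebra K (M.Endo U) :=
  Algebra.adjoin K (Set.range (M.mulOp U) ∪ {X | ∃ n, M.IsDerivation n X})

theorem genDiff_res {U V : Opens M.space} (h : V ≤ U) {P : M.Endo U} (hP : P ∈ M.genDiff U) :
    M.resEndo h P ∈ M.genDiff V := by
  have : M.genDiff U ≤ (M.genDiff V).comap (M.resEndo h) := by
    refine Algebra.adjoin_le ?_
    rintro _ (⟨f, rfl⟩ | ⟨n, hX⟩)
    · refine Algebra.subset_adjoin (Or.inl ⟨M.res h f, ?_⟩)
      rw [RingHom.coe_coe, resEndo_mulOp]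
    · exact Algebra.subset_adjoin (Or.inr ⟨n, hX.restrict h⟩)
  exact this hP

/-- Differential operators over `U`: the sections of the subsheaf of algebras of `End_K(O_M)`
generated by functions and vector fields. -/
def diffSubalgebra (U : Opens M.space) : Subalgebra K (M.Endo U) where
  carrier := {P | ∀ x ∈ U, ∃ (V : Opens M.space) (h : V ≤ U), x ∈ V ∧ M.resEndo h P ∈ M.genDiff V}
  mul_mem' {P Q} hP hQ := fun x hx => by
    obtain ⟨V, h, hxV, hV⟩ := hP x hx
    obtain ⟨W, h', hxW, hW⟩ := hQ x hx
    refine ⟨V ⊓ W, inf_le_left.trans h, ⟨hxV, hxW⟩, ?_⟩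
    rw [map_mul]
    exact mul_mem (M.genDiff_res (inf_le_left : V ⊓ W ≤ V) hV)
      (M.genDiff_res (inf_le_right : V ⊓ W ≤ W) hW)
  add_mem' {P Q} hP hQ := fun x hx => by
    obtain ⟨V, h, hxV, hV⟩ := hP x hx
    obtain ⟨W, h', hxW, hW⟩ := hQ x hx
    refine ⟨V ⊓ W, inf_le_left.trans h, ⟨hxV, hxW⟩, ?_⟩
    rw [map_add]
    exact add_mem (M.genDiff_res (inf_le_left : V ⊓ W ≤ V) hV)
      (M.genDiff_res (inf_le_right : V ⊓ W ≤ W) hW)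
  algebraMap_mem' r := fun x hx => ⟨U, le_rfl, hx, by
    rw [AlgHom.commutes]; exact Subalgebra.algebraMap_mem _ _⟩

theorem genDiff_le (U : Opens M.space) : M.genDiff U ≤ M.diffSubalgebra U :=
  fun _ hP _ hx => ⟨U, le_rfl, hx, M.genDiff_res le_rfl hP⟩

/-- The algebra `D_M(U)` of differential operators over `U`. -/
def Diff (U : Opens M.space) : Type u := M.diffSubalgebra U

instance (U : Opens M.space) : Ring (M.Diff U) := inferInstanceAs (Ring (M.diffSubalgebra U))

instance (U : Opens M.space) : Algebra K (M.Diff U) :=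
  inferInstanceAs (Algebra K (M.diffSubalgebra U))

/-- Restriction of differential operators. -/
def resDiff {U V : Opens M.space} (h : V ≤ U) : M.Diff U →ₐ[K] M.Diff V :=
  ((M.resEndo h).comp (M.diffSubalgebra U).val).codRestrict (M.diffSubalgebra V) (fun P x hx => by
    obtain ⟨W, hW, hxW, hP⟩ := P.2 x (h hx)
    exact ⟨V ⊓ W, inf_le_left, ⟨hx, hxW⟩, M.genDiff_res (inf_le_right : V ⊓ W ≤ W) hP⟩)

/-- Functions as differential operators of order zero. -/
def fnOp (U : Opens M.space) : M.Sec U →ₐ[K] M.Diff U :=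
  (M.mulOp U).codRestrict (M.diffSubalgebra U) (fun f =>
    M.genDiff_le U (Algebra.subset_adjoin (Or.inl ⟨f, rfl⟩)))

/-- Vector fields as differential operators. -/
def vecOp {U : Opens M.space} {n : ℕ} (X : M.Endo U) (hX : M.IsDerivation n X) : M.Diff U :=
  ⟨X, M.genDiff_le U (Algebra.subset_adjoin (Or.inr ⟨n, hX⟩))⟩

/-- The parity of the coordinate with index `a`: the `z_i` are even, the `θ_α` are odd. -/
def par {p q : ℕ} : Fin p ⊕ Fin q → ℕ := Sum.elim (fun _ => 0) (fun _ => 1)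

/-- A system of local coordinates `x_a = z_1, …, z_p | θ_1, …, θ_q` over `U`: homogeneous functions
together with the coordinate vector fields `∂_a`, which satisfy `∂_a x_b = δ_ab` and form a basis
of the vector fields: a vector field over an open subset of `U` is determined by its values on the
coordinates, so that `X = ∑ X(x_a) ∂_a`. -/
structure Coords (p q : ℕ) (U : Opens M.space) where
  x : Fin p ⊕ Fin q → M.Sec U
  del : Fin p ⊕ Fin q → M.Endo U
  x_parity : ∀ a, M.HasParity (par a) (x a)
  del_isDerivation : ∀ a, M.IsDerivation (par a) (del a)
  del_x : ∀ a b, (del a).ev (x b) = if a = b then 1 else 0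
  eq_zero : ∀ {V : Opens M.space} (h : V ≤ U) (n : ℕ) (X : M.Endo V), M.IsDerivation n X →
    (∀ a, X.ev (M.res h (x a)) = 0) → X = 0

/-- Restriction of a coordinate system to a smaller open set. -/
def Coords.restrict {M : SuperSpace K} {p q : ℕ} {U V : Opens M.space} (c : M.Coords p q U)
    (h : V ≤ U) : M.Coords p q V where
  x a := M.res h (c.x a)
  del a := M.resEndo h (c.del a)
  x_parity a := by
    have := congrArg (M.res h) (c.x_parity a)
    rw [res_σ, map_zsmul] at this
    exact this
  del_isDerivation a := (c.del_isDerivation a).restrict h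
  del_x a b := by
    have := congrArg (M.res h) (c.del_x a b)
    rw [Endo.res_app] at this
    refine Eq.trans this ?_
    split <;> simp
  eq_zero h' n X hX h0 := c.eq_zero (h'.trans h) n X hX (fun a => by
    rw [← h0 a, res_res])

/-- `M` is a supermanifold of dimension `p|q`: it has local coordinates around every point. This
covers at once real smooth (`K = ℝ`), complex analytic (`K = ℂ`) and smooth algebraic
supermanifolds. -/
def IsSupermanifold (p q : ℕ) : Prop :=
  ∀ x : M.space, ∃ U : Opens M.space, x ∈ U ∧ Nonempty (M.Coords p q U)

section Forms

variable {M}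

/-- The free algebra on symbols `f` and `df`, for `f` a function over `U`. -/
abbrev PreForms (U : Opens M.space) : Type u := FreeAlgebra K (M.Sec U ⊕ M.Sec U)

/-- The generator `f`. -/
def preFn {U : Opens M.space} (f : M.Sec U) : PreForms U := FreeAlgebra.ι K (Sum.inl f)

/-- The generator `df`. -/
def preDf {U : Opens M.space} (f : M.Sec U) : PreForms U := FreeAlgebra.ι K (Sum.inr f)

/-- The parity involution: `|df| = |f| + 1`, as `d` is odd. -/
def preσ (U : Opens M.space) : PreForms U →ₐ[K] PreForms U :=
  FreeAlgebra.lift K (Sum.elim (fun f => preFn (M.σ U f)) (fun f => -preDf (M.σ U f)))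

/-- The algebra morphism `ω ↦ [[σ ω, d ω], [0, ω]]`, which encodes the odd derivation `d` with
`d(ωη) = dω η + (-1)^{|ω|} ω dη`. -/
def preMat (U : Opens M.space) : PreForms U →ₐ[K] Matrix (Fin 2) (Fin 2) (PreForms U) :=
  FreeAlgebra.lift K (Sum.elim
    (fun f => !![preFn (M.σ U f), preDf f; 0, preFn f])
    (fun f => !![-preDf (M.σ U f), 0; 0, preDf f]))

/-- The odd derivation `d` of the free algebra with `d(f) = df`, `d(df) = 0`. -/
def preD {U : Opens M.space} (a : PreForms U) : PreForms U := preMat U a 0 1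

/-- The relations of the algebra of differential forms: functions multiply and add as they do in
`O_M(U)`, `d` is linear and satisfies the Leibniz rule on functions, `f` and `df`
supercommute, and `df = ∑ dx_a ∂_a f` for all coordinate systems over `U`; the relations are closed
under the parity involution and under `d`. -/
inductive FormRel (p q : ℕ) (U : Opens M.space) : PreForms U → PreForms U → Prop
  | fn_add (f g : M.Sec U) : FormRel p q U (preFn (f + g)) (preFn f + preFn g)
  | fn_mul (f g : M.Sec U) : FormRel p q U (preFn (f * g)) (preFn f * preFn g)
  | fn_const (r : K) : FormRel p q U (preFn (algebraMap K _ r)) (algebraMap K _ r)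
  | d_add (f g : M.Sec U) : FormRel p q U (preDf (f + g)) (preDf f + preDf g)
  | d_smul (r : K) (f : M.Sec U) : FormRel p q U (preDf (r • f)) (r • preDf f)
  | d_mul (f g : M.Sec U) :
      FormRel p q U (preDf (f * g)) (preDf f * preFn g + preFn (M.σ U f) * preDf g)
  | fn_d (m n : ℕ) (f g : M.Sec U) (hf : M.HasParity m f) (hg : M.HasParity n g) :
      FormRel p q U (preFn f * preDf g) ((-1 : ℤ) ^ (m * (n + 1)) • (preDf g * preFn f))
  | d_d (m n : ℕ) (f g : M.Sec U) (hf : M.HasParity m f) (hg : M.HasParity n g) :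
      FormRel p q U (preDf f * preDf g) ((-1 : ℤ) ^ ((m + 1) * (n + 1)) • (preDf g * preDf f))
  | chain (c : M.Coords p q U) (f : M.Sec U) :
      FormRel p q U (preDf f) (∑ a, preDf (c.x a) * preFn ((c.del a).ev f))
  | parity (a b : PreForms U) (h : FormRel p q U a b) : FormRel p q U (preσ U a) (preσ U b)
  | diff (a b : PreForms U) (h : FormRel p q U a b) : FormRel p q U (preD a) (preD b)

theorem preMat_apply {U : Opens M.space} (a : PreForms U) :
    preMat U a = !![preσ U a, preD a; 0, a] := by
  have key : ∀ a : PreForms U, preMat U a 0 0 = preσ U a ∧ preMat U a 1 0 = 0 ∧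
      preMat U a 1 1 = a := by
    intro a
    induction a using FreeAlgebra.induction with
    | grade0 r => simp [Matrix.algebraMap_matrix_apply]
    | grade1 x => rcases x with f | f <;> simp [preMat, preσ, preFn, preDf]
    | mul a b ha hb => simp [Matrix.mul_apply, ha, hb]
    | add a b ha hb => simp [ha, hb]
  obtain ⟨h1, h2, h3⟩ := key a
  ext i j
  fin_cases i <;> fin_cases j <;> simp [h1, h2, h3, preD]

variable (M) in
/-- The superalgebra `Ω^•_{M,odd}(U)` of differential forms, generated by functions and their
differentials. Over a coordinate domain it is the supersymmetric algebra over `O_M(U)` on the `dx_a`,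
with `dz_i` odd and `dθ_α` even. -/
def Forms (p q : ℕ) (U : Opens M.space) : Type u := RingQuot (FormRel (M := M) p q U)

variable {p q : ℕ} {U V W : Opens M.space}

instance : Ring (M.Forms p q U) := inferInstanceAs (Ring (RingQuot _))
instance : Algebra K (M.Forms p q U) := inferInstanceAs (Algebra K (RingQuot _))

variable (M p q U) in
/-- The projection from the free algebra. -/
def mkForm : PreForms U →ₐ[K] M.Forms p q U := RingQuot.mkAlgHom K (FormRel p q U)

theorem mkForm_rel {a b : PreForms U} (h : FormRel p q U a b) :
    mkForm M p q U a = mkForm M p q U b := RingQuot.mkAlgHom_rel K h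

theorem mkForm_surjective : Function.Surjective (mkForm M p q U) :=
  RingQuot.mkAlgHom_surjective K _

variable (M p q U) in
/-- Functions as forms of degree zero. -/
def fn : M.Sec U →ₐ[K] M.Forms p q U where
  toFun f := mkForm M p q U (preFn f)
  map_add' f g := (mkForm_rel (.fn_add f g)).trans (map_add _ _ _)
  map_mul' f g := (mkForm_rel (.fn_mul f g)).trans (map_mul _ _ _)
  commutes' r := (mkForm_rel (.fn_const r)).trans (AlgHom.commutes _ _)
  map_zero' := by
    have := mkForm_rel (p := p) (q := q) (.fn_const (U := U) 0)
    simpa using this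
  map_one' := by
    have := mkForm_rel (p := p) (q := q) (.fn_const (U := U) 1)
    simpa using this

variable (M p q U) in
/-- The differential of a function. -/
def df : M.Sec U →ₗ[K] M.Forms p q U where
  toFun f := mkForm M p q U (preDf f)
  map_add' f g := (mkForm_rel (.d_add f g)).trans (map_add _ _ _)
  map_smul' r f := (mkForm_rel (.d_smul r f)).trans (map_smul _ _ _)

variable (M p q U) in
/-- The parity involution on forms. -/
def formσ : M.Forms p q U →ₐ[K] M.Forms p q U :=
  RingQuot.liftAlgHom K ⟨(mkForm M p q U).comp (preσ U), fun _ _ h => mkForm_rel (.parity _ _ h)⟩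

theorem formσ_mk (a : PreForms U) : formσ M p q U (mkForm M p q U a) = mkForm M p q U (preσ U a) :=
  RingQuot.liftAlgHom_mkAlgHom_apply ..

variable (M p q U) in
/-- The morphism `ω ↦ [[σ ω, d ω], [0, ω]]` on forms. -/
def formMat : M.Forms p q U →ₐ[K] Matrix (Fin 2) (Fin 2) (M.Forms p q U) :=
  RingQuot.liftAlgHom K ⟨(mkForm M p q U).mapMatrix.comp (preMat U), fun a b h => by
    have h1 := mkForm_rel (.parity _ _ h)
    have h2 := mkForm_rel (.diff _ _ h)
    have h3 := mkForm_rel h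
    simp only [AlgHom.comp_apply, preMat_apply]
    ext i j
    fin_cases i <;> fin_cases j <;> simp [h1, h2, h3]⟩

theorem formMat_mk (a : PreForms U) :
    formMat M p q U (mkForm M p q U a) = (mkForm M p q U).mapMatrix (preMat U a) :=
  RingQuot.liftAlgHom_mkAlgHom_apply ..

variable (M p q U) in
/-- The exterior derivative. -/
def d : M.Forms p q U →ₗ[K] M.Forms p q U where
  toFun ω := formMat M p q U ω 0 1
  map_add' _ _ := by simp
  map_smul' _ _ := by simp

theorem d_mk (a : PreForms U) : d M p q U (mkForm M p q U a) = mkForm M p q U (preD a) := by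
  simp [d, formMat_mk, preD]

theorem d_mul (ω η : M.Forms p q U) :
    d M p q U (ω * η) = d M p q U ω * η + formσ M p q U ω * d M p q U η := by
  obtain ⟨a, rfl⟩ := mkForm_surjective ω
  obtain ⟨b, rfl⟩ := mkForm_surjective η
  have : preD (a * b) = preσ U a * preD b + preD a * b := by
    change preMat U (a * b) 0 1 = _
    rw [map_mul, preMat_apply, preMat_apply, Matrix.mul_apply]
    simp
  rw [← map_mul, d_mk, d_mk, d_mk, formσ_mk, this, map_add, map_mul, map_mul, add_comm]

theorem d_fn (f : M.Sec U) : d M p q U (fn M p q U f) = df M p q U f := by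
  change d M p q U (mkForm M p q U (preFn f)) = mkForm M p q U (preDf f)
  rw [d_mk]
  simp [preD, preMat, preFn]

theorem d_df (f : M.Sec U) : d M p q U (df M p q U f) = 0 := by
  change d M p q U (mkForm M p q U (preDf f)) = 0
  rw [d_mk]
  simp [preD, preMat, preDf]

theorem formσ_fn (f : M.Sec U) : formσ M p q U (fn M p q U f) = fn M p q U (M.σ U f) := by
  change formσ M p q U (mkForm M p q U (preFn f)) = mkForm M p q U (preFn (M.σ U f))
  rw [formσ_mk]
  simp [preσ, preFn]

theorem formσ_df (f : M.Sec U) : formσ M p q U (df M p q U f) = -df M p q U (M.σ U f) := by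
  change formσ M p q U (mkForm M p q U (preDf f)) = -mkForm M p q U (preDf (M.σ U f))
  rw [formσ_mk]
  simp [preσ, preDf]

theorem df_eq_sum (c : M.Coords p q U) (f : M.Sec U) :
    df M p q U f = ∑ a, df M p q U (c.x a) * fn M p q U ((c.del a).ev f) := by
  have := mkForm_rel (.chain c f)
  simp only [map_sum, map_mul] at this
  exact this

theorem df_mul (f g : M.Sec U) : df M p q U (f * g) =
    df M p q U f * fn M p q U g + fn M p q U (M.σ U f) * df M p q U g := by
  have := mkForm_rel (p := p) (q := q) (.d_mul f g)
  simp only [map_add, map_mul] at this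
  exact this

theorem fn_mul_df {m n : ℕ} {f g : M.Sec U} (hf : M.HasParity m f) (hg : M.HasParity n g) :
    fn M p q U f * df M p q U g = (-1 : ℤ) ^ (m * (n + 1)) • (df M p q U g * fn M p q U f) := by
  have := mkForm_rel (p := p) (q := q) (.fn_d m n f g hf hg)
  simp only [map_zsmul, map_mul] at this
  exact this

theorem df_mul_df {m n : ℕ} {f g : M.Sec U} (hf : M.HasParity m f) (hg : M.HasParity n g) :
    df M p q U f * df M p q U g =
      (-1 : ℤ) ^ ((m + 1) * (n + 1)) • (df M p q U g * df M p q U f) := by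
  have := mkForm_rel (p := p) (q := q) (.d_d m n f g hf hg)
  simp only [map_zsmul, map_mul] at this
  exact this

theorem sec_induction {P : M.Sec U → Prop}
    (hom : ∀ (n : ℕ) (f : M.Sec U), M.HasParity n f → P f)
    (add : ∀ f g, P f → P g → P (f + g)) (f : M.Sec U) : P f := by
  have h2 : (2 : K) ≠ 0 := two_ne_zero
  have h : f = (2 : K)⁻¹ • (f + M.σ U f) + (2 : K)⁻¹ • (f - M.σ U f) := by
    rw [← smul_add, add_add_sub_cancel, ← two_smul K f, smul_smul, inv_mul_cancel₀ h2, one_smul]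
  rw [h]
  refine add _ _ (hom 0 _ ?_) (hom 1 _ ?_)
  · simp [HasParity, σ_σ, add_comm]
  · simp only [HasParity, map_smul, map_sub, σ_σ, pow_one, neg_smul, one_smul]
    rw [← smul_neg, neg_sub]

@[elab_as_elim]
theorem form_induction {P : M.Forms p q U → Prop}
    (fn_hom : ∀ (n : ℕ) (f : M.Sec U), M.HasParity n f → P (fn M p q U f))
    (df_hom : ∀ (n : ℕ) (f : M.Sec U), M.HasParity n f → P (df M p q U f))
    (mul : ∀ a b, P a → P b → P (a * b)) (add : ∀ a b, P a → P b → P (a + b))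
    (ω : M.Forms p q U) : P ω := by
  obtain ⟨a, rfl⟩ := mkForm_surjective ω
  induction a using FreeAlgebra.induction with
  | grade0 r =>
    rw [AlgHom.commutes, ← (fn M p q U).commutes r]
    exact fn_hom 0 _ (by simp [HasParity])
  | grade1 x =>
    rcases x with f | f
    · exact sec_induction (P := fun f => P (fn M p q U f)) fn_hom
        (fun f g hf hg => by rw [map_add]; exact add _ _ hf hg) f
    · exact sec_induction (P := fun f => P (df M p q U f)) df_hom
        (fun f g hf hg => by rw [map_add]; exact add _ _ hf hg) f
  | mul a b ha hb => rw [map_mul]; exact mul _ _ ha hb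
  | add a b ha hb => rw [map_add]; exact add _ _ ha hb

theorem formσ_pow {k : ℕ} {ω : M.Forms p q U} (h : formσ M p q U ω = (-1 : ℤ) ^ k • ω) (m : ℕ) :
    (formσ M p q U ^ m) ω = (-1 : ℤ) ^ (k * m) • ω := by
  induction m with
  | zero => simp
  | succ m ih =>
    rw [pow_succ', AlgHom.mul_apply, ih, map_zsmul, h, smul_smul, ← pow_add]
    congr 2

theorem formσ_fn_hom {n : ℕ} {f : M.Sec U} (hf : M.HasParity n f) :
    formσ M p q U (fn M p q U f) = (-1 : ℤ) ^ n • fn M p q U f := by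
  rw [formσ_fn, hf, map_zsmul]

theorem formσ_df_hom {n : ℕ} {f : M.Sec U} (hf : M.HasParity n f) :
    formσ M p q U (df M p q U f) = (-1 : ℤ) ^ (n + 1) • df M p q U f := by
  rw [formσ_df, hf, map_zsmul, pow_succ]
  simp

theorem neg_one_pow_eq {m n : ℕ} (h : Even (m + n)) : (-1 : ℤ) ^ m = (-1) ^ n := by
  have : (-1 : ℤ) ^ (m + n) = 1 := h.neg_one_pow
  rw [pow_add] at this
  rcases neg_one_pow_eq_or ℤ m with h1 | h1 <;> rcases neg_one_pow_eq_or ℤ n with h2 | h2 <;>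
    simp_all

theorem formσ_mul_df {m : ℕ} {f : M.Sec U} (hf : M.HasParity m f)
    (ω : M.Forms p q U) :
    formσ M p q U ω * df M p q U f = df M p q U f * (formσ M p q U ^ m) ω := by
  induction ω using form_induction with
  | fn_hom n g hg =>
    rw [formσ_pow (formσ_fn_hom hg), formσ_fn_hom hg, smul_mul_assoc, fn_mul_df hg hf, smul_smul,
      mul_smul_comm, ← pow_add]
    congr 1
    exact neg_one_pow_eq (by ring_nf; simp [parity_simps])
  | df_hom n g hg =>
    rw [formσ_pow (formσ_df_hom hg), formσ_df_hom hg, smul_mul_assoc, df_mul_df hg hf, smul_smul,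
      mul_smul_comm, ← pow_add]
    congr 1
    exact neg_one_pow_eq (by ring_nf; simp [parity_simps])
  | mul a b ha hb => rw [map_mul, map_mul, mul_assoc, hb, ← mul_assoc, ha, mul_assoc]
  | add a b ha hb => rw [map_add, map_add, add_mul, mul_add, ha, hb]

theorem fn_mul_form {m : ℕ} {f : M.Sec U} (hf : M.HasParity m f)
    (ω : M.Forms p q U) :
    fn M p q U f * ω = (formσ M p q U ^ m) ω * fn M p q U f := by
  induction ω using form_induction with
  | fn_hom n g hg =>
    rw [formσ_pow (formσ_fn_hom hg), smul_mul_assoc, ← map_mul, ← map_mul]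
    rw [M.supercomm U m n f g hf hg, mul_comm m n, map_zsmul]
  | df_hom n g hg =>
    rw [formσ_pow (formσ_df_hom hg), smul_mul_assoc, fn_mul_df hf hg, mul_comm m]
  | mul a b ha hb => rw [map_mul, ← mul_assoc, ha, mul_assoc, hb, ← mul_assoc]
  | add a b ha hb => rw [map_add, add_mul, mul_add, ha, hb]

end Forms

section Complex

variable {M} {p q : ℕ} {U V W : Opens M.space}

/-- The relations `ω f ⊗ P = ω ⊗ f P`. For the right `D_M`-module structure to be the one provided by
Mathlib, the factors of the tensor product over `K` are written in the other order (without signs):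
`P ⊗ₜ ω` stands for `ω ⊗ P`. -/
def relSubmodule (p q : ℕ) (U : Opens M.space) :
    Submodule (M.Diff U)ᵐᵒᵖ (M.Diff U ⊗[K] M.Forms p q U) :=
  Submodule.span _ {t | ∃ (ω : M.Forms p q U) (f : M.Sec U) (P : M.Diff U),
    t = P ⊗ₜ[K] (ω * fn M p q U f) - (M.fnOp U f * P) ⊗ₜ[K] ω}

variable (M) in
/-- The universal de Rham module `Ω^•_{M,odd} ⊗_{O_M} D_M` over `U`, a right module over `D_M(U)`. -/
abbrev UdR (p q : ℕ) (U : Opens M.space) : Type u :=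
  (M.Diff U ⊗[K] M.Forms p q U) ⧸ relSubmodule p q U

/-- The tensor `ω ⊗ P`. -/
def tens (ω : M.Forms p q U) (P : M.Diff U) : M.UdR p q U :=
  (relSubmodule p q U).mkQ (P ⊗ₜ[K] ω)

theorem tens_fn (ω : M.Forms p q U) (f : M.Sec U) (P : M.Diff U) :
    tens (ω * fn M p q U f) P = tens ω (M.fnOp U f * P) := by
  rw [← sub_eq_zero, tens, tens, ← map_sub, Submodule.mkQ_apply, Submodule.Quotient.mk_eq_zero]
  exact Submodule.subset_span ⟨ω, f, P, rfl⟩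

theorem tens_add_left (ω η : M.Forms p q U) (P : M.Diff U) :
    tens (ω + η) P = tens ω P + tens η P := by
  simp [tens, TensorProduct.tmul_add]

theorem tens_add_right (ω : M.Forms p q U) (P Q : M.Diff U) :
    tens ω (P + Q) = tens ω P + tens ω Q := by
  simp [tens, TensorProduct.add_tmul]

theorem tens_sum_left {ι : Type*} (s : Finset ι) (ω : ι → M.Forms p q U) (P : M.Diff U) :
    tens (∑ i ∈ s, ω i) P = ∑ i ∈ s, tens (ω i) P := by
  simp [tens, TensorProduct.tmul_sum]

theorem tens_sum_right {ι : Type*} (s : Finset ι) (ω : M.Forms p q U) (P : ι → M.Diff U) :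
    tens ω (∑ i ∈ s, P i) = ∑ i ∈ s, tens ω (P i) := by
  simp [tens, TensorProduct.sum_tmul]

theorem op_smul_tens (ω : M.Forms p q U) (P Q : M.Diff U) :
    MulOpposite.op Q • tens ω P = tens ω (P * Q) := by
  rfl

/-- Left multiplication, as a right module endomorphism of `D_M(U)`. -/
def leftMul (P : M.Diff U) : M.Diff U →ₗ[(M.Diff U)ᵐᵒᵖ] M.Diff U where
  toFun Q := P * Q
  map_add' := mul_add P
  map_smul' r Q := (mul_assoc P Q r.unop).symm

namespace Coords

/-- The coordinate vector field `∂_a` as a differential operator. -/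
def delOp (c : M.Coords p q U) (a : Fin p ⊕ Fin q) : M.Diff U :=
  M.vecOp (c.del a) (c.del_isDerivation a)

/-- `ω ⊗ P ↦ dω ⊗ P + ∑_a (-1)^{|ω||x_a|} dx_a ω ⊗ ∂_a P`, before passing to the quotient. -/
def preD (c : M.Coords p q U) :
    M.Diff U ⊗[K] M.Forms p q U →ₗ[(M.Diff U)ᵐᵒᵖ] M.Diff U ⊗[K] M.Forms p q U :=
  AlgebraTensorModule.map LinearMap.id (d M p q U) +
    ∑ a, AlgebraTensorModule.map (leftMul (c.delOp a))
      (LinearMap.mulLeft K (df M p q U (c.x a)) ∘ₗ (formσ M p q U ^ par a).toLinearMap)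

theorem preD_tmul (c : M.Coords p q U) (ω : M.Forms p q U) (P : M.Diff U) :
    c.preD (P ⊗ₜ ω) = P ⊗ₜ d M p q U ω +
      ∑ a, (c.delOp a * P) ⊗ₜ (df M p q U (c.x a) * (formσ M p q U ^ par a) ω) := by
  simp only [preD, LinearMap.add_apply, LinearMap.sum_apply]
  rfl

theorem delOp_mul_fnOp (c : M.Coords p q U) (a : Fin p ⊕ Fin q) (f : M.Sec U) :
    c.delOp a * M.fnOp U f = M.fnOp U ((c.del a).ev f) +
      M.fnOp U ((M.σ U ^ par a) f) * c.delOp a := by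
  refine Subtype.ext (Endo.ext fun V hV g => ?_)
  have h1 : ∀ n : ℕ, M.res hV ((M.σ U ^ n) f) = (M.σ V ^ n) (M.res hV f) := by
    intro n
    induction n with
    | zero => rfl
    | succ n ih => rw [pow_succ', pow_succ', AlgHom.mul_apply, AlgHom.mul_apply, res_σ, ih]
  change (c.del a).app hV (M.res hV f * g) = M.res hV ((c.del a).ev f) * g +
    M.res hV ((M.σ U ^ par a) f) * (c.del a).app hV g
  rw [(c.del_isDerivation a).leibniz, h1, Endo.res_app]

theorem formσ_pow_fn (n : ℕ) (f : M.Sec U) :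
    (formσ M p q U ^ n) (fn M p q U f) = fn M p q U ((M.σ U ^ n) f) := by
  induction n with
  | zero => rfl
  | succ n ih => rw [pow_succ', pow_succ', AlgHom.mul_apply, AlgHom.mul_apply, ih, formσ_fn]

theorem mkQ_preD_tmul (c : M.Coords p q U) (ω : M.Forms p q U) (P : M.Diff U) :
    (relSubmodule p q U).mkQ (c.preD (P ⊗ₜ ω)) = tens (d M p q U ω) P +
      ∑ a, tens (df M p q U (c.x a) * (formσ M p q U ^ par a) ω) (c.delOp a * P) := by
  rw [preD_tmul, map_add, map_sum]
  rfl

theorem preD_mem (c : M.Coords p q U) :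
    relSubmodule p q U ≤ (relSubmodule p q U).comap c.preD := by
  refine Submodule.span_le.2 ?_
  rintro _ ⟨ω, f, P, rfl⟩
  change _ ∈ relSubmodule p q U
  rw [← Submodule.Quotient.mk_eq_zero, ← Submodule.mkQ_apply, map_sub, map_sub, mkQ_preD_tmul,
    mkQ_preD_tmul, sub_eq_zero, d_mul, tens_add_left, tens_fn, d_fn, add_assoc]
  congr 1
  rw [df_eq_sum c f, Finset.mul_sum, tens_sum_left, ← Finset.sum_add_distrib]
  refine Finset.sum_congr rfl fun a _ => ?_
  rw [← mul_assoc, formσ_mul_df (c.x_parity a), tens_fn, ← mul_assoc (c.delOp a), delOp_mul_fnOp,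
    add_mul, tens_add_right, map_mul, formσ_pow_fn, ← mul_assoc, tens_fn, mul_assoc (M.fnOp U _)]

/-- The differential `D(ω ⊗ P) = dω ⊗ P + ∑_a (-1)^{|ω||x_a|} dx_a ω ⊗ ∂_a P` of the universal de
Rham complex, in the coordinates `c`. -/
def D (c : M.Coords p q U) : M.UdR p q U →ₗ[(M.Diff U)ᵐᵒᵖ] M.UdR p q U :=
  (relSubmodule p q U).mapQ (relSubmodule p q U) c.preD c.preD_mem

theorem D_tens (c : M.Coords p q U) (ω : M.Forms p q U) (P : M.Diff U) :
    c.D (tens ω P) = tens (d M p q U ω) P +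
      ∑ a, tens (df M p q U (c.x a) * (formσ M p q U ^ par a) ω) (c.delOp a * P) :=
  c.mkQ_preD_tmul ω P

end Coords

theorem UdR_induction {P : M.UdR p q U → Prop} (zero : P 0) (h : ∀ ω Q, P (tens ω Q))
    (add : ∀ s t, P s → P t → P (s + t)) (t : M.UdR p q U) : P t := by
  obtain ⟨t, rfl⟩ := Submodule.mkQ_surjective _ t
  induction t using TensorProduct.induction_on with
  | zero => simpa using zero
  | tmul Q ω => exact h ω Q
  | add s t hs ht => rw [map_add]; exact add _ _ hs ht

/-- Restriction on the free algebras. -/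
def preRes (h : V ≤ U) : PreForms U →ₐ[K] PreForms V :=
  FreeAlgebra.lift K (Sum.elim (fun f => preFn (M.res h f)) (fun f => preDf (M.res h f)))

theorem preRes_fn (h : V ≤ U) (f : M.Sec U) : preRes h (preFn f) = preFn (M.res h f) := by
  simp [preRes, preFn]

theorem preRes_df (h : V ≤ U) (f : M.Sec U) : preRes h (preDf f) = preDf (M.res h f) := by
  simp [preRes, preDf]

theorem preRes_σ (h : V ≤ U) (a : PreForms U) : preRes h (preσ U a) = preσ V (preRes h a) := by
  have : (preRes h).comp (preσ U) = (preσ V).comp (preRes h) := by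
    refine FreeAlgebra.hom_ext (funext fun x => ?_)
    rcases x with f | f <;> simp [preσ, preRes, preFn, preDf, res_σ]
  exact congrArg (fun k => k a) this

theorem preRes_D (h : V ≤ U) (a : PreForms U) : preRes h (preD a) = preD (preRes h a) := by
  have : (preRes h).mapMatrix.comp (preMat U) = (preMat V).comp (preRes h) := by
    refine FreeAlgebra.hom_ext (funext fun x => ?_)
    rcases x with f | f <;> ext i j <;> fin_cases i <;> fin_cases j <;>
      simp [preMat, preRes, preFn, preDf, res_σ]
  exact congrArg (fun k => k a 0 1) this

theorem FormRel.restrict (h : V ≤ U) {a b : PreForms U} (hab : FormRel p q U a b) :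
    FormRel p q V (preRes h a) (preRes h b) := by
  have hp : ∀ {n : ℕ} {f : M.Sec U}, M.HasParity n f → M.HasParity n (M.res h f) := by
    intro n f hf
    rw [HasParity, ← res_σ, hf, map_zsmul]
  induction hab with
  | fn_add f g => simpa only [map_add, preRes_fn] using FormRel.fn_add _ _
  | fn_mul f g => simpa only [map_mul, preRes_fn] using FormRel.fn_mul _ _
  | fn_const r => simpa only [AlgHom.commutes, preRes_fn] using FormRel.fn_const _
  | d_add f g => simpa only [map_add, preRes_df] using FormRel.d_add _ _
  | d_smul r f => simpa only [map_smul, preRes_df] using FormRel.d_smul _ _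
  | d_mul f g =>
    simpa only [map_add, map_mul, preRes_df, preRes_fn, res_σ] using FormRel.d_mul _ _
  | fn_d m n f g hf hg =>
    simpa only [map_zsmul, map_mul, preRes_df, preRes_fn] using FormRel.fn_d m n _ _ (hp hf) (hp hg)
  | d_d m n f g hf hg =>
    simpa only [map_zsmul, map_mul, preRes_df, preRes_fn] using FormRel.d_d m n _ _ (hp hf) (hp hg)
  | chain c f =>
    simp only [map_sum, map_mul, preRes_df, preRes_fn, Endo.res_app]
    exact FormRel.chain (c.restrict h) _
  | parity a b _ ih => simpa only [preRes_σ] using FormRel.parity _ _ ih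
  | diff a b _ ih => simpa only [preRes_D] using FormRel.diff _ _ ih

/-- Restriction of forms. -/
def resForm (h : V ≤ U) : M.Forms p q U →ₐ[K] M.Forms p q V :=
  RingQuot.liftAlgHom K ⟨(mkForm M p q V).comp (preRes h), fun _ _ hab => mkForm_rel (hab.restrict h)⟩

theorem resForm_mk (h : V ≤ U) (a : PreForms U) :
    resForm h (mkForm M p q U a) = mkForm M p q V (preRes h a) :=
  RingQuot.liftAlgHom_mkAlgHom_apply ..

theorem resForm_fn (h : V ≤ U) (f : M.Sec U) :
    resForm h (fn M p q U f) = fn M p q V (M.res h f) :=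
  (resForm_mk h _).trans (by rw [preRes_fn]; rfl)

theorem resForm_df (h : V ≤ U) (f : M.Sec U) :
    resForm h (df M p q U f) = df M p q V (M.res h f) :=
  (resForm_mk h _).trans (by rw [preRes_df]; rfl)

theorem resForm_σ (h : V ≤ U) (ω : M.Forms p q U) :
    resForm h (formσ M p q U ω) = formσ M p q V (resForm h ω) := by
  obtain ⟨a, rfl⟩ := mkForm_surjective ω
  rw [formσ_mk, resForm_mk, resForm_mk, formσ_mk, preRes_σ]

theorem resForm_d (h : V ≤ U) (ω : M.Forms p q U) :
    resForm h (d M p q U ω) = d M p q V (resForm h ω) := by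
  obtain ⟨a, rfl⟩ := mkForm_surjective ω
  rw [d_mk, resForm_mk, resForm_mk, d_mk, preRes_D]

theorem resDiff_fnOp (h : V ≤ U) (f : M.Sec U) :
    M.resDiff h (M.fnOp U f) = M.fnOp V (M.res h f) :=
  Subtype.ext (M.resEndo_mulOp h f)

/-- Restriction before passing to the quotient. -/
def preResUdR (h : V ≤ U) : M.Diff U ⊗[K] M.Forms p q U
    →ₛₗ[(M.resDiff h).toRingHom.op] M.Diff V ⊗[K] M.Forms p q V where
  toFun := TensorProduct.map (M.resDiff h).toLinearMap (resForm h).toLinearMap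
  map_add' := map_add _
  map_smul' r t := by
    induction t using TensorProduct.induction_on with
    | zero => simp
    | tmul P ω =>
      change (M.resDiff h (P * r.unop)) ⊗ₜ[K] resForm h ω =
        (M.resDiff h P * M.resDiff h r.unop) ⊗ₜ[K] resForm h ω
      rw [map_mul]
    | add s t hs ht => rw [smul_add, map_add, hs, ht, map_add, smul_add]

theorem preResUdR_mem (h : V ≤ U) :
    relSubmodule p q U ≤ (relSubmodule p q V).comap (preResUdR h) := by
  refine Submodule.span_le.2 ?_
  rintro _ ⟨ω, f, P, rfl⟩
  change preResUdR h _ ∈ relSubmodule p q V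
  refine Submodule.subset_span ⟨resForm h ω, M.res h f, M.resDiff h P, ?_⟩
  rw [map_sub, ← resDiff_fnOp, ← map_mul, ← resForm_fn, ← map_mul]
  rfl

/-- Restriction of sections of the universal de Rham module. -/
def resUdR (h : V ≤ U) : M.UdR p q U →ₛₗ[(M.resDiff h).toRingHom.op] M.UdR p q V :=
  (relSubmodule p q U).mapQ (relSubmodule p q V) (preResUdR h) (preResUdR_mem h)

theorem resUdR_tens (h : V ≤ U) (ω : M.Forms p q U) (P : M.Diff U) :
    resUdR h (tens ω P) = tens (resForm h ω) (M.resDiff h P) := rfl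

theorem resUdR_resUdR (h : V ≤ U) (h' : W ≤ V) (t : M.UdR p q U) :
    resUdR h' (resUdR h t) = resUdR (h'.trans h) t := by
  have h1 : ∀ ω : M.Forms p q U, resForm h' (resForm h ω) = resForm (h'.trans h) ω := by
    intro ω
    induction ω using form_induction with
    | fn_hom n f _ => simp only [resForm_fn, res_res]
    | df_hom n f _ => simp only [resForm_df, res_res]
    | mul a b ha hb => simp only [map_mul, ha, hb]
    | add a b ha hb => simp only [map_add, ha, hb]
  induction t using UdR_induction with
  | zero => simp only [map_zero]
  | h ω Q => rw [resUdR_tens, resUdR_tens, resUdR_tens, h1]; rfl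
  | add s t hs ht => simp only [map_add, hs, ht]

theorem Coords.resUdR_D (c : M.Coords p q U) (h : V ≤ U) (t : M.UdR p q U) :
    resUdR h (c.D t) = (c.restrict h).D (resUdR h t) := by
  have h1 : ∀ (n : ℕ) (ω : M.Forms p q U),
      resForm h ((formσ M p q U ^ n) ω) = (formσ M p q V ^ n) (resForm h ω) := by
    intro n ω
    induction n with
    | zero => rfl
    | succ n ih => rw [pow_succ', pow_succ', AlgHom.mul_apply, AlgHom.mul_apply, resForm_σ, ih]
  induction t using UdR_induction with
  | zero => simp only [map_zero]
  | h ω Q =>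
    rw [resUdR_tens, D_tens, D_tens, map_add, map_sum, resUdR_tens, resForm_d]
    congr 1
    refine Finset.sum_congr rfl fun a _ => ?_
    rw [resUdR_tens, map_mul, map_mul, resForm_df, h1]
    rfl
  | add s t hs ht => simp only [map_add, hs, ht]

theorem hasParity_res (h : V ≤ U) {n : ℕ} {f : M.Sec U} (hf : M.HasParity n f) :
    M.HasParity n (M.res h f) := by
  rw [HasParity, ← res_σ, hf, map_zsmul]

theorem mul_eq_σ_pow_mul {m : ℕ} {f : M.Sec U} (hf : M.HasParity m f) (g : M.Sec U) :
    f * g = (M.σ U ^ m) g * f := by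
  induction g using sec_induction with
  | hom l k hk =>
    have : (M.σ U ^ m) k = (-1 : ℤ) ^ (m * l) • k := by
      clear hf
      induction m with
      | zero => simp
      | succ m ih =>
        rw [pow_succ', AlgHom.mul_apply, ih, map_zsmul, hk, smul_smul, ← pow_add]
        congr 2
        ring
    rw [this, smul_mul_assoc]
    exact M.supercomm U m l _ _ hf hk
  | add k k' h1 h2 => rw [mul_add, map_add, add_mul, h1, h2]

theorem isDerivation_mulOp_mul {m n : ℕ} {f : M.Sec U} {X : M.Endo U} (hf : M.HasParity m f)
    (hX : M.IsDerivation n X) : M.IsDerivation (m + n) (M.mulOp U f * X) where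
  parity h g := by
    rw [Endo.mul_app, Endo.mul_app, mulOp_app, mulOp_app, map_mul, ← res_σ, hf, hX.parity,
      map_zsmul, smul_mul_smul_comm, pow_add]
  leibniz {V} h g g' := by
    rw [Endo.mul_app, Endo.mul_app, Endo.mul_app, mulOp_app, mulOp_app, mulOp_app, hX.leibniz,
      mul_add, mul_assoc, pow_add, AlgHom.mul_apply, ← mul_assoc _ _ (X.app h g'),
      mul_eq_σ_pow_mul (hasParity_res h hf) ((M.σ V ^ n) g), mul_assoc _ _ (X.app h g')]

theorem isDerivation_sub {n : ℕ} {X Y : M.Endo U} (hX : M.IsDerivation n X)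
    (hY : M.IsDerivation n Y) : M.IsDerivation n (X - Y) where
  parity h g := by
    rw [Endo.sub_app, Endo.sub_app, map_sub, hX.parity, hY.parity, smul_sub]
  leibniz h g g' := by
    rw [Endo.sub_app, Endo.sub_app, Endo.sub_app, hX.leibniz, hY.leibniz]
    noncomm_ring

theorem isDerivation_zero (n : ℕ) : M.IsDerivation n (0 : M.Endo U) where
  parity h g := by simp [Endo.zero_app]
  leibniz h g g' := by simp [Endo.zero_app]

theorem isDerivation_sum {ι : Type*} (s : Finset ι) {n : ℕ} {X : ι → M.Endo U}
    (hX : ∀ i, M.IsDerivation n (X i)) : M.IsDerivation n (∑ i ∈ s, X i) := by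
  classical
  induction s using Finset.induction_on with
  | empty => exact isDerivation_zero n
  | insert i s hi ih =>
    rw [Finset.sum_insert hi, ← sub_neg_eq_add, ← zero_sub]
    exact isDerivation_sub (hX i) (isDerivation_sub (isDerivation_zero n) ih)

theorem isDerivation_congr {m n : ℕ} (h : Even (m + n)) {X : M.Endo U}
    (hX : M.IsDerivation m X) : M.IsDerivation n X where
  parity h' g := by rw [hX.parity, neg_one_pow_eq h]
  leibniz {V} h' g g' := by
    have h2 : M.σ V ^ 2 = 1 := AlgHom.ext fun f => by
      rw [pow_two, AlgHom.mul_apply, σ_σ]; rfl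
    have key : M.σ V ^ m = M.σ V ^ n := by
      rw [Nat.even_iff] at h
      have hmn : m % 2 = n % 2 := by omega
      rw [← Nat.div_add_mod m 2, ← Nat.div_add_mod n 2, pow_add, pow_add, pow_mul, pow_mul, h2,
        one_pow, one_pow, hmn]
    rw [hX.leibniz, key]

theorem Coords.eq_sum (c : M.Coords p q U) {n : ℕ} {X : M.Endo U} (hX : M.IsDerivation n X) :
    X = ∑ a, M.mulOp U (X.ev (c.x a)) * c.del a := by
  rw [← sub_eq_zero]
  refine c.eq_zero le_rfl n _ (isDerivation_sub hX (isDerivation_sum _ fun a => ?_)) fun b => ?_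
  · have : M.HasParity (n + par a) (X.ev (c.x a)) := by
      rw [HasParity, hX.parity, c.x_parity, map_zsmul, smul_smul, pow_add]
    exact isDerivation_congr (by ring_nf; simp [parity_simps])
      (isDerivation_mulOp_mul this (c.del_isDerivation a))
  · rw [res_self]
    have h2 : ∀ a, (M.mulOp U (X.ev (c.x a)) * c.del a).ev (c.x b) =
        X.ev (c.x a) * (if a = b then 1 else 0) := by
      intro a
      rw [← c.del_x a b, Endo.mul_app, mulOp_app, res_self]
    rw [Endo.sub_app, Endo.sum_app, Finset.sum_congr rfl fun a _ => h2 a]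
    simp only [mul_ite, mul_one, mul_zero, Finset.sum_ite_eq', Finset.mem_univ, if_true, sub_self]

theorem Coords.D_eq (c c' : M.Coords p q U) : c.D = c'.D := by
  have h1 : ∀ b, c'.delOp b =
      ∑ a, M.fnOp U ((c'.del b).ev (c.x a)) * c.delOp a := by
    intro b
    refine Subtype.ext ?_
    have h2 : ∀ (s : Finset (Fin p ⊕ Fin q)) (Y : Fin p ⊕ Fin q → M.Diff U),
        (∑ a ∈ s, Y a).1 = ∑ a ∈ s, (Y a).1 := by
      intro s Y
      induction s using Finset.induction_on with
      | empty => rfl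
      | insert i s hi ih => rw [Finset.sum_insert hi, Finset.sum_insert hi, ← ih]; rfl
    rw [h2]
    exact c.eq_sum (c'.del_isDerivation b)
  refine LinearMap.ext fun t => ?_
  induction t using UdR_induction with
  | zero => simp only [map_zero]
  | h ω P =>
    rw [D_tens, D_tens]
    congr 1
    calc _ = ∑ a, ∑ b, tens (df M p q U (c'.x b) *
            (fn M p q U ((c'.del b).ev (c.x a)) * (formσ M p q U ^ par a) ω))
            (c.delOp a * P) := by
          refine Finset.sum_congr rfl fun a _ => ?_
          rw [df_eq_sum c', Finset.sum_mul, tens_sum_left]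
          simp only [mul_assoc]
      _ = ∑ b, ∑ a, tens (df M p q U (c'.x b) * (formσ M p q U ^ par b) ω)
            (M.fnOp U ((c'.del b).ev (c.x a)) * c.delOp a * P) := by
          rw [Finset.sum_comm]
          refine Finset.sum_congr rfl fun b _ => Finset.sum_congr rfl fun a _ => ?_
          have hp : M.HasParity (par b + par a) ((c'.del b).ev (c.x a)) := by
            rw [HasParity, (c'.del_isDerivation b).parity, c.x_parity, map_zsmul, smul_smul, pow_add]
          have hσ : formσ M p q U ^ 2 = 1 := by
            refine AlgHom.ext fun η => ?_
            rw [pow_two, AlgHom.mul_apply, AlgHom.one_apply]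
            induction η using form_induction with
            | fn_hom n f _ => rw [formσ_fn, formσ_fn, σ_σ]
            | df_hom n f _ => rw [formσ_df, map_neg, formσ_df, σ_σ, neg_neg]
            | mul a b ha hb => rw [map_mul, map_mul, ha, hb]
            | add a b ha hb => rw [map_add, map_add, ha, hb]
          rw [fn_mul_form hp, ← AlgHom.mul_apply, ← pow_add, add_assoc, ← two_mul, pow_add, pow_mul,
            hσ, one_pow, mul_one, ← mul_assoc, tens_fn, mul_assoc (M.fnOp U _)]
      _ = _ := by
          refine Finset.sum_congr rfl fun b _ => ?_
          rw [← tens_sum_right, ← Finset.sum_mul, ← h1]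
  | add s t hs ht => rw [map_add, map_add, hs, ht]

variable (M p q U) in
/-- Elements annihilated by the differential; the differential is given in coordinates. -/
def cocycles : Submodule (M.Diff U)ᵐᵒᵖ (M.UdR p q U) where
  carrier := {t | ∀ (V : Opens M.space) (h : V ≤ U) (c : M.Coords p q V), c.D (resUdR h t) = 0}
  zero_mem' V h c := by simp only [map_zero]
  add_mem' hs ht V h c := by rw [map_add, map_add, hs V h c, ht V h c, add_zero]
  smul_mem' r t ht V h c := by rw [map_smulₛₗ, map_smul, ht V h c, smul_zero]

variable (M p q U) in
/-- Images of elements under the differential. -/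
def boundaries : Submodule (M.Diff U)ᵐᵒᵖ (M.UdR p q U) where
  carrier := {t | ∃ s : M.UdR p q U, ∀ (V : Opens M.space) (h : V ≤ U) (c : M.Coords p q V),
    resUdR h t = c.D (resUdR h s)}
  zero_mem' := ⟨0, fun V h c => by simp only [map_zero]⟩
  add_mem' := fun ⟨s, hs⟩ ⟨s', hs'⟩ =>
    ⟨s + s', fun V h c => by rw [map_add, map_add, map_add, hs V h c, hs' V h c]⟩
  smul_mem' r t := fun ⟨s, hs⟩ =>
    ⟨r • s, fun V h c => by rw [map_smulₛₗ, map_smulₛₗ, map_smul, hs V h c]⟩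

variable (M p q U) in
/-- The (total) homology of the universal de Rham complex over `U`, a right module over `D_M(U)`. -/
abbrev Homology : Type u := M.cocycles p q U ⧸ (M.boundaries p q U).submoduleOf (M.cocycles p q U)

/-- The class of a cocycle. -/
def Homology.mk (t : M.UdR p q U) (ht : t ∈ M.cocycles p q U) : M.Homology p q U :=
  Submodule.Quotient.mk ⟨t, ht⟩

theorem resUdR_mem_cocycles (h : V ≤ U) {t : M.UdR p q U} (ht : t ∈ M.cocycles p q U) :
    resUdR h t ∈ M.cocycles p q V := fun W h' c => by
  rw [resUdR_resUdR]; exact ht W (h'.trans h) c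

theorem resUdR_mem_boundaries (h : V ≤ U) {t : M.UdR p q U} (ht : t ∈ M.boundaries p q U) :
    resUdR h t ∈ M.boundaries p q V := by
  obtain ⟨s, hs⟩ := ht
  refine ⟨resUdR h s, fun W h' c => ?_⟩
  rw [resUdR_resUdR, resUdR_resUdR]
  exact hs W (h'.trans h) c

/-- Restriction of homology classes. -/
def resHomology (h : V ≤ U) :
    M.Homology p q U →ₛₗ[(M.resDiff h).toRingHom.op] M.Homology p q V :=
  Submodule.mapQ _ _
    (LinearMap.restrict (resUdR h) (fun _ ht => resUdR_mem_cocycles h ht))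
    (fun _ ht => resUdR_mem_boundaries h ht)

theorem resHomology_mk (h : V ≤ U) (t : M.UdR p q U) (ht : t ∈ M.cocycles p q U) :
    resHomology h (Homology.mk t ht) = Homology.mk (resUdR h t) (resUdR_mem_cocycles h ht) := rfl

theorem mul_list_prod_eq_zero {R : Type*} [Ring R] {x : R} {l : List R} (hx : x ∈ l)
    (hsq : x * x = 0) (h : ∀ y ∈ l, x * y = -(y * x)) : x * l.prod = 0 := by
  induction l with
  | nil => simp at hx
  | cons y l ih =>
    rw [List.prod_cons, ← mul_assoc]
    by_cases hxy : x = y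
    · rw [← hxy, hsq, zero_mul]
    · have hx' : x ∈ l := (List.mem_cons.1 hx).resolve_left hxy
      rw [h y List.mem_cons_self, neg_mul, mul_assoc,
        ih hx' (fun z hz => h z (List.mem_cons_of_mem _ hz)), mul_zero, neg_zero]

theorem eq_zero_of_eq_neg {A : Type*} [AddCommGroup A] [Module K A] {a : A} (h : a = -a) : a = 0 := by
  have h2 : (2 : K) • a = 0 := by
    rw [two_smul]
    nth_rewrite 2 [h]
    exact add_neg_cancel a
  exact (smul_eq_zero.1 h2).resolve_left two_ne_zero

namespace Coords

theorem df_z_anticomm (c : M.Coords p q U) (i j : Fin p) :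
    df M p q U (c.x (Sum.inl i)) * df M p q U (c.x (Sum.inl j)) =
      -(df M p q U (c.x (Sum.inl j)) * df M p q U (c.x (Sum.inl i))) := by
  rw [df_mul_df (c.x_parity (Sum.inl i)) (c.x_parity (Sum.inl j))]
  simp [par]

theorem delOp_θ_anticomm (c : M.Coords p q U) (i j : Fin q) :
    c.delOp (Sum.inr i) * c.delOp (Sum.inr j) = -(c.delOp (Sum.inr j) * c.delOp (Sum.inr i)) := by
  rw [eq_neg_iff_add_eq_zero]
  refine Subtype.ext ?_
  change c.del (Sum.inr i) * c.del (Sum.inr j) + c.del (Sum.inr j) * c.del (Sum.inr i) = 0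
  have hi := c.del_isDerivation (Sum.inr i)
  have hj := c.del_isDerivation (Sum.inr j)
  refine c.eq_zero le_rfl 0 _ ⟨fun {V} h f => ?_, fun {V} h f g => ?_⟩ fun a => ?_
  · simp only [Endo.add_app, Endo.mul_app]
    rw [map_add, hi.parity, hj.parity, hj.parity, hi.parity]
    simp [par]
  · have pi := hi.parity h
    have pj := hj.parity h
    simp only [par, Sum.elim_inr, pow_one, neg_smul, one_smul] at pi pj
    have li := hi.leibniz h
    have lj := hj.leibniz h
    simp only [par, Sum.elim_inr, pow_one] at li lj
    simp only [Endo.add_app, Endo.mul_app, li, lj, map_add, pi, pj, σ_σ, pow_zero,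
      AlgHom.one_apply]
    noncomm_ring
  · rw [res_self]
    have h0 : ∀ i j : Fin p ⊕ Fin q, (c.del i).ev ((c.del j).ev (c.x a)) = 0 := by
      intro i j
      have h1 : (c.del i).ev 1 = 0 := by
        have := (c.del_isDerivation i).leibniz le_rfl 1 1
        simpa using this
      rw [c.del_x]
      split
      · exact h1
      · exact map_zero _
    rw [Endo.add_app, Endo.mul_app, Endo.mul_app, h0, h0, add_zero]

/-- The form `dz_1 … dz_p`. -/
def dz (c : M.Coords p q U) : M.Forms p q U :=
  (List.ofFn fun i : Fin p => df M p q U (c.x (Sum.inl i))).prod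

/-- The operator `∂_{θ_1} … ∂_{θ_q}`. -/
def delθ (c : M.Coords p q U) : M.Diff U :=
  (List.ofFn fun j : Fin q => c.delOp (Sum.inr j)).prod

theorem d_dz (c : M.Coords p q U) : d M p q U c.dz = 0 := by
  have : ∀ l : List (M.Forms p q U), (∀ ω ∈ l, d M p q U ω = 0) → d M p q U l.prod = 0 := by
    intro l hl
    induction l with
    | nil =>
      rw [List.prod_nil, ← map_one (fn M p q U), d_fn]
      have := df_mul (p := p) (q := q) (1 : M.Sec U) 1
      simpa using this
    | cons ω l ih =>
      rw [List.prod_cons, d_mul, hl ω List.mem_cons_self,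
        ih fun η hη => hl η (List.mem_cons_of_mem _ hη), zero_mul, mul_zero, add_zero]
  refine this _ fun ω hω => ?_
  obtain ⟨i, rfl⟩ := List.mem_ofFn.1 hω
  exact d_df _

theorem D_dz_tens_delθ (c : M.Coords p q U) : c.D (tens c.dz c.delθ) = 0 := by
  have h0l : ∀ P : M.Diff U, tens (0 : M.Forms p q U) P = 0 := fun P => by simp [tens]
  have h0r : ∀ ω : M.Forms p q U, tens ω (0 : M.Diff U) = 0 := fun P => by simp [tens]
  rw [D_tens, d_dz, h0l, zero_add]
  refine Finset.sum_eq_zero fun a _ => ?_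
  rcases a with i | j
  · have : df M p q U (c.x (Sum.inl i)) * (formσ M p q U ^ par (Sum.inl i : Fin p ⊕ Fin q)) c.dz = 0 :=
      mul_list_prod_eq_zero (List.mem_ofFn.2 ⟨i, rfl⟩) (eq_zero_of_eq_neg (K := K) (c.df_z_anticomm i i))
        (fun y hy => by obtain ⟨k, rfl⟩ := List.mem_ofFn.1 hy; exact c.df_z_anticomm i k)
    rw [this, h0l]
  · have : c.delOp (Sum.inr j) * c.delθ = 0 :=
      mul_list_prod_eq_zero (List.mem_ofFn.2 ⟨j, rfl⟩) (eq_zero_of_eq_neg (K := K) (c.delOp_θ_anticomm j j))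
        (fun y hy => by obtain ⟨k, rfl⟩ := List.mem_ofFn.1 hy; exact c.delOp_θ_anticomm j k)
    rw [this, h0r]

theorem dz_tens_delθ_mem (c : M.Coords p q U) : tens c.dz c.delθ ∈ M.cocycles p q U := by
  intro V h c'
  rw [D_eq c' (c.restrict h), ← resUdR_D, D_dz_tens_delθ, map_zero]

/-- The class `[dz_1 … dz_p ⊗ ∂_{θ_1} … ∂_{θ_q}]`. -/
def genClass (c : M.Coords p q U) : M.Homology p q U := Homology.mk (tens c.dz c.delθ) c.dz_tens_delθ_mem

end Coords

end Complex

section Berezinian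

variable {M} {p q : ℕ} {U V W : Opens M.space}

variable (M U) in
/-- The even functions. -/
def evenSubalgebra : Subalgebra K (M.Sec U) := AlgHom.equalizer (M.σ U) (AlgHom.id K (M.Sec U))

variable (M U) in
/-- The commutative ring of even functions over `U`. -/
def EvenSec : Type u := M.evenSubalgebra U

instance : Ring (M.EvenSec U) := inferInstanceAs (Ring (M.evenSubalgebra U))

instance : CommRing (M.EvenSec U) :=
  { (inferInstance : Ring (M.EvenSec U)) with
    mul_comm := fun f g => Subtype.ext (by
      have hf : M.σ U f.1 = f.1 := f.2
      have hg : M.σ U g.1 = g.1 := g.2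
      have h := M.supercomm U 0 0 f.1 g.1 (by rw [pow_zero, one_smul]; exact hf)
        (by rw [pow_zero, one_smul]; exact hg)
      rw [mul_zero, pow_zero, one_smul] at h
      exact h) }

/-- Even functions as functions. -/
def EvenSec.val (f : M.EvenSec U) : M.Sec U := Subtype.val f

/-- The even part of a function. -/
def evenPart (f : M.Sec U) : M.EvenSec U :=
  ⟨(2 : K)⁻¹ • (f + M.σ U f), by
    change M.σ U ((2 : K)⁻¹ • (f + M.σ U f)) = (2 : K)⁻¹ • (f + M.σ U f)
    rw [map_smul, map_add, σ_σ, add_comm]⟩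

/-- The Berezinian `det (A - B D⁻¹ C) (det D)⁻¹` of an invertible even supermatrix with blocks
`A`, `B`, `C`, `D`. The entries of `A`, `D` and `B D⁻¹ C` are even, so that `evenPart` only
regards them as elements of the commutative ring of even functions. -/
def berezinian (J : Matrix (Fin p ⊕ Fin q) (Fin p ⊕ Fin q) (M.Sec U)) : M.EvenSec U :=
  let D : Matrix (Fin q) (Fin q) (M.EvenSec U) := J.toBlocks₂₂.map evenPart
  let Dinv : Matrix (Fin q) (Fin q) (M.Sec U) := (D⁻¹).map EvenSec.val
  ((J.toBlocks₁₁ - J.toBlocks₁₂ * Dinv * J.toBlocks₂₁).map evenPart).det * Ring.inverse D.det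

/-- The Jacobian `(∂ x'_b / ∂ x_a)_{a b}` of the coordinates `c'` with respect to `c`. -/
def jacobian (c c' : M.Coords p q U) : Matrix (Fin p ⊕ Fin q) (Fin p ⊕ Fin q) (M.Sec U) :=
  Matrix.of fun a b => (c.del a).ev (c'.x b)

variable (M p q U) in
/-- A coordinate system on an open subset of `U`. -/
structure Chart where
  dom : Opens M.space
  le : dom ≤ U
  coords : M.Coords p q dom

variable (M p q U) in
/-- Sections over `U` of the Berezinian sheaf, the rank one sheaf of right `O_M`-modules which is
generated by a symbol `D(x)` for each system `x` of local coordinates, with the transition rule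
`D(x') = D(x) Ber(∂x'/∂x)`. A section is given by its coefficients `f_x` with respect to all
systems of local coordinates, `s = D(x) f_x`. -/
def Ber : Submodule K (∀ i : M.Chart p q U, M.Sec i.dom) where
  carrier := {s |
    (∀ {V W : Opens M.space} (hV : V ≤ U) (hW : W ≤ V) (c : M.Coords p q V),
      M.res hW (s ⟨V, hV, c⟩) = s ⟨W, hW.trans hV, c.restrict hW⟩) ∧
    (∀ {V : Opens M.space} (hV : V ≤ U) (c c' : M.Coords p q V),
      s ⟨V, hV, c⟩ = (berezinian (jacobian c c')).val * s ⟨V, hV, c'⟩)}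
  zero_mem' := ⟨fun hV hW c => map_zero _, fun hV c c' => (mul_zero _).symm⟩
  add_mem' hs ht := ⟨fun hV hW c => by
      simp only [Pi.add_apply, map_add]
      rw [hs.1, ht.1], fun hV c c' => by
      simp only [Pi.add_apply, mul_add]
      rw [← hs.2, ← ht.2]⟩
  smul_mem' r s hs := ⟨fun hV hW c => by
      simp only [Pi.smul_apply, map_smul]
      rw [hs.1], fun hV c c' => by
      simp only [Pi.smul_apply, mul_smul_comm]
      rw [← hs.2]⟩

/-- The coefficient `f` of a section `D(x) f` of the Berezinian sheaf in the coordinates `c`. -/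
def coeff (c : M.Coords p q U) (s : M.Ber p q U) : M.Sec U := s.1 ⟨U, le_rfl, c⟩

/-- The right `O_M`-module structure of the Berezinian sheaf. -/
def mulFn (s : M.Ber p q U) (f : M.Sec U) : M.Ber p q U :=
  ⟨fun i => s.1 i * M.res i.le f, fun hV hW c => by
      dsimp only
      rw [map_mul, s.2.1, res_res],
    fun hV c c' => by
      dsimp only
      rw [s.2.2 hV c c', mul_assoc]⟩

/-- Restriction of sections of the Berezinian sheaf. -/
def resBer (h : V ≤ U) : M.Ber p q U →ₗ[K] M.Ber p q V where
  toFun s := ⟨fun i => s.1 ⟨i.dom, i.le.trans h, i.coords⟩,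
    fun hV hW c => s.2.1 (hV.trans h) hW c, fun hV c c' => s.2.2 (hV.trans h) c c'⟩
  map_add' _ _ := rfl
  map_smul' _ _ := rfl

/-- Homogeneity of a section `s = D(x) f` of the Berezinian sheaf; `D(x)` has parity `p + q`. -/
def BerHasParity (n : ℕ) (s : M.Ber p q U) : Prop :=
  ∀ i, M.HasParity (n + (p + q)) (s.1 i)

/-- The Lie derivative of a section `s = D(x) f` of parity `n` of the Berezinian sheaf along a
vector field `X = ∑ X^a ∂_a` of parity `m`, by its coefficients in all coordinate systems:
`L_X(s) = (-1)^{|D(x)||X|} D(x) ∑_a (-1)^{|X^a| (|x_a| + |f|)} ∂_a (f X^a)`, where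
`|D(x)| = p + q`, `|f| = n + p + q` and `|X^a| = m + |x_a|`. -/
def lieDerivative (m n : ℕ) (X : M.Endo U) (s : M.Ber p q U) : ∀ i : M.Chart p q U, M.Sec i.dom :=
  fun i => (-1 : ℤ) ^ ((p + q) * m) • ∑ a, (-1 : ℤ) ^ ((m + par a) * (par a + (n + (p + q)))) •
    (i.coords.del a).ev (s.1 i * X.app i.le (i.coords.x a))

variable (M p q) in
/-- A right `D_M`-module structure on the sheaf `Ber(M)` which extends its right `O_M`-module
structure. -/
structure RightAction where
  act : ∀ U : Opens M.space, M.Ber p q U →ₗ[K] M.Diff U →ₗ[K] M.Ber p q U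
  act_mul : ∀ (U : Opens M.space) (s : M.Ber p q U) (P Q : M.Diff U),
    act U s (P * Q) = act U (act U s P) Q
  act_fn : ∀ (U : Opens M.space) (s : M.Ber p q U) (f : M.Sec U),
    act U s (M.fnOp U f) = mulFn s f
  act_res : ∀ {U V : Opens M.space} (h : V ≤ U) (s : M.Ber p q U) (P : M.Diff U),
    resBer h (act U s P) = act V (resBer h s) (M.resDiff h P)

variable (M p q) in
/-- Morphisms of right `O_M`-modules from the homology of the universal de Rham complex to the
Berezinian sheaf. -/
structure HomologyToBer where
  app : ∀ U : Opens M.space, M.Homology p q U →+ M.Ber p q U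
  app_fn : ∀ (U : Opens M.space) (η : M.Homology p q U) (f : M.Sec U),
    app U (MulOpposite.op (M.fnOp U f) • η) = mulFn (app U η) f
  app_res : ∀ {U V : Opens M.space} (h : V ≤ U) (η : M.Homology p q U),
    resBer h (app U η) = app V (resHomology h η)

/-- The morphism sends the class `[dz_1 … dz_p ⊗ ∂_{θ_1} … ∂_{θ_q}]` to the generator `D(x)`, for
every system of local coordinates. -/
def HomologyToBer.Normalized (Φ : M.HomologyToBer p q) : Prop :=
  ∀ (U : Opens M.space) (c : M.Coords p q U), coeff c (Φ.app U c.genClass) = 1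

/-- The morphism is locally injective and locally surjective, i.e. it is an isomorphism from the
homology sheaf (the sheaf associated with `U ↦ Homology U`) to `Ber(M)`. -/
def HomologyToBer.IsIso (Φ : M.HomologyToBer p q) : Prop :=
  (∀ (U : Opens M.space) (η : M.Homology p q U), Φ.app U η = 0 →
    ∀ x ∈ U, ∃ (V : Opens M.space) (h : V ≤ U), x ∈ V ∧ resHomology h η = 0) ∧
  (∀ (U : Opens M.space) (s : M.Ber p q U), ∀ x ∈ U, ∃ (V : Opens M.space) (h : V ≤ U),
    x ∈ V ∧ ∃ η : M.Homology p q V, Φ.app V η = resBer h s)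

end Berezinian

end SuperSpace

end

noncomputable section

namespace SuperSpace

variable {K : Type u} [Field K] [CharZero K] {M : SuperSpace K} {p q : ℕ} {U V W : Opens M.space}

/-! Fix local coordinates and move all functions to the right. Forms are combinations of
dx_{a_1}…dx_{a_r} f (`form_mem_span`), operators generated by functions and vector fields are
combinations of ∂_{b_1}…∂_{b_s} f (`mem_delSpan`), so locally the complex is spanned by monomials
dx_l ⊗ ∂_m f for lists of indices l, m. It behaves like a Koszul complex: contraction with ∂_a on
forms, paired with the supercommutator with x_a on operators and summed over a with signs, gives a
homotopy H for which DH + HD multiplies such a monomial by the integer Σ_a (1 + (-1)^{|x_a|}(m_a -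
l_a)), where l_a, m_a are the multiplicities of a (`homotopy_DK_add`). Since dz_i and ∂_{θ_j} square
to zero, a nonzero monomial has l_a ≤ 1 for even a and m_a ≤ 1 for odd a; then every summand is
nonnegative, and all vanish only if the monomial is ±dz_1…dz_p ⊗ ∂_{θ_1}…∂_{θ_q} f. In
characteristic 0 cycles of nonzero weight are exact. So homology is locally generated over O_M by
the class of dz ⊗ ∂_θ, and ∂_a kills this class because dz ⊗ ∂_θ ∂_a has weight ±1.

The generator is free because a coefficient map `genCoeff` vanishes on boundaries and takes the
value 1 on it. It extracts the coefficient of dz by iterated contractions, and that of ∂_θ by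
iterated supercommutators with the θ_j followed by reduction modulo Σ ∂_a D_M. Iterated odd
derivations of a product of odd elements give a determinant (`iterDer_prod_ofFn`), so the transition
factor from x to x' is det(∂z'/∂z) det(∂θ/∂θ'). The two transition factors between x and x' are
mutually inverse (`jac_det_mul`), and the two Jacobian matrices are mutually inverse; the Schur
complement formula then identifies the factor with the Berezinian (`berezinian_jacobian`). This
yields the isomorphism with Ber(M).

For the action, `red` assigns to P the unique function congruent to P modulo Σ ∂_a D_M locally.
Uniqueness holds because ∂_m f is an eigenvector of `euler` with eigenvalue the length of m. As φ(x)
is killed by all ∂_a, necessarily (φ(x) f)·P = φ(x) red(fP). This gives existence and uniqueness of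
the action, and the case P = Σ X^a ∂_a is the Lie derivative formula. -/

/-- Multiplicities of coordinate indices in lists are used throughout; the counting lemmas need a
lawful equality test on `Fin p ⊕ Fin q`. -/
instance lawfulBEqSum {α β : Type*} [BEq α] [BEq β] [LawfulBEq α] [LawfulBEq β] :
    LawfulBEq (α ⊕ β) where
  eq_of_beq {a b} h := by
    rcases a with a | a <;> rcases b with b | b
    · exact congrArg Sum.inl (eq_of_beq (show (a == b) = true from h))
    · exact absurd h Bool.false_ne_true
    · exact absurd h Bool.false_ne_true
    · exact congrArg Sum.inr (eq_of_beq (show (a == b) = true from h))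
  rfl {a} := by
    rcases a with a | a
    · exact (BEq.rfl : (a == a) = true)
    · exact (BEq.rfl : (a == a) = true)

/-! ### Locality and gluing of functions. -/

section Sheaf

theorem sec_eq_of_locally_eq {f g : M.Sec U}
    (h : ∀ x ∈ U, ∃ (V : Opens M.space) (h : V ≤ U), x ∈ V ∧ M.res h f = M.res h g) : f = g := by
  choose V hV hx hfg using h
  refine TopCat.Sheaf.eq_of_locally_eq'.{u, u} M.struct (fun x : U => V x.1 x.2) U
    (fun x => homOfLE (hV x.1 x.2)) (fun x hxU => ?_) f g (fun x => hfg x.1 x.2)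
  exact Opens.mem_iSup.2 ⟨⟨x, hxU⟩, hx x hxU⟩

/-- Gluing of functions which are uniquely determined by a local property. -/
theorem existsUnique_sec_of_local (R : ∀ V : Opens M.space, V ≤ U → M.Sec V → Prop)
    (hres : ∀ {V W : Opens M.space} (hV : V ≤ U) (hW : W ≤ V) (f : M.Sec V),
      R V hV f → R W (hW.trans hV) (M.res hW f))
    (huniq : ∀ {V : Opens M.space} (hV : V ≤ U) (f g : M.Sec V), R V hV f → R V hV g → f = g)
    (hloc : ∀ x ∈ U, ∃ (V : Opens M.space) (hV : V ≤ U), x ∈ V ∧ ∃ f : M.Sec V, R V hV f) :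
    ∃ f : M.Sec U, ∀ x ∈ U, ∃ (V : Opens M.space) (hV : V ≤ U), x ∈ V ∧ R V hV (M.res hV f) := by
  choose V hV hx f hf using hloc
  obtain ⟨s, hs, -⟩ := TopCat.Sheaf.existsUnique_gluing'.{u, u} M.struct (fun x : U => V x.1 x.2) U
    (fun x => homOfLE (hV x.1 x.2))
    (fun x hxU => Opens.mem_iSup.2 ⟨⟨x, hxU⟩, hx x hxU⟩) (fun x => f x.1 x.2) (fun x y => by
      -- Local uniqueness forces the chosen sections to agree on overlaps.
      refine huniq (inf_le_left.trans (hV x.1 x.2)) _ _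
        (hres (hV x.1 x.2) inf_le_left _ (hf x.1 x.2))
        (hres (hV y.1 y.2) inf_le_right _ (hf y.1 y.2)))
  refine ⟨s, fun x hxU => ⟨V x hxU, hV x hxU, hx x hxU, ?_⟩⟩
  have := hs ⟨x, hxU⟩
  change M.res (hV x hxU) s = _ at this
  rw [this]
  exact hf x hxU

end Sheaf

/-! ### Signs, powers of the parity involution, supercommutators of vector fields. -/

section Parity

theorem σ_pow_two (U : Opens M.space) : M.σ U ^ 2 = 1 := AlgHom.ext fun f => by
  rw [pow_two, AlgHom.mul_apply, σ_σ]; rfl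

theorem σ_pow_σ_pow (n : ℕ) (f : M.Sec U) : (M.σ U ^ n) ((M.σ U ^ n) f) = f := by
  rw [← AlgHom.mul_apply, ← pow_add, ← two_mul, pow_mul, σ_pow_two, one_pow, AlgHom.one_apply]

theorem σ_pow_hom {m : ℕ} {f : M.Sec U} (hf : M.HasParity m f) (n : ℕ) :
    (M.σ U ^ n) f = (-1 : ℤ) ^ (m * n) • f := by
  induction n with
  | zero => simp
  | succ n ih =>
    rw [pow_succ', AlgHom.mul_apply, ih, map_zsmul, hf, smul_smul, ← pow_add]
    congr 2

theorem neg_one_pow_mul_self (n : ℕ) : (-1 : ℤ) ^ n * (-1) ^ n = 1 := by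
  rw [← pow_add, ← two_mul, pow_mul]; simp

theorem neg_one_pow_smul_smul {A : Type*} [AddCommGroup A] (n : ℕ) (a : A) :
    (-1 : ℤ) ^ n • (-1 : ℤ) ^ n • a = a := by
  rw [smul_smul, neg_one_pow_mul_self, one_smul]

theorem res_σ_pow (h : V ≤ U) (n : ℕ) (f : M.Sec U) :
    M.res h ((M.σ U ^ n) f) = (M.σ V ^ n) (M.res h f) := by
  induction n with
  | zero => rfl
  | succ n ih => rw [pow_succ', pow_succ', AlgHom.mul_apply, AlgHom.mul_apply, res_σ, ih]

theorem IsDerivation.parity_pow {n : ℕ} {X : M.Endo U} (hX : M.IsDerivation n X) (m : ℕ)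
    (h : V ≤ U) (f : M.Sec V) :
    (M.σ V ^ m) (X.app h f) = (-1 : ℤ) ^ (n * m) • X.app h ((M.σ V ^ m) f) := by
  induction m with
  | zero => simp
  | succ m ih =>
    rw [pow_succ', AlgHom.mul_apply, ih, map_zsmul, hX.parity, smul_smul, ← pow_add,
      AlgHom.mul_apply]
    congr 2

theorem IsDerivation.hasParity {n m : ℕ} {X : M.Endo U} (hX : M.IsDerivation n X) (h : V ≤ U)
    {f : M.Sec V} (hf : M.HasParity m f) : M.HasParity (n + m) (X.app h f) := by
  rw [HasParity, hX.parity, hf, map_zsmul, smul_smul, pow_add]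

/-- The supercommutator of two vector fields is a vector field. -/
theorem IsDerivation.bracket {m n : ℕ} {X Y : M.Endo U} (hX : M.IsDerivation m X)
    (hY : M.IsDerivation n Y) : M.IsDerivation (m + n) (X * Y - (-1 : ℤ) ^ (m * n) • (Y * X)) where
  parity {V} h f := by
    have : ∀ g : M.Sec V, (X * Y - (-1 : ℤ) ^ (m * n) • (Y * X)).app h g =
        X.app h (Y.app h g) - (-1 : ℤ) ^ (m * n) • Y.app h (X.app h g) := fun g => by
      rcases neg_one_pow_eq_or ℤ (m * n) with h1 | h1 <;> rw [h1]
      · simp only [one_smul]; rfl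
      · simp only [neg_smul, one_smul, sub_neg_eq_add]; rfl
    rw [this, this, map_sub, map_zsmul, hX.parity, hY.parity, hY.parity, hX.parity, map_zsmul,
      map_zsmul]
    simp only [smul_sub, smul_smul, pow_add]
    congr 2
    ring
  leibniz {V} h f g := by
    have : ∀ g : M.Sec V, (X * Y - (-1 : ℤ) ^ (m * n) • (Y * X)).app h g =
        X.app h (Y.app h g) - (-1 : ℤ) ^ (m * n) • Y.app h (X.app h g) := fun g => by
      rcases neg_one_pow_eq_or ℤ (m * n) with h1 | h1 <;> rw [h1]
      · simp only [one_smul]; rfl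
      · simp only [neg_smul, one_smul, sub_neg_eq_add]; rfl
    rw [this, this, this, hX.leibniz, hY.leibniz, map_add, map_add, hX.leibniz, hX.leibniz,
      hY.leibniz, hY.leibniz, hX.parity_pow, hY.parity_pow, mul_comm n m]
    have h2 : (M.σ V ^ n) ((M.σ V ^ m) f) = (M.σ V ^ (m + n)) f := by
      rw [← AlgHom.mul_apply, ← pow_add, add_comm]
    have h3 : (M.σ V ^ m) ((M.σ V ^ n) f) = (M.σ V ^ (m + n)) f := by
      rw [← AlgHom.mul_apply, ← pow_add]
    rw [h2, h3]
    rcases neg_one_pow_eq_or ℤ (m * n) with h1 | h1 <;> rw [h1] <;>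
      simp only [one_smul, neg_smul] <;> noncomm_ring

end Parity

/-! ### The parity of differential operators and supercommutators with functions. -/

section Operators

variable (M U) in
/-- Conjugation of endomorphisms of the structure sheaf by the parity involution. -/
def conjEndo : M.Endo U →ₐ[K] M.Endo U where
  toFun P := ⟨fun V => (M.σ V.1).toLinearMap ∘ₗ P.app V.2 ∘ₗ (M.σ V.1).toLinearMap,
    fun V W h f => by
      change M.res h (M.σ V.1 (P.app V.2 (M.σ V.1 f))) = M.σ W.1 (P.app W.2 (M.σ W.1 (M.res h f)))
      rw [res_σ, Endo.res_app, res_σ]⟩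
  map_one' := Endo.ext fun V hV f => M.σ_σ f
  map_mul' P Q := Endo.ext fun V hV f => by
    change M.σ V (P.app hV (Q.app hV (M.σ V f))) =
      M.σ V (P.app hV (M.σ V (M.σ V (Q.app hV (M.σ V f)))))
    rw [σ_σ]
  map_zero' := Endo.ext fun V hV f => map_zero (M.σ V)
  map_add' P Q := Endo.ext fun V hV f => map_add (M.σ V) _ _
  commutes' r := Endo.ext fun V hV f => by
    change M.σ V (r • M.σ V f) = r • f
    rw [map_smul, σ_σ]

theorem conjEndo_app (P : M.Endo U) (h : V ≤ U) (f : M.Sec V) :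
    (conjEndo M U P).app h f = M.σ V (P.app h (M.σ V f)) := rfl

theorem conjEndo_mulOp (f : M.Sec U) : conjEndo M U (M.mulOp U f) = M.mulOp U (M.σ U f) :=
  Endo.ext fun V hV g => by
    rw [conjEndo_app, mulOp_app, mulOp_app, map_mul, σ_σ, res_σ]

theorem Endo.zsmul_app (P : M.Endo U) (n : ℤ) (h : V ≤ U) (f : M.Sec V) :
    (n • P).app h f = n • P.app h f := by
  let F : M.Endo U →+ M.Sec V :=
    { toFun := fun P => P.app h f, map_zero' := rfl, map_add' := fun _ _ => rfl }
  exact map_zsmul F n P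

theorem conjEndo_derivation {n : ℕ} {X : M.Endo U} (hX : M.IsDerivation n X) :
    conjEndo M U X = (-1 : ℤ) ^ n • X :=
  Endo.ext fun V hV g => by
    rw [conjEndo_app, hX.parity, σ_σ, Endo.zsmul_app]

/-- Conjugation sends multiplication operators to multiplication operators and changes homogeneous
vector fields by a sign, so it preserves the algebra they generate. -/
theorem conjEndo_mem_genDiff {P : M.Endo U} (hP : P ∈ M.genDiff U) :
    conjEndo M U P ∈ M.genDiff U := by
  have : M.genDiff U ≤ (M.genDiff U).comap (conjEndo M U) := by
    refine Algebra.adjoin_le ?_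
    rintro X (⟨f, rfl⟩ | ⟨n, hX⟩)
    · refine Algebra.subset_adjoin (Or.inl ⟨M.σ U f, ?_⟩)
      rw [RingHom.coe_coe, conjEndo_mulOp]
    · change conjEndo M U X ∈ M.genDiff U
      rw [conjEndo_derivation hX]
      have : X ∈ M.genDiff U := Algebra.subset_adjoin (Or.inr ⟨n, hX⟩)
      exact zsmul_mem this _
  exact this hP

variable (M U) in
/-- The parity involution on differential operators. -/
def conjDiff : M.Diff U →ₐ[K] M.Diff U :=
  ((conjEndo M U).comp (M.diffSubalgebra U).val).codRestrict (M.diffSubalgebra U) (fun P x hx => by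
    obtain ⟨W, hW, hxW, hP⟩ := P.2 x hx
    exact ⟨W, hW, hxW, conjEndo_mem_genDiff hP⟩)

theorem conjDiff_fnOp (f : M.Sec U) : conjDiff M U (M.fnOp U f) = M.fnOp U (M.σ U f) :=
  Subtype.ext (conjEndo_mulOp f)

variable (M U) in
/-- The inclusion of the differential operators into all endomorphisms. -/
def Diff.incl : M.Diff U →ₐ[K] M.Endo U := (M.diffSubalgebra U).val

theorem Diff.val_zsmul (n : ℤ) (P : M.Diff U) : (n • P).1 = n • (P.1 : M.Endo U) :=
  map_zsmul (Diff.incl M U) n P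

theorem Diff.val_sum {ι : Type*} (s : Finset ι) (P : ι → M.Diff U) :
    (∑ i ∈ s, P i).1 = ∑ i ∈ s, ((P i).1 : M.Endo U) :=
  map_sum (Diff.incl M U) P s

theorem conjDiff_vecOp {n : ℕ} {X : M.Endo U} (hX : M.IsDerivation n X) :
    conjDiff M U (M.vecOp X hX) = (-1 : ℤ) ^ n • M.vecOp X hX :=
  Subtype.ext ((conjEndo_derivation hX).trans (Diff.val_zsmul ((-1) ^ n) (M.vecOp X hX)).symm)

theorem conjDiff_pow_fnOp (n : ℕ) (f : M.Sec U) :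
    (conjDiff M U ^ n) (M.fnOp U f) = M.fnOp U ((M.σ U ^ n) f) := by
  induction n with
  | zero => rfl
  | succ n ih => rw [pow_succ', pow_succ', AlgHom.mul_apply, AlgHom.mul_apply, ih, conjDiff_fnOp]

theorem conjDiff_pow_vecOp (m : ℕ) {n : ℕ} {X : M.Endo U} (hX : M.IsDerivation n X) :
    (conjDiff M U ^ m) (M.vecOp X hX) = (-1 : ℤ) ^ (n * m) • M.vecOp X hX := by
  induction m with
  | zero => simp
  | succ m ih =>
    rw [pow_succ', AlgHom.mul_apply, ih, map_zsmul, conjDiff_vecOp, smul_smul, ← pow_add]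
    congr 2

theorem resDiff_conjDiff (h : V ≤ U) (P : M.Diff U) :
    M.resDiff h (conjDiff M U P) = conjDiff M V (M.resDiff h P) := rfl

theorem resDiff_conjDiff_pow (h : V ≤ U) (n : ℕ) (P : M.Diff U) :
    M.resDiff h ((conjDiff M U ^ n) P) = (conjDiff M V ^ n) (M.resDiff h P) := by
  induction n with
  | zero => rfl
  | succ n ih =>
    rw [pow_succ', pow_succ', AlgHom.mul_apply, AlgHom.mul_apply, resDiff_conjDiff, ih]

theorem resDiff_resDiff (h : V ≤ U) (h' : W ≤ V) (P : M.Diff U) :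
    M.resDiff h' (M.resDiff h P) = M.resDiff (h'.trans h) P := rfl

theorem resDiff_self (h : U ≤ U) (P : M.Diff U) : M.resDiff h P = P := rfl

theorem fnOp_injective : Function.Injective (M.fnOp U) := fun f g h => by
  have : (M.fnOp U f).1.app le_rfl 1 = (M.fnOp U g).1.app le_rfl 1 := by rw [h]
  change M.res le_rfl f * 1 = M.res le_rfl g * 1 at this
  rwa [mul_one, mul_one, res_self, res_self] at this

theorem vecOp_mul_fnOp {n : ℕ} {X : M.Endo U} (hX : M.IsDerivation n X) (f : M.Sec U) :
    M.vecOp X hX * M.fnOp U f =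
      M.fnOp U (X.ev f) + M.fnOp U ((M.σ U ^ n) f) * M.vecOp X hX := by
  refine Subtype.ext (Endo.ext fun V hV g => ?_)
  change X.app hV (M.res hV f * g) = M.res hV (X.ev f) * g +
    M.res hV ((M.σ U ^ n) f) * X.app hV g
  rw [hX.leibniz, res_σ_pow, Endo.res_app]

/-- The supercommutator `P ↦ x P - (-1)^{n|P|} P x` with a function `x` of parity `n`. -/
def ad (n : ℕ) (x : M.Sec U) : M.Diff U →ₗ[K] M.Diff U :=
  LinearMap.mulLeft K (M.fnOp U x) -
    LinearMap.mulRight K (M.fnOp U x) ∘ₗ (conjDiff M U ^ n).toLinearMap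

theorem ad_apply (n : ℕ) (x : M.Sec U) (P : M.Diff U) :
    ad n x P = M.fnOp U x * P - (conjDiff M U ^ n) P * M.fnOp U x := rfl

/-- Being a twisted derivation, `ad` is computed on products from its values on functions (zero, by
supercommutativity) and on vector fields (∓X(x)). -/
theorem ad_mul (n : ℕ) (x : M.Sec U) (P Q : M.Diff U) :
    ad n x (P * Q) = ad n x P * Q + (conjDiff M U ^ n) P * ad n x Q := by
  rw [ad_apply, ad_apply, ad_apply, map_mul]
  noncomm_ring

theorem ad_fnOp {n : ℕ} {x : M.Sec U} (hx : M.HasParity n x) (f : M.Sec U) :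
    ad n x (M.fnOp U f) = 0 := by
  rw [ad_apply, conjDiff_pow_fnOp, ← map_mul, ← map_mul, mul_eq_σ_pow_mul hx, sub_self]

theorem ad_vecOp {m n : ℕ} {x : M.Sec U} (hx : M.HasParity m x) {X : M.Endo U}
    (hX : M.IsDerivation n X) :
    ad m x (M.vecOp X hX) = -((-1 : ℤ) ^ (m * n) • M.fnOp U (X.ev x)) := by
  rw [ad_apply, conjDiff_pow_vecOp, smul_mul_assoc, vecOp_mul_fnOp, σ_pow_hom hx, map_zsmul,
    smul_mul_assoc, smul_add, mul_comm n m, neg_one_pow_smul_smul]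
  abel

theorem resDiff_ad (h : V ≤ U) (n : ℕ) (x : M.Sec U) (P : M.Diff U) :
    M.resDiff h (ad n x P) = ad n (M.res h x) (M.resDiff h P) := by
  rw [ad_apply, ad_apply, map_sub, map_mul, map_mul, resDiff_fnOp, resDiff_conjDiff_pow]

end Operators

/-! ### Normal form of differential operators with coefficients on the right. -/

namespace Coords

variable (c : M.Coords p q U)

/-- The supercommutator is a vector field that kills every coordinate, because ∂_b x_e is constant;
such a field is zero. -/
theorem delOp_mul_delOp (a b : Fin p ⊕ Fin q) :
    c.delOp a * c.delOp b = (-1 : ℤ) ^ (par a * par b : ℕ) • (c.delOp b * c.delOp a) := by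
  rw [← sub_eq_zero]
  refine Subtype.ext ?_
  have hv : (c.delOp a * c.delOp b - (-1 : ℤ) ^ (par a * par b : ℕ) • (c.delOp b * c.delOp a)).1 =
      c.del a * c.del b - (-1 : ℤ) ^ (par a * par b : ℕ) • (c.del b * c.del a) :=
    congrArg (fun Q => c.del a * c.del b - Q) (Diff.val_zsmul _ _)
  rw [hv]
  refine c.eq_zero le_rfl _ _ ((c.del_isDerivation a).bracket (c.del_isDerivation b)) fun e => ?_
  have h0 : ∀ i j : Fin p ⊕ Fin q, (c.del i).ev ((c.del j).ev (c.x e)) = 0 := by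
    intro i j
    have h1 : (c.del i).ev 1 = 0 := by
      have := (c.del_isDerivation i).leibniz le_rfl 1 1
      simpa using this
    rw [c.del_x]
    split
    · exact h1
    · exact map_zero _
  rw [res_self, Endo.sub_app, Endo.zsmul_app, Endo.mul_app, Endo.mul_app, h0, h0, smul_zero,
    sub_zero]

/-- The canonical commutation relation between x_a and ∂_b on the operator side. -/
theorem ad_delOp_mul (a b : Fin p ⊕ Fin q) (P : M.Diff U) :
    ad (par a) (c.x a) (c.delOp b * P) = (-1 : ℤ) ^ (par a * par b : ℕ) •
      (c.delOp b * ad (par a) (c.x a) P - if a = b then P else 0) := by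
  rw [ad_mul, delOp, conjDiff_pow_vecOp, ad_vecOp (c.x_parity a), c.del_x b a, smul_mul_assoc,
    mul_comm (par b), neg_mul, smul_mul_assoc, smul_sub]
  by_cases h : a = b
  · subst h; simp [sub_eq_neg_add]
  · simp [h, Ne.symm h]

/-- The product of the coordinate vector fields over a list of indices. -/
def delMon (l : List (Fin p ⊕ Fin q)) : M.Diff U := (l.map c.delOp).prod

theorem delMon_cons (a : Fin p ⊕ Fin q) (l : List (Fin p ⊕ Fin q)) :
    c.delMon (a :: l) = c.delOp a * c.delMon l := by
  rw [delMon, List.map_cons, List.prod_cons, delMon]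

theorem delMon_nil : c.delMon [] = 1 := rfl

theorem delMon_append (l l' : List (Fin p ⊕ Fin q)) :
    c.delMon (l ++ l') = c.delMon l * c.delMon l' := by
  rw [delMon, List.map_append, List.prod_append, delMon, delMon]

/-- [x_a, ·] deletes one factor ∂_a at a time and ∂_a puts it back; the sign from moving ∂_a past
∂_b cancels the one in `ad_delOp_mul`, so every occurrence contributes equally. -/
theorem delOp_mul_ad_delMon (a : Fin p ⊕ Fin q) (l : List (Fin p ⊕ Fin q)) (f : M.Sec U) :
    c.delOp a * ad (par a) (c.x a) (c.delMon l * M.fnOp U f) =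
      -((-1 : ℤ) ^ (par a) • (l.count a • (c.delMon l * M.fnOp U f))) := by
  induction l with
  | nil => simp [delMon, ad_fnOp (c.x_parity a)]
  | cons b l ih =>
    rw [delMon_cons, mul_assoc, ad_delOp_mul, mul_smul_comm, mul_sub, ← mul_assoc, delOp_mul_delOp,
      smul_mul_assoc, mul_assoc, ih, smul_sub, neg_one_pow_smul_smul]
    by_cases h : a = b
    · subst h
      have h2 : (-1 : ℤ) ^ (par a * par a) = (-1) ^ par a := neg_one_pow_eq (by
        rcases a with i | i <;> simp [par])
      rw [List.count_cons_self, if_pos rfl, h2, mul_neg, mul_smul_comm, mul_smul_comm, succ_nsmul,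
        smul_add]
      abel
    · rw [List.count_cons_of_ne (Ne.symm h), if_neg h, mul_zero, smul_zero, sub_zero, mul_neg,
        mul_smul_comm, mul_smul_comm]

/-- The span of the operators `∂_{a_1} … ∂_{a_n} f`. -/
def delSpan : Submodule K (M.Diff U) :=
  Submodule.span K {P | ∃ (l : List (Fin p ⊕ Fin q)) (f : M.Sec U), P = c.delMon l * M.fnOp U f}

theorem delMon_mul_fnOp_mem (l : List (Fin p ⊕ Fin q)) (f : M.Sec U) :
    c.delMon l * M.fnOp U f ∈ c.delSpan := Submodule.subset_span ⟨l, f, rfl⟩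

theorem delOp_mul_mem (a : Fin p ⊕ Fin q) {P : M.Diff U} (hP : P ∈ c.delSpan) :
    c.delOp a * P ∈ c.delSpan := by
  induction hP using Submodule.span_induction with
  | mem P h =>
    obtain ⟨l, f, rfl⟩ := h
    rw [← mul_assoc, ← delMon_cons]
    exact c.delMon_mul_fnOp_mem _ _
  | zero => rw [mul_zero]; exact zero_mem _
  | add P Q _ _ h h' => rw [mul_add]; exact add_mem h h'
  | smul r P _ h => rw [mul_smul_comm]; exact Submodule.smul_mem _ _ h

theorem fnOp_mul_delOp (a : Fin p ⊕ Fin q) (f : M.Sec U) :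
    M.fnOp U f * c.delOp a = c.delOp a * M.fnOp U ((M.σ U ^ par a) f) -
      M.fnOp U ((c.del a).ev ((M.σ U ^ par a) f)) := by
  rw [delOp_mul_fnOp, σ_pow_σ_pow, add_sub_cancel_left]

/-- Moving f to the right past ∂_a costs a parity twist of f and a term with one derivative fewer.
-/
theorem fnOp_mul_mem (f : M.Sec U) {P : M.Diff U} (hP : P ∈ c.delSpan) :
    M.fnOp U f * P ∈ c.delSpan := by
  induction hP using Submodule.span_induction with
  | mem P h =>
    obtain ⟨l, g, rfl⟩ := h
    -- The induction replaces f by its twist and by a derivative of it, so f must vary.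
    induction l generalizing f with
    | nil =>
      rw [delMon_nil, one_mul, ← map_mul]
      simpa [delMon_nil] using c.delMon_mul_fnOp_mem [] (f * g)
    | cons a l ih =>
      rw [delMon_cons, ← mul_assoc, ← mul_assoc, fnOp_mul_delOp, sub_mul, sub_mul]
      refine sub_mem ?_ ?_
      · rw [mul_assoc, mul_assoc]
        refine c.delOp_mul_mem a ?_
        rw [← mul_assoc]
        simpa [mul_assoc] using ih _
      · simpa [mul_assoc] using ih _
  | zero => rw [mul_zero]; exact zero_mem _
  | add P Q _ _ h h' => rw [mul_add]; exact add_mem h h'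
  | smul r P _ h => rw [mul_smul_comm]; exact Submodule.smul_mem _ _ h

theorem delSpan_mul_mem {P Q : M.Diff U} (hP : P ∈ c.delSpan) (hQ : Q ∈ c.delSpan) :
    P * Q ∈ c.delSpan := by
  induction hP using Submodule.span_induction with
  | mem P h =>
    obtain ⟨l, f, rfl⟩ := h
    rw [mul_assoc]
    have := c.fnOp_mul_mem f hQ
    revert this
    generalize M.fnOp U f * Q = R
    intro hR
    induction l with
    | nil => rwa [delMon_nil, one_mul]
    | cons a l ih =>
      rw [delMon_cons, mul_assoc]
      exact c.delOp_mul_mem a ih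
  | zero => rw [zero_mul]; exact zero_mem _
  | add P Q _ _ h h' => rw [add_mul]; exact add_mem h h'
  | smul r P _ h => rw [smul_mul_assoc]; exact Submodule.smul_mem _ _ h

theorem fnOp_mem (f : M.Sec U) : M.fnOp U f ∈ c.delSpan := by
  simpa [delMon_nil] using c.delMon_mul_fnOp_mem [] f

theorem delOp_mem (a : Fin p ⊕ Fin q) : c.delOp a ∈ c.delSpan := by
  simpa using c.delOp_mul_mem a (c.fnOp_mem 1)

theorem vecOp_eq_sum {n : ℕ} {X : M.Endo U} (hX : M.IsDerivation n X) :
    M.vecOp X hX = ∑ a, M.fnOp U (X.ev (c.x a)) * c.delOp a :=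
  Subtype.ext ((c.eq_sum hX).trans
    (Diff.val_sum Finset.univ fun a => M.fnOp U (X.ev (c.x a)) * c.delOp a).symm)

/-- Functions lie in the span, vector fields do by X = Σ X(x_a) ∂_a, and the span is closed under
products. A general section of D_M satisfies the hypothesis only locally, which is why later
arguments shrink the domain. -/
theorem mem_delSpan {P : M.Diff U} (hP : P.1 ∈ M.genDiff U) : P ∈ c.delSpan := by
  have key : ∀ P : M.Endo U, P ∈ M.genDiff U → ∃ Q ∈ c.delSpan, Q.1 = P := by
    intro P hP
    induction hP using Algebra.adjoin_induction with
    | mem P h =>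
      rcases h with ⟨f, rfl⟩ | ⟨n, hX⟩
      · exact ⟨M.fnOp U f, c.fnOp_mem f, rfl⟩
      · refine ⟨M.vecOp P hX, ?_, rfl⟩
        rw [c.vecOp_eq_sum]
        exact sum_mem fun a _ => c.fnOp_mul_mem _ (c.delOp_mem a)
    | algebraMap r =>
      refine ⟨algebraMap K _ r, ?_, rfl⟩
      rw [← (M.fnOp U).commutes]
      exact c.fnOp_mem _
    | add P P' _ _ h h' =>
      obtain ⟨Q, hQ, rfl⟩ := h
      obtain ⟨Q', hQ', rfl⟩ := h'
      exact ⟨Q + Q', add_mem hQ hQ', rfl⟩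
    | mul P P' _ _ h h' =>
      obtain ⟨Q, hQ, rfl⟩ := h
      obtain ⟨Q', hQ', rfl⟩ := h'
      exact ⟨Q * Q', c.delSpan_mul_mem hQ hQ', rfl⟩
  obtain ⟨Q, hQ, h⟩ := key P.1 hP
  exact (Subtype.ext h : Q = P) ▸ hQ

/-- The operator with eigenvectors `∂_{a_1} … ∂_{a_n} f` of eigenvalue `n`. -/
def euler : Module.End K (M.Diff U) :=
  ∑ a, -((-1 : ℤ) ^ (par a) • (LinearMap.mulLeft K (c.delOp a) ∘ₗ ad (par a) (c.x a)))

theorem euler_delMon (l : List (Fin p ⊕ Fin q)) (f : M.Sec U) :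
    c.euler (c.delMon l * M.fnOp U f) = (l.length : K) • (c.delMon l * M.fnOp U f) := by
  have h1 : ∀ a, (-((-1 : ℤ) ^ (par a) • (LinearMap.mulLeft K (c.delOp a) ∘ₗ ad (par a) (c.x a))))
      (c.delMon l * M.fnOp U f) = l.count a • (c.delMon l * M.fnOp U f) := fun a => by
    rw [LinearMap.neg_apply, LinearMap.smul_apply, LinearMap.comp_apply, LinearMap.mulLeft_apply,
      delOp_mul_ad_delMon, smul_neg, neg_neg, neg_one_pow_smul_smul]
  rw [euler, LinearMap.sum_apply, Finset.sum_congr rfl fun a _ => h1 a, ← Finset.sum_smul]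
  -- The multiplicities of all indices add up to the length, which is the eigenvalue.
  have h2 : ∑ a, l.count a = l.length := by
    clear h1
    induction l with
    | nil => simp
    | cons b l ih =>
      simp only [List.count_cons, Finset.sum_add_distrib, ih, List.length_cons, beq_iff_eq,
        Finset.sum_ite_eq, Finset.mem_univ, if_true]
  rw [h2, Nat.cast_smul_eq_nsmul]

/-- A function has `euler` eigenvalue 0, whereas the right-hand side is a sum of eigenvectors of
positive length. These lengths are nonzero in K, and eigenspaces are independent. -/
theorem eq_zero_of_fnOp_eq_sum {g : M.Sec U} {Q : Fin p ⊕ Fin q → M.Diff U}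
    (hQ : ∀ a, Q a ∈ c.delSpan) (h : M.fnOp U g = ∑ a, c.delOp a * Q a) : g = 0 := by
  have h0 : M.fnOp U g ∈ c.euler.eigenspace (0 : K) := by
    rw [Module.End.mem_eigenspace_iff]
    simpa [delMon_nil] using c.euler_delMon [] g
  have h1 : M.fnOp U g ∈ ⨆ (r : K) (_ : r ≠ 0), c.euler.eigenspace r := by
    rw [h]
    refine sum_mem fun a _ => ?_
    have := hQ a
    generalize Q a = P at this
    induction this using Submodule.span_induction with
    | mem P h =>
      obtain ⟨l, f, rfl⟩ := h
      rw [← mul_assoc, ← delMon_cons]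
      refine Submodule.mem_iSup_of_mem ((a :: l).length : K) (Submodule.mem_iSup_of_mem ?_ ?_)
      · exact Nat.cast_ne_zero.2 (by simp)
      · exact Module.End.mem_eigenspace_iff.2 (c.euler_delMon _ _)
    | zero => rw [mul_zero]; exact zero_mem _
    | add P Q _ _ h h' => rw [mul_add]; exact add_mem h h'
    | smul r P _ h => rw [mul_smul_comm]; exact Submodule.smul_mem _ _ h
  have h2 := (Module.End.eigenspaces_iSupIndep c.euler) 0
  have h3 := Submodule.disjoint_def.1 h2 _ h0 h1
  exact fnOp_injective (h3.trans (map_zero _).symm)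

end Coords

/-! ### Reduction of differential operators modulo Σ ∂_a D_M. -/

theorem exists_genDiff_nhd (P : M.Diff U) {x : M.space} (hx : x ∈ U) :
    ∃ (V : Opens M.space) (h : V ≤ U), x ∈ V ∧ (M.resDiff h P).1 ∈ M.genDiff V := P.2 x hx

theorem exists_genDiff_nhd_finite {ι : Type*} [Finite ι] (P : ι → M.Diff U) {x : M.space}
    (hx : x ∈ U) :
    ∃ (V : Opens M.space) (h : V ≤ U), x ∈ V ∧ ∀ i, (M.resDiff h (P i)).1 ∈ M.genDiff V := by
  choose V hV hxV hP using fun i => exists_genDiff_nhd (P i) hx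
  -- The factor U keeps the neighbourhood inside U also when the family is empty.
  refine ⟨U ⊓ ⨅ i, V i, inf_le_left, ⟨hx, ?_⟩, fun i => ?_⟩
  · rw [Opens.coe_iInf, Set.mem_iInter]
    exact hxV
  · exact M.genDiff_res ((inf_le_right.trans (iInf_le V i) : U ⊓ ⨅ i, V i ≤ V i)) (hP i)

namespace Coords

variable (c : M.Coords p q U)

/-- Only the coordinate functions need `res_res`; the vector fields agree definitionally and the
remaining fields are proofs. -/
theorem restrict_restrict (h : V ≤ U) (h' : W ≤ V) :
    (c.restrict h).restrict h' = c.restrict (h'.trans h) := by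
  have : ∀ (x y : Fin p ⊕ Fin q → M.Sec W) (hxy : x = y) (del h1 h2 h3 h4 h1' h2' h3' h4'),
      (⟨x, del, h1, h2, h3, h4⟩ : M.Coords p q W) = ⟨y, del, h1', h2', h3', h4'⟩ := by
    rintro x y rfl del _ _ _ _ _ _ _ _; rfl
  exact this _ _ (funext fun a => M.res_res h h' _) _ _ _ _ _ _ _ _ _

theorem resDiff_delOp (h : V ≤ U) (a : Fin p ⊕ Fin q) :
    M.resDiff h (c.delOp a) = (c.restrict h).delOp a := rfl

/-- `P` is congruent to the function `g` modulo `∑ ∂_a D_M`, locally. -/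
def Reduces (P : M.Diff U) (g : M.Sec U) : Prop :=
  ∀ x ∈ U, ∃ (V : Opens M.space) (h : V ≤ U), x ∈ V ∧ ∃ Q : Fin p ⊕ Fin q → M.Diff V,
    M.resDiff h P = M.fnOp V (M.res h g) + ∑ a, (c.restrict h).delOp a * Q a

variable {c}

theorem Reduces.restrict {P : M.Diff U} {g : M.Sec U} (hg : c.Reduces P g) (h : V ≤ U) :
    (c.restrict h).Reduces (M.resDiff h P) (M.res h g) := fun x hx => by
  obtain ⟨W, hW, hxW, Q, hQ⟩ := hg x (h hx)
  refine ⟨V ⊓ W, inf_le_left, ⟨hx, hxW⟩, fun a => M.resDiff inf_le_right (Q a), ?_⟩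
  have := congrArg (M.resDiff (inf_le_right : V ⊓ W ≤ W)) hQ
  rw [map_add, map_sum, resDiff_fnOp, res_res, resDiff_resDiff] at this
  rw [resDiff_resDiff, this, res_res]
  congr 1

theorem Reduces.of_locally {P : M.Diff U} {g : M.Sec U}
    (h : ∀ x ∈ U, ∃ (V : Opens M.space) (h : V ≤ U), x ∈ V ∧
      (c.restrict h).Reduces (M.resDiff h P) (M.res h g)) : c.Reduces P g := fun x hx => by
  obtain ⟨V, hV, hxV, h1⟩ := h x hx
  obtain ⟨W, hW, hxW, Q, hQ⟩ := h1 x hxV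
  refine ⟨W, hW.trans hV, hxW, Q, ?_⟩
  rw [resDiff_resDiff, res_res] at hQ
  exact hQ

theorem Reduces.add {P P' : M.Diff U} {g g' : M.Sec U} (h : c.Reduces P g) (h' : c.Reduces P' g') :
    c.Reduces (P + P') (g + g') := fun x hx => by
  obtain ⟨V, hV, hxV, Q, hQ⟩ := h x hx
  obtain ⟨W, hW, hxW, R, hR⟩ := h'.restrict hV x hxV
  refine ⟨W, hW.trans hV, hxW, fun a => M.resDiff hW (Q a) + R a, ?_⟩
  rw [resDiff_resDiff, res_res] at hR
  have := congrArg (M.resDiff hW) hQ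
  rw [map_add, map_sum, resDiff_fnOp, res_res, resDiff_resDiff] at this
  rw [map_add, map_add, map_add, this, hR]
  simp only [mul_add, Finset.sum_add_distrib, map_mul, resDiff_delOp, restrict_restrict]
  abel

theorem Reduces.mul_fnOp {P : M.Diff U} {g : M.Sec U} (h : c.Reduces P g) (f : M.Sec U) :
    c.Reduces (P * M.fnOp U f) (g * f) := fun x hx => by
  obtain ⟨V, hV, hxV, Q, hQ⟩ := h x hx
  refine ⟨V, hV, hxV, fun a => Q a * M.fnOp V (M.res hV f), ?_⟩
  rw [map_mul, hQ, map_mul, map_mul, resDiff_fnOp, add_mul, Finset.sum_mul]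
  simp only [mul_assoc]

theorem reduces_fnOp (g : M.Sec U) : c.Reduces (M.fnOp U g) g := fun x hx =>
  ⟨U, le_rfl, hx, fun _ => 0, by simp [resDiff_fnOp]⟩

theorem reduces_sum (Q : Fin p ⊕ Fin q → M.Diff U) : c.Reduces (∑ a, c.delOp a * Q a) 0 :=
  fun x hx => ⟨U, le_rfl, hx, Q, by
    rw [map_zero, map_zero, zero_add, resDiff_self]
    rfl⟩

theorem reduces_delOp_mul (a : Fin p ⊕ Fin q) (P : M.Diff U) : c.Reduces (c.delOp a * P) 0 := by
  classical
  have := reduces_sum (c := c) (fun b => if b = a then P else 0)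
  simpa using this

theorem Reduces.smul {P : M.Diff U} {g : M.Sec U} (h : c.Reduces P g) (r : K) :
    c.Reduces (r • P) (r • g) := by
  have := h.mul_fnOp (algebraMap K _ r)
  rwa [(M.fnOp U).commutes, ← Algebra.commutes, ← Algebra.commutes, ← Algebra.smul_def,
    ← Algebra.smul_def] at this

/-- After shrinking until all cofactors are in normal form, `eq_zero_of_fnOp_eq_sum` applies;
vanishing of g is local. -/
theorem Reduces.unique_zero {g : M.Sec U} (h : c.Reduces 0 g) : g = 0 := by
  refine sec_eq_of_locally_eq fun x hx => ?_
  obtain ⟨V, hV, hxV, Q, hQ⟩ := h x hx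
  obtain ⟨W, hW, hxW, hg⟩ := exists_genDiff_nhd_finite Q hxV
  refine ⟨W, hW.trans hV, hxW, ?_⟩
  have := congrArg (M.resDiff hW) hQ
  rw [map_zero, map_zero, map_add, map_sum, resDiff_fnOp, res_res, eq_comm,
    ← eq_neg_iff_add_eq_zero] at this
  rw [map_zero]
  refine (c.restrict (hW.trans hV)).eq_zero_of_fnOp_eq_sum
    (Q := fun a => -M.resDiff hW (Q a)) (fun a => neg_mem (mem_delSpan _ (hg a))) ?_
  rw [this, ← Finset.sum_neg_distrib]
  refine Finset.sum_congr rfl fun a _ => ?_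
  rw [map_mul, mul_neg]
  rfl

theorem Reduces.unique {P : M.Diff U} {g g' : M.Sec U} (h : c.Reduces P g)
    (h' : c.Reduces P g') : g = g' := by
  have := h.add (h'.smul (-1))
  rw [neg_one_smul, neg_one_smul, add_neg_cancel, ← sub_eq_add_neg] at this
  exact sub_eq_zero.1 this.unique_zero

theorem exists_reduces_of_mem {P : M.Diff U} (hP : P ∈ c.delSpan) : ∃ g, c.Reduces P g := by
  induction hP using Submodule.span_induction with
  | mem P h =>
    obtain ⟨l, f, rfl⟩ := h
    cases l with
    | nil =>
      rw [delMon_nil, one_mul]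
      exact ⟨f, reduces_fnOp f⟩
    | cons a l =>
      rw [delMon_cons, mul_assoc]
      exact ⟨0, reduces_delOp_mul a _⟩
  | zero => exact ⟨0, by simpa using reduces_fnOp (c := c) 0⟩
  | add P Q _ _ h h' =>
    obtain ⟨g, hg⟩ := h
    obtain ⟨g', hg'⟩ := h'
    exact ⟨_, hg.add hg'⟩
  | smul r P _ h =>
    obtain ⟨g, hg⟩ := h
    exact ⟨_, hg.smul r⟩

variable (c)

/-- The normal form gives reductions locally: monomials of positive length reduce to 0. Uniqueness
lets the local functions glue. -/
theorem exists_reduces (P : M.Diff U) : ∃ g, c.Reduces P g := by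
  obtain ⟨g, hg⟩ := existsUnique_sec_of_local
    (fun V h f => (c.restrict h).Reduces (M.resDiff h P) f)
    (fun hV hW f hf => by simpa only [restrict_restrict, resDiff_resDiff] using hf.restrict hW)
    (fun hV f g hf hg => hf.unique hg)
    (fun x hx => by
      obtain ⟨V, hV, hxV, h⟩ := exists_genDiff_nhd P hx
      exact ⟨V, hV, hxV, exists_reduces_of_mem ((c.restrict hV).mem_delSpan h)⟩)
  exact ⟨g, .of_locally hg⟩

/-- The function which is congruent to a given differential operator modulo `∑ ∂_a D_M`. -/
def red : M.Diff U →ₗ[K] M.Sec U where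
  toFun P := (c.exists_reduces P).choose
  map_add' P Q := (c.exists_reduces _).choose_spec.unique
    ((c.exists_reduces P).choose_spec.add (c.exists_reduces Q).choose_spec)
  map_smul' r P := (c.exists_reduces _).choose_spec.unique
    ((c.exists_reduces P).choose_spec.smul r)

theorem reduces_red (P : M.Diff U) : c.Reduces P (c.red P) := (c.exists_reduces P).choose_spec

theorem red_eq {P : M.Diff U} {g : M.Sec U} (h : c.Reduces P g) : c.red P = g :=
  (c.reduces_red P).unique h

theorem red_fnOp (f : M.Sec U) : c.red (M.fnOp U f) = f := c.red_eq (reduces_fnOp f)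

theorem red_delOp_mul (a : Fin p ⊕ Fin q) (P : M.Diff U) : c.red (c.delOp a * P) = 0 :=
  c.red_eq (reduces_delOp_mul a P)

theorem red_mul_fnOp (P : M.Diff U) (f : M.Sec U) : c.red (P * M.fnOp U f) = c.red P * f :=
  c.red_eq ((c.reduces_red P).mul_fnOp f)

theorem res_red (h : V ≤ U) (P : M.Diff U) :
    M.res h (c.red P) = (c.restrict h).red (M.resDiff h P) :=
  ((c.restrict h).red_eq ((c.reduces_red P).restrict h)).symm

/-- Σ ∂_a D_M is a right ideal, so P may be replaced by its reduction before multiplying by Q. This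
becomes associativity of the action on Ber(M). -/
theorem red_red_mul (P Q : M.Diff U) : c.red (M.fnOp U (c.red P) * Q) = c.red (P * Q) := by
  refine sec_eq_of_locally_eq fun x hx => ?_
  obtain ⟨V, hV, hxV, R, hR⟩ := c.reduces_red P x hx
  refine ⟨V, hV, hxV, ?_⟩
  rw [res_red, res_red, map_mul (M.resDiff hV), map_mul (M.resDiff hV), resDiff_fnOp, hR, add_mul, map_add, Finset.sum_mul,
    map_sum, Finset.sum_eq_zero, add_zero]
  intro a _
  rw [mul_assoc, red_delOp_mul]

end Coords

/-! ### Twisted derivations of forms prescribed on generators. -/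

section Derivations

variable (M p q U) in
/-- The algebra morphism `ω ↦ [[σ^k ω, δ ω], [0, ω]]`, which encodes the derivation `δ` over `σ^k`
with given values on the generators. -/
def preDerMat (k : ℕ) (δ : M.Sec U ⊕ M.Sec U → M.Forms p q U) :
    PreForms U →ₐ[K] Matrix (Fin 2) (Fin 2) (M.Forms p q U) :=
  FreeAlgebra.lift K fun x =>
    !![(formσ M p q U ^ k) (mkForm M p q U (FreeAlgebra.ι K x)), δ x;
      0, mkForm M p q U (FreeAlgebra.ι K x)]

variable (M p q U) in
/-- The derivation over `σ^k` with given values on the generators. -/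
def preDer (k : ℕ) (δ : M.Sec U ⊕ M.Sec U → M.Forms p q U) : PreForms U →ₗ[K] M.Forms p q U where
  toFun a := preDerMat M p q U k δ a 0 1
  map_add' _ _ := by simp
  map_smul' _ _ := by simp

variable {k : ℕ} {δ : M.Sec U ⊕ M.Sec U → M.Forms p q U}

theorem preDerMat_apply (a : PreForms U) : preDerMat M p q U k δ a =
    !![(formσ M p q U ^ k) (mkForm M p q U a), preDer M p q U k δ a; 0, mkForm M p q U a] := by
  have key : ∀ a : PreForms U,
      preDerMat M p q U k δ a 0 0 = (formσ M p q U ^ k) (mkForm M p q U a) ∧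
      preDerMat M p q U k δ a 1 0 = 0 ∧ preDerMat M p q U k δ a 1 1 = mkForm M p q U a := by
    intro a
    induction a using FreeAlgebra.induction with
    | grade0 r => simp [Matrix.algebraMap_matrix_apply]
    | grade1 x => simp [preDerMat]
    | mul a b ha hb => simp [Matrix.mul_apply, ha, hb]
    | add a b ha hb => simp [ha, hb]
  obtain ⟨h1, h2, h3⟩ := key a
  ext i j
  fin_cases i <;> fin_cases j <;> simp [h1, h2, h3, preDer]

theorem preDer_mul (a b : PreForms U) : preDer M p q U k δ (a * b) =
    preDer M p q U k δ a * mkForm M p q U b +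
      (formσ M p q U ^ k) (mkForm M p q U a) * preDer M p q U k δ b := by
  change preDerMat M p q U k δ (a * b) 0 1 = _
  rw [map_mul, preDerMat_apply, preDerMat_apply, Matrix.mul_apply]
  simp [add_comm]

theorem preDer_fn (f : M.Sec U) : preDer M p q U k δ (preFn f) = δ (Sum.inl f) := by
  simp [preDer, preDerMat, preFn]

theorem preDer_df (f : M.Sec U) : preDer M p q U k δ (preDf f) = δ (Sum.inr f) := by
  simp [preDer, preDerMat, preDf]

theorem preDer_algebraMap (r : K) : preDer M p q U k δ (algebraMap K _ r) = 0 := by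
  simp [preDer, Matrix.algebraMap_matrix_apply]

end Derivations

/-! ### Parity and the exterior derivative. -/

section FormParity

theorem formσ_pow_two : formσ M p q U ^ 2 = 1 := by
  refine AlgHom.ext fun η => ?_
  rw [pow_two, AlgHom.mul_apply, AlgHom.one_apply]
  induction η using form_induction with
  | fn_hom n f _ => rw [formσ_fn, formσ_fn, σ_σ]
  | df_hom n f _ => rw [formσ_df, map_neg, formσ_df, σ_σ, neg_neg]
  | mul a b ha hb => rw [map_mul, map_mul, ha, hb]
  | add a b ha hb => rw [map_add, map_add, ha, hb]

theorem formσ_pow_formσ_pow (n : ℕ) (ω : M.Forms p q U) :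
    (formσ M p q U ^ n) ((formσ M p q U ^ n) ω) = ω := by
  rw [← AlgHom.mul_apply, ← pow_add, ← two_mul, pow_mul, formσ_pow_two, one_pow, AlgHom.one_apply]

theorem formσ_pow_df (n : ℕ) (f : M.Sec U) :
    (formσ M p q U ^ n) (df M p q U f) = (-1 : ℤ) ^ n • df M p q U ((M.σ U ^ n) f) := by
  induction n with
  | zero => simp
  | succ n ih =>
    rw [pow_succ', AlgHom.mul_apply, ih, map_zsmul, formσ_df, pow_succ', pow_succ',
      AlgHom.mul_apply, mul_smul]
    simp

theorem formσ_d (ω : M.Forms p q U) : formσ M p q U (d M p q U ω) = -d M p q U (formσ M p q U ω) := by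
  induction ω using form_induction with
  | fn_hom n f _ => rw [d_fn, formσ_df, formσ_fn, d_fn]
  | df_hom n f _ => rw [d_df, formσ_df, map_neg, d_df, map_zero, neg_zero, neg_zero]
  | mul a b ha hb =>
    rw [d_mul, map_add, map_mul, map_mul, map_mul, d_mul, ha, hb]
    noncomm_ring
  | add a b ha hb => rw [map_add, map_add, map_add, map_add, ha, hb, neg_add]

theorem formσ_pow_d (n : ℕ) (ω : M.Forms p q U) :
    (formσ M p q U ^ n) (d M p q U ω) = (-1 : ℤ) ^ n • d M p q U ((formσ M p q U ^ n) ω) := by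
  induction n with
  | zero => simp
  | succ n ih =>
    rw [pow_succ', AlgHom.mul_apply, ih, map_zsmul, formσ_d, AlgHom.mul_apply, pow_succ', mul_smul]
    simp

theorem preD_mul (a b : PreForms U) : preD (a * b) = preD a * b + preσ U a * preD b := by
  change preMat U (a * b) 0 1 = _
  rw [map_mul, preMat_apply, preMat_apply, Matrix.mul_apply]
  simp [add_comm]

theorem preD_fn (f : M.Sec U) : preD (preFn f) = preDf f := by
  simp [preD, preMat, preFn]

theorem preD_df (f : M.Sec U) : preD (preDf f) = 0 := by
  simp [preD, preMat, preDf]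

theorem preσ_fn (f : M.Sec U) : preσ U (preFn f) = preFn (M.σ U f) := by
  simp [preσ, preFn]

theorem preσ_df (f : M.Sec U) : preσ U (preDf f) = -preDf (M.σ U f) := by
  simp [preσ, preDf]

theorem preD_add (a b : PreForms U) : preD (a + b) = preD a + preD b := by
  simp [preD]

theorem preD_algebraMap (r : K) : preD (algebraMap K (PreForms U) r) = 0 := by
  simp [preD, Matrix.algebraMap_matrix_apply]

end FormParity

/-! ### Contraction with vector fields and Cartan's formula. -/

section Contraction

variable {n : ℕ} {X : M.Endo U}

theorem IsDerivation.ev_mul (hX : M.IsDerivation n X) (f g : M.Sec U) :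
    X.ev (f * g) = X.ev f * g + (M.σ U ^ n) f * X.ev g := hX.leibniz le_rfl f g

theorem IsDerivation.ev_algebraMap (hX : M.IsDerivation n X) (r : K) :
    X.ev (algebraMap K _ r) = 0 := by
  have h1 : X.ev 1 = 0 := by
    have := hX.leibniz le_rfl (1 : M.Sec U) 1
    simpa using this
  rw [Algebra.algebraMap_eq_smul_one, map_smul, h1, smul_zero]

theorem IsDerivation.ev_parity (hX : M.IsDerivation n X) (f : M.Sec U) :
    M.σ U (X.ev f) = (-1 : ℤ) ^ n • X.ev (M.σ U f) := hX.parity le_rfl f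

theorem IsDerivation.ev_hasParity (hX : M.IsDerivation n X) {m : ℕ} {f : M.Sec U}
    (hf : M.HasParity m f) : M.HasParity (n + m) (X.ev f) := hX.hasParity le_rfl hf

theorem Coords.ev_eq_sum (c : M.Coords p q U) (hX : M.IsDerivation n X) (f : M.Sec U) :
    X.ev f = ∑ a, X.ev (c.x a) * (c.del a).ev f := by
  have := congrArg (fun Y : M.Endo U => Y.ev f) (c.eq_sum hX)
  refine (this.trans (Endo.sum_app _ _ _ _)).trans (Finset.sum_congr rfl fun a _ => ?_)
  rw [Endo.mul_app, mulOp_app, res_self]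

variable (p q) in
/-- The values of the contraction with a vector field on the generators. -/
def contrGen (X : M.Endo U) : M.Sec U ⊕ M.Sec U → M.Forms p q U :=
  Sum.elim (fun _ => 0) (fun f => fn M p q U (X.ev f))

variable (p q) in
/-- The values of the Lie derivative on the generators. -/
def lieGen (n : ℕ) (X : M.Endo U) : M.Sec U ⊕ M.Sec U → M.Forms p q U :=
  Sum.elim (fun f => fn M p q U (X.ev f)) (fun f => (-1 : ℤ) ^ n • df M p q U (X.ev f))

variable (p q) in
/-- The contraction with a vector field of parity `n`, on the free algebra. -/
abbrev preContr (n : ℕ) (X : M.Endo U) : PreForms U →ₗ[K] M.Forms p q U :=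
  preDer M p q U (n + 1) (contrGen p q X)

variable (p q) in
/-- The Lie derivative along a vector field of parity `n`, on the free algebra. -/
abbrev preLie (n : ℕ) (X : M.Endo U) : PreForms U →ₗ[K] M.Forms p q U :=
  preDer M p q U n (lieGen p q n X)

theorem mkForm_preFn (f : M.Sec U) : mkForm M p q U (preFn f) = fn M p q U f := rfl

theorem mkForm_preDf (f : M.Sec U) : mkForm M p q U (preDf f) = df M p q U f := rfl

theorem preContr_fn (f : M.Sec U) : preContr p q n X (preFn f) = 0 := preDer_fn f

theorem preContr_df (f : M.Sec U) : preContr p q n X (preDf f) = fn M p q U (X.ev f) := preDer_df f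

theorem preLie_fn (f : M.Sec U) : preLie p q n X (preFn f) = fn M p q U (X.ev f) := preDer_fn f

theorem preLie_df (f : M.Sec U) :
    preLie p q n X (preDf f) = (-1 : ℤ) ^ n • df M p q U (X.ev f) := preDer_df f

theorem preContr_preσ (hX : M.IsDerivation n X) (a : PreForms U) :
    preContr p q n X (preσ U a) = (-1 : ℤ) ^ (n + 1) • formσ M p q U (preContr p q n X a) := by
  induction a using FreeAlgebra.induction with
  | grade0 r => rw [AlgHom.commutes, preDer_algebraMap, map_zero, smul_zero]
  | grade1 x =>
    rcases x with f | f
    · change preContr p q n X (preσ U (preFn f)) = _ • formσ M p q U (preContr p q n X (preFn f))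
      rw [preσ_fn, preContr_fn, preContr_fn, map_zero, smul_zero]
    · change preContr p q n X (preσ U (preDf f)) = _ • formσ M p q U (preContr p q n X (preDf f))
      rw [preσ_df, map_neg, preContr_df, preContr_df, formσ_fn, hX.ev_parity, map_zsmul, pow_succ,
        mul_smul, neg_one_smul, smul_neg, neg_one_pow_smul_smul]
  | mul a b ha hb =>
    rw [map_mul, preDer_mul, preDer_mul, ha, hb, map_add, map_mul, map_mul, smul_add,
      smul_mul_assoc, mul_smul_comm]
    simp only [← formσ_mk]
    rw [← AlgHom.mul_apply, ← AlgHom.mul_apply, ← pow_succ, ← pow_succ']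
  | add a b ha hb => rw [map_add, map_add, map_add, ha, hb, map_add, smul_add]

theorem preLie_preσ (hX : M.IsDerivation n X) (a : PreForms U) :
    preLie p q n X (preσ U a) = (-1 : ℤ) ^ n • formσ M p q U (preLie p q n X a) := by
  induction a using FreeAlgebra.induction with
  | grade0 r => rw [AlgHom.commutes, preDer_algebraMap, map_zero, smul_zero]
  | grade1 x =>
    rcases x with f | f
    · change preLie p q n X (preσ U (preFn f)) = _ • formσ M p q U (preLie p q n X (preFn f))
      rw [preσ_fn, preLie_fn, preLie_fn, formσ_fn, hX.ev_parity, map_zsmul, neg_one_pow_smul_smul]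
    · change preLie p q n X (preσ U (preDf f)) = _ • formσ M p q U (preLie p q n X (preDf f))
      rw [preσ_df, map_neg, preLie_df, preLie_df, map_zsmul, formσ_df, hX.ev_parity, map_zsmul,
        neg_one_pow_smul_smul]
  | mul a b ha hb =>
    rw [map_mul, preDer_mul, preDer_mul, ha, hb, map_add, map_mul, map_mul, smul_add,
      smul_mul_assoc, mul_smul_comm]
    simp only [← formσ_mk]
    rw [← AlgHom.mul_apply, ← AlgHom.mul_apply, ← pow_succ, ← pow_succ']
  | add a b ha hb => rw [map_add, map_add, map_add, ha, hb, map_add, smul_add]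

/-- Cartan's formula. -/
theorem preContr_preD (hX : M.IsDerivation n X) (a : PreForms U) :
    preContr p q n X (preD a) =
      preLie p q n X a - (-1 : ℤ) ^ n • d M p q U (preContr p q n X a) := by
  induction a using FreeAlgebra.induction with
  | grade0 r =>
    rw [preD_algebraMap, preDer_algebraMap, preDer_algebraMap]; simp
  | grade1 x =>
    rcases x with f | f
    · change preContr p q n X (preD (preFn f)) =
        preLie p q n X (preFn f) - _ • d M p q U (preContr p q n X (preFn f))
      rw [preD_fn, preContr_fn, preContr_df, preLie_fn, map_zero, smul_zero, sub_zero]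
    · change preContr p q n X (preD (preDf f)) =
        preLie p q n X (preDf f) - _ • d M p q U (preContr p q n X (preDf f))
      rw [preD_df, map_zero, preLie_df, preContr_df, d_fn, sub_self]
  | mul a b ha hb =>
    rw [preD_mul, map_add, preDer_mul, preDer_mul, preDer_mul, preDer_mul, ha, hb,
      preContr_preσ hX, map_add, d_mul, d_mul, ← formσ_mk, ← d_mk, ← d_mk, formσ_pow_d,
      ← AlgHom.mul_apply, ← AlgHom.mul_apply, ← pow_succ, ← pow_succ', pow_add (formσ M p q U) n 2,
      formσ_pow_two, mul_one, pow_succ]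
    simp only [mul_sub, sub_mul, smul_add, smul_mul_assoc, mul_smul_comm, mul_neg, mul_one, neg_smul,
      neg_mul]
    abel
  | add a b ha hb =>
    rw [preD_add, map_add, map_add, map_add, map_add, ha, hb, smul_add]
    abel

/-- With Cartan's formula this controls both ι_X and L_X after an application of d, as the closure
of the relations under d requires. -/
theorem preLie_preD (hX : M.IsDerivation n X) (a : PreForms U) :
    preLie p q n X (preD a) = (-1 : ℤ) ^ n • d M p q U (preLie p q n X a) := by
  induction a using FreeAlgebra.induction with
  | grade0 r =>
    rw [preD_algebraMap, preDer_algebraMap]; simp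
  | grade1 x =>
    rcases x with f | f
    · change preLie p q n X (preD (preFn f)) = _ • d M p q U (preLie p q n X (preFn f))
      rw [preD_fn, preLie_fn, preLie_df, d_fn]
    · change preLie p q n X (preD (preDf f)) = _ • d M p q U (preLie p q n X (preDf f))
      rw [preD_df, map_zero, preLie_df, map_zsmul, d_df, smul_zero, smul_zero]
  | mul a b ha hb =>
    rw [preD_mul, map_add, preDer_mul, preDer_mul, preDer_mul, ha, hb,
      preLie_preσ hX, map_add, d_mul, d_mul, ← formσ_mk, ← d_mk, ← d_mk, formσ_pow_d,
      ← AlgHom.mul_apply, ← AlgHom.mul_apply, ← pow_succ, ← pow_succ']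
    simp only [smul_add, smul_mul_assoc, mul_smul_comm]
    abel
  | add a b ha hb =>
    rw [preD_add, map_add, map_add, map_add, ha, hb, smul_add]

theorem neg_one_pow_congr {A : Type*} [AddCommGroup A] {m n : ℕ} (h : Even (m + n)) (a : A) :
    (-1 : ℤ) ^ m • a = (-1 : ℤ) ^ n • a := by rw [neg_one_pow_eq h]

/-- Contraction alone cannot be carried through the induction: the relations are closed under d, and
ι_X d involves L_X by Cartan's formula. Since L_X supercommutes with d, the two invariances prove
each other's inductive step. -/
theorem FormRel.preContr_eq (hX : M.IsDerivation n X) {a b : PreForms U} (h : FormRel p q U a b) :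
    preContr p q n X a = preContr p q n X b ∧ preLie p q n X a = preLie p q n X b := by
  induction h with
  | fn_add f g => simp only [map_add, preContr_fn, preLie_fn, add_zero, and_self]
  | fn_mul f g =>
    simp only [preDer_mul, preContr_fn, preLie_fn, mkForm_preFn, hX.ev_mul, zero_mul, mul_zero,
      add_zero, map_add, map_mul, Coords.formσ_pow_fn, and_self]
  | fn_const r =>
    simp only [preDer_algebraMap, preContr_fn, preLie_fn, hX.ev_algebraMap, map_zero, and_self]
  | d_add f g => simp only [map_add, preContr_df, preLie_df, smul_add, and_self]
  | d_smul r f =>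
    simp only [map_smul, preContr_df, preLie_df, smul_comm r, and_self]
  | d_mul f g =>
    refine ⟨?_, ?_⟩
    · simp only [map_add, preDer_mul, preContr_fn, preContr_df, mkForm_preFn, mkForm_preDf,
        hX.ev_mul, map_mul, mul_zero, zero_mul, add_zero, zero_add, pow_succ,
        AlgHom.mul_apply, formσ_fn, σ_σ, Coords.formσ_pow_fn]
    · simp only [map_add, preDer_mul, preLie_fn, preLie_df, mkForm_preFn, mkForm_preDf,
        hX.ev_mul, Coords.formσ_pow_fn, df_mul, formσ_pow_df, smul_add, smul_mul_assoc,
        mul_smul_comm, hX.ev_parity]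
      have h1 : M.σ U ((M.σ U ^ n) f) = (M.σ U ^ n) (M.σ U f) := by
        rw [← AlgHom.mul_apply, ← AlgHom.mul_apply, ← pow_succ, ← pow_succ']
      simp only [map_zsmul, smul_mul_assoc, neg_one_pow_smul_smul, h1]
      abel
  | fn_d l m f g hf hg =>
    refine ⟨?_, ?_⟩
    · simp only [map_zsmul, preDer_mul, preContr_fn, preContr_df, mkForm_preFn, mkForm_preDf,
        mul_zero, zero_mul, add_zero, zero_add, Coords.formσ_pow_fn, σ_pow_hom hf, ← map_mul,
        smul_mul_assoc]
      rw [M.supercomm U l (n + m) _ _ hf (hX.ev_hasParity hg), map_zsmul, smul_smul, ← pow_add]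
      exact neg_one_pow_congr (by simp only [parity_simps]; tauto) _
    · simp only [map_zsmul, preDer_mul, preLie_fn, preLie_df, mkForm_preFn, mkForm_preDf,
        Coords.formσ_pow_fn, σ_pow_hom hf, smul_mul_assoc, mul_smul_comm, formσ_pow_df,
        σ_pow_hom hg, smul_add]
      rw [fn_mul_df (hX.ev_hasParity hf) hg, fn_mul_df hf (hX.ev_hasParity hg)]
      simp only [smul_smul, ← pow_add]
      rw [add_comm]
      refine congrArg₂ (· + ·) (neg_one_pow_congr ?_ _) (neg_one_pow_congr ?_ _) <;>
      · simp only [parity_simps]; tauto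
  | d_d l m f g hf hg =>
    refine ⟨?_, ?_⟩
    · simp only [map_zsmul, preDer_mul, preContr_df, mkForm_preDf, formσ_pow_df, σ_pow_hom hf,
        σ_pow_hom hg, smul_mul_assoc, smul_add, map_zsmul]
      rw [fn_mul_df (hX.ev_hasParity hf) hg, fn_mul_df (hX.ev_hasParity hg) hf]
      simp only [smul_smul, ← pow_add]
      rw [add_comm]
      refine congrArg₂ (· + ·) (neg_one_pow_congr ?_ _) (neg_one_pow_congr ?_ _) <;>
      · simp only [parity_simps]; tauto
    · simp only [map_zsmul, preDer_mul, preLie_df, mkForm_preDf, formσ_pow_df, σ_pow_hom hf,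
        σ_pow_hom hg, smul_mul_assoc, mul_smul_comm, smul_add, map_zsmul]
      rw [df_mul_df (hX.ev_hasParity hf) hg, df_mul_df hf (hX.ev_hasParity hg)]
      simp only [smul_smul, ← pow_add]
      rw [add_comm]
      refine congrArg₂ (· + ·) (neg_one_pow_congr ?_ _) (neg_one_pow_congr ?_ _) <;>
      · simp only [parity_simps]; tauto
  | chain c f =>
    have h1 : preContr p q n X (preDf f) =
        preContr p q n X (∑ a, preDf (c.x a) * preFn ((c.del a).ev f)) := by
      simp only [map_sum, preDer_mul, preContr_fn, preContr_df, mul_zero, add_zero, mkForm_preFn,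
        ← map_mul]
      rw [← map_sum, ← c.ev_eq_sum hX]
    refine ⟨h1, ?_⟩
    -- Applying d to the contraction identity accounts for the terms with d(X(x_a)). What remains is
    -- an equality of double sums, which holds since ∂_a and ∂_b supercommute.
    have h2 := congrArg (d M p q U) h1
    simp only [map_sum, preDer_mul, preContr_fn, preContr_df, mul_zero, add_zero, mkForm_preFn,
      SuperSpace.d_mul, d_fn, formσ_fn] at h2
    simp only [map_sum, preDer_mul, preLie_fn, preLie_df, mkForm_preFn, mkForm_preDf, h2,
      Finset.sum_add_distrib, smul_add, smul_mul_assoc, ← Finset.smul_sum]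
    congr 1
    simp only [fun b => df_eq_sum (p := p) (q := q) c ((c.del b).ev f), Finset.mul_sum,
      fun a => c.ev_eq_sum hX ((c.del a).ev f), map_sum, Finset.smul_sum]
    rw [Finset.sum_comm]
    refine Finset.sum_congr rfl fun a _ => Finset.sum_congr rfl fun b _ => ?_
    have h3 : (c.del a).ev ((c.del b).ev f) =
        (-1 : ℤ) ^ (par a * par b : ℕ) • (c.del b).ev ((c.del a).ev f) := by
      have := congrArg (fun P : M.Diff U => P.1.app le_rfl f) (c.delOp_mul_delOp a b)
      rwa [Diff.val_zsmul, Endo.zsmul_app] at this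
    rw [formσ_pow_df, σ_pow_hom (c.x_parity a), hX.ev_hasParity (c.x_parity b), h3]
    simp only [map_zsmul, map_mul, smul_mul_assoc, mul_smul_comm, ← mul_assoc]
    rw [fn_mul_df (hX.ev_hasParity (c.x_parity b)) (c.x_parity a), smul_mul_assoc]
    simp only [smul_smul, ← pow_add]
    exact neg_one_pow_congr (by simp only [parity_simps]; tauto) _
  | parity a b _ ih =>
    rw [preContr_preσ hX, preContr_preσ hX, preLie_preσ hX, preLie_preσ hX, ih.1, ih.2]
    exact ⟨rfl, rfl⟩
  | diff a b _ ih =>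
    rw [preContr_preD hX, preContr_preD hX, preLie_preD hX, preLie_preD hX, ih.1, ih.2]
    exact ⟨rfl, rfl⟩

end Contraction

section Contraction

variable {n : ℕ} {X : M.Endo U}

variable (p q) in
/-- The algebra morphism which encodes the contraction with a vector field. -/
def contrMat (hX : M.IsDerivation n X) :
    M.Forms p q U →ₐ[K] Matrix (Fin 2) (Fin 2) (M.Forms p q U) :=
  RingQuot.liftAlgHom K ⟨preDerMat M p q U (n + 1) (contrGen p q X), fun a b h => by
    rw [preDerMat_apply, preDerMat_apply, mkForm_rel h, (h.preContr_eq hX).1]⟩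

variable (p q) in
/-- The contraction of differential forms with a vector field of parity `n`, a superderivation of
parity `n + 1`. -/
def contr (hX : M.IsDerivation n X) : M.Forms p q U →ₗ[K] M.Forms p q U where
  toFun ω := contrMat p q hX ω 0 1
  map_add' _ _ := by simp
  map_smul' _ _ := by simp

variable (hX : M.IsDerivation n X)

theorem contr_mk (a : PreForms U) : contr p q hX (mkForm M p q U a) = preContr p q n X a := by
  change contrMat p q hX (mkForm M p q U a) 0 1 = _
  have : contrMat p q hX (mkForm M p q U a) = preDerMat M p q U (n + 1) (contrGen p q X) a :=
    RingQuot.liftAlgHom_mkAlgHom_apply ..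
  rw [this]
  rfl

theorem contr_mul (ω η : M.Forms p q U) : contr p q hX (ω * η) =
    contr p q hX ω * η + (formσ M p q U ^ (n + 1)) ω * contr p q hX η := by
  obtain ⟨a, rfl⟩ := mkForm_surjective ω
  obtain ⟨b, rfl⟩ := mkForm_surjective η
  rw [← map_mul, contr_mk, contr_mk, contr_mk, preDer_mul]

theorem contr_fn (f : M.Sec U) : contr p q hX (fn M p q U f) = 0 :=
  (contr_mk hX _).trans (preContr_fn f)

theorem contr_df (f : M.Sec U) : contr p q hX (df M p q U f) = fn M p q U (X.ev f) :=
  (contr_mk hX _).trans (preContr_df f)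

theorem formσ_contr (ω : M.Forms p q U) :
    formσ M p q U (contr p q hX ω) = (-1 : ℤ) ^ (n + 1) • contr p q hX (formσ M p q U ω) := by
  obtain ⟨a, rfl⟩ := mkForm_surjective ω
  rw [formσ_mk, contr_mk, contr_mk, preContr_preσ hX, neg_one_pow_smul_smul]

theorem formσ_pow_contr (m : ℕ) (ω : M.Forms p q U) : (formσ M p q U ^ m) (contr p q hX ω) =
    (-1 : ℤ) ^ ((n + 1) * m) • contr p q hX ((formσ M p q U ^ m) ω) := by
  induction m with
  | zero => simp
  | succ m ih =>
    rw [pow_succ', AlgHom.mul_apply, ih, map_zsmul, formσ_contr, smul_smul, ← pow_add,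
      AlgHom.mul_apply]
    congr 2

theorem resForm_formσ_pow (h : V ≤ U) (m : ℕ) (ω : M.Forms p q U) :
    resForm h ((formσ M p q U ^ m) ω) = (formσ M p q V ^ m) (resForm h ω) := by
  induction m with
  | zero => rfl
  | succ m ih => rw [pow_succ', pow_succ', AlgHom.mul_apply, AlgHom.mul_apply, resForm_σ, ih]

theorem resForm_contr (h : V ≤ U) (ω : M.Forms p q U) :
    resForm h (contr p q hX ω) = contr p q (hX.restrict h) (resForm h ω) := by
  induction ω using form_induction with
  | fn_hom m f _ => rw [contr_fn, map_zero, resForm_fn, contr_fn]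
  | df_hom m f _ =>
    rw [contr_df, resForm_fn, resForm_df, contr_df, Endo.res_app]
    rfl
  | mul a b ha hb =>
    rw [contr_mul, map_add, map_mul, map_mul, map_mul, contr_mul, ha, hb, resForm_formσ_pow]
  | add a b ha hb => rw [map_add, map_add, map_add, map_add, ha, hb]

end Contraction

/-! ### Projection of forms onto functions. -/

section Augmentation

variable (M p q U) in
/-- The projection of differential forms onto functions, on the free algebra. -/
def preAug : PreForms U →ₐ[K] M.Sec U := FreeAlgebra.lift K (Sum.elim id fun _ => 0)

theorem preAug_fn (f : M.Sec U) : preAug M U (preFn f) = f := by simp [preAug, preFn]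

theorem preAug_df (f : M.Sec U) : preAug M U (preDf f) = 0 := by simp [preAug, preDf]

/-- d lands in the ideal generated by the differentials, so relations obtained by applying d are
respected trivially. -/
theorem preAug_preD (a : PreForms U) : preAug M U (preD a) = 0 := by
  induction a using FreeAlgebra.induction with
  | grade0 r => rw [preD_algebraMap, map_zero]
  | grade1 x =>
    rcases x with f | f
    · exact (congrArg _ (preD_fn f)).trans (preAug_df f)
    · exact (congrArg _ (preD_df f)).trans (map_zero _)
  | mul a b ha hb => rw [preD_mul, map_add, map_mul, map_mul, ha, hb, zero_mul, mul_zero, add_zero]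
  | add a b ha hb => rw [preD_add, map_add, ha, hb, add_zero]

theorem preAug_preσ (a : PreForms U) : preAug M U (preσ U a) = M.σ U (preAug M U a) := by
  induction a using FreeAlgebra.induction with
  | grade0 r => rw [AlgHom.commutes, AlgHom.commutes, AlgHom.commutes]
  | grade1 x =>
    rcases x with f | f
    · change preAug M U (preσ U (preFn f)) = M.σ U (preAug M U (preFn f))
      rw [preσ_fn, preAug_fn, preAug_fn]
    · change preAug M U (preσ U (preDf f)) = M.σ U (preAug M U (preDf f))
      rw [preσ_df, map_neg, preAug_df, preAug_df, neg_zero, map_zero]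
  | mul a b ha hb => rw [map_mul, map_mul, map_mul, map_mul, ha, hb]
  | add a b ha hb => rw [map_add, map_add, map_add, map_add, ha, hb]

theorem FormRel.preAug_eq {a b : PreForms U} (h : FormRel p q U a b) :
    preAug M U a = preAug M U b := by
  induction h with
  | fn_add f g => simp only [map_add, preAug_fn]
  | fn_mul f g => simp only [map_mul, preAug_fn]
  | fn_const r => rw [preAug_fn, AlgHom.commutes]
  | d_add f g => simp only [map_add, preAug_df, add_zero]
  | d_smul r f => simp only [map_smul, preAug_df, smul_zero]
  | d_mul f g => simp only [map_add, map_mul, preAug_df, zero_mul, mul_zero, add_zero]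
  | fn_d m n f g hf hg => simp only [map_zsmul, map_mul, preAug_df, zero_mul, mul_zero, smul_zero]
  | d_d m n f g hf hg => simp only [map_zsmul, map_mul, preAug_df, zero_mul, smul_zero]
  | chain c f => simp only [map_sum, map_mul, preAug_df, zero_mul, Finset.sum_const_zero]
  | parity a b _ ih => rw [preAug_preσ, preAug_preσ, ih]
  | diff a b _ ih => rw [preAug_preD, preAug_preD]

variable (M p q U) in
/-- The projection of differential forms onto functions. -/
def aug : M.Forms p q U →ₐ[K] M.Sec U :=
  RingQuot.liftAlgHom K ⟨preAug M U, fun _ _ h => h.preAug_eq⟩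

theorem aug_fn (f : M.Sec U) : aug M p q U (fn M p q U f) = f :=
  (RingQuot.liftAlgHom_mkAlgHom_apply ..).trans (preAug_fn f)

theorem aug_df (f : M.Sec U) : aug M p q U (df M p q U f) = 0 :=
  (RingQuot.liftAlgHom_mkAlgHom_apply ..).trans (preAug_df f)

theorem res_aug (h : V ≤ U) (ω : M.Forms p q U) :
    M.res h (aug M p q U ω) = aug M p q V (resForm h ω) := by
  induction ω using form_induction with
  | fn_hom m f _ => rw [aug_fn, resForm_fn, aug_fn]
  | df_hom m f _ => rw [aug_df, resForm_df, aug_df, map_zero]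
  | mul a b ha hb => rw [map_mul, map_mul, map_mul, map_mul, ha, hb]
  | add a b ha hb => rw [map_add, map_add, map_add, map_add, ha, hb]

end Augmentation

/-! ### Coordinate monomials of differential forms. -/

namespace Coords

variable (c : M.Coords p q U)

/-- The product of the differentials of the coordinates over a list of indices. -/
def dxMon (l : List (Fin p ⊕ Fin q)) : M.Forms p q U := (l.map fun a => df M p q U (c.x a)).prod

theorem dxMon_nil : c.dxMon [] = 1 := rfl

theorem dxMon_cons (a : Fin p ⊕ Fin q) (l : List (Fin p ⊕ Fin q)) :
    c.dxMon (a :: l) = df M p q U (c.x a) * c.dxMon l := by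
  rw [dxMon, List.map_cons, List.prod_cons, dxMon]

theorem formσ_pow_dx (n : ℕ) (a : Fin p ⊕ Fin q) :
    (formσ M p q U ^ n) (df M p q U (c.x a)) = (-1 : ℤ) ^ ((par a + 1) * n) • df M p q U (c.x a) :=
  formσ_pow (formσ_df_hom (c.x_parity a)) n

theorem fn_mul_dx (f : M.Sec U) (a : Fin p ⊕ Fin q) :
    fn M p q U f * df M p q U (c.x a) =
      df M p q U (c.x a) * fn M p q U ((M.σ U ^ (par a + 1)) f) := by
  have := formσ_mul_df (p := p) (q := q) (c.x_parity a) (fn M p q U (M.σ U f))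
  rw [formσ_fn, σ_σ, formσ_pow_fn] at this
  rw [this, pow_succ, AlgHom.mul_apply]

/-- The contraction with the coordinate vector field `∂_a`. -/
abbrev contr (a : Fin p ⊕ Fin q) : M.Forms p q U →ₗ[K] M.Forms p q U :=
  SuperSpace.contr p q (c.del_isDerivation a)

theorem formσ_pow_contr (a : Fin p ⊕ Fin q) (m : ℕ) (ω : M.Forms p q U) :
    (formσ M p q U ^ m) (c.contr a ω) =
      (-1 : ℤ) ^ ((par a + 1) * m) • c.contr a ((formσ M p q U ^ m) ω) :=
  SuperSpace.formσ_pow_contr _ m ω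

/-- The canonical commutation relation between ι_a and dx_b, the counterpart on forms of
`ad_delOp_mul`. -/
theorem contr_dx_mul (a b : Fin p ⊕ Fin q) (ω : M.Forms p q U) :
    c.contr a (df M p q U (c.x b) * ω) = (if a = b then ω else 0) +
      (-1 : ℤ) ^ ((par a + 1) * (par b + 1) : ℕ) • (df M p q U (c.x b) * c.contr a ω) := by
  rw [contr_mul, contr_df, c.del_x, formσ_pow_dx, smul_mul_assoc, mul_comm (par b + 1)]
  split <;> simp

theorem d_dxMon (l : List (Fin p ⊕ Fin q)) : d M p q U (c.dxMon l) = 0 := by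
  induction l with
  | nil =>
    rw [dxMon_nil, ← map_one (fn M p q U), d_fn]
    have := df_mul (p := p) (q := q) (1 : M.Sec U) 1
    simpa using this
  | cons a l ih => rw [dxMon_cons, d_mul, d_df, ih, zero_mul, mul_zero, add_zero]

/-- Contracting a form with constant coefficients gives constant coefficients again, because ∂_a x_b
is constant. -/
theorem d_contr_dxMon (a : Fin p ⊕ Fin q) (l : List (Fin p ⊕ Fin q)) :
    d M p q U (c.contr a (c.dxMon l)) = 0 := by
  induction l with
  | nil => rw [dxMon_nil, ← map_one (fn M p q U), contr_fn, map_zero]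
  | cons b l ih =>
    rw [dxMon_cons, contr_dx_mul, map_add, map_zsmul, d_mul, d_df, ih, zero_mul, mul_zero,
      add_zero, smul_zero, add_zero]
    split
    · exact c.d_dxMon l
    · exact map_zero _

theorem dx_mul_contr_dxMon (a : Fin p ⊕ Fin q) (l : List (Fin p ⊕ Fin q)) :
    df M p q U (c.x a) * c.contr a (c.dxMon l) = l.count a • c.dxMon l := by
  induction l with
  | nil => rw [dxMon_nil, ← map_one (fn M p q U), contr_fn, mul_zero, List.count_nil, zero_smul]
  | cons b l ih =>
    rw [dxMon_cons, contr_dx_mul, mul_add, mul_smul_comm, ← mul_assoc _ _ (c.contr a _),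
      df_mul_df (c.x_parity a) (c.x_parity b), smul_mul_assoc, neg_one_pow_smul_smul, mul_assoc, ih]
    by_cases h : a = b
    · subst h
      rw [List.count_cons_self, if_pos rfl, succ_nsmul, mul_smul_comm, add_comm]
    · rw [List.count_cons_of_ne (Ne.symm h), if_neg h, mul_zero, zero_add, mul_smul_comm]

/-- The precise sign never matters below: spans and kernels are insensitive to it. -/
theorem formσ_pow_dxMon (n : ℕ) (l : List (Fin p ⊕ Fin q)) :
    (formσ M p q U ^ n) (c.dxMon l) = c.dxMon l ∨ (formσ M p q U ^ n) (c.dxMon l) = -c.dxMon l := by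
  induction l with
  | nil => exact Or.inl (by rw [dxMon_nil, map_one])
  | cons a l ih =>
    rw [dxMon_cons, map_mul, formσ_pow_dx]
    rcases neg_one_pow_eq_or ℤ ((par a + 1) * n) with h | h <;> rcases ih with h' | h' <;>
      rw [h, h'] <;> simp

/-- The span contains 1 and is stable under left multiplication by functions and by dx_a, hence by
every df = Σ dx_a ∂_a f, hence by all forms. -/
theorem form_mem_span (ω : M.Forms p q U) : ω ∈ Submodule.span K
    {ω | ∃ (l : List (Fin p ⊕ Fin q)) (f : M.Sec U), ω = c.dxMon l * fn M p q U f} := by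
  set S := Submodule.span K
    {ω | ∃ (l : List (Fin p ⊕ Fin q)) (f : M.Sec U), ω = c.dxMon l * fn M p q U f} with hS
  have hmon : ∀ l f, c.dxMon l * fn M p q U f ∈ S := fun l f => Submodule.subset_span ⟨l, f, rfl⟩
  have hfn : ∀ f, fn M p q U f ∈ S := fun f => by simpa [dxMon_nil] using hmon [] f
  have hdx : ∀ a, ∀ ω ∈ S, df M p q U (c.x a) * ω ∈ S := by
    intro a ω hω
    induction hω using Submodule.span_induction with
    | mem ω h =>
      obtain ⟨l, f, rfl⟩ := h
      rw [← mul_assoc, ← dxMon_cons]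
      exact hmon _ _
    | zero => rw [mul_zero]; exact zero_mem _
    | add P Q _ _ h h' => rw [mul_add]; exact add_mem h h'
    | smul r P _ h => rw [mul_smul_comm]; exact Submodule.smul_mem _ _ h
  have hfm : ∀ l f g, fn M p q U g * (c.dxMon l * fn M p q U f) ∈ S := by
    intro l
    induction l with
    | nil => intro f g; rw [dxMon_nil, one_mul, ← map_mul]; exact hfn _
    | cons a l ih =>
      intro f g
      rw [dxMon_cons, mul_assoc, ← mul_assoc, fn_mul_dx, mul_assoc]
      exact hdx a _ (ih _ _)
  have hf : ∀ g, ∀ ω ∈ S, fn M p q U g * ω ∈ S := by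
    intro g ω hω
    induction hω using Submodule.span_induction with
    | mem ω h =>
      obtain ⟨l, f, rfl⟩ := h
      exact hfm _ _ _
    | zero => rw [mul_zero]; exact zero_mem _
    | add P Q _ _ h h' => rw [mul_add]; exact add_mem h h'
    | smul r P _ h => rw [mul_smul_comm]; exact Submodule.smul_mem _ _ h
  have hmul : ∀ ω : M.Forms p q U, ∀ η ∈ S, ω * η ∈ S := by
    intro ω
    induction ω using form_induction with
    | fn_hom m f _ => exact hf f
    | df_hom m f _ =>
      intro η hη
      rw [df_eq_sum c, Finset.sum_mul]
      refine sum_mem fun a _ => ?_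
      rw [mul_assoc]
      exact hdx a _ (hf _ _ hη)
    | mul a b ha hb => intro η hη; rw [mul_assoc]; exact ha _ (hb _ hη)
    | add a b ha hb => intro η hη; rw [add_mul]; exact add_mem (ha _ hη) (hb _ hη)
  simpa using hmul ω 1 (by simpa using hfn 1)

end Coords

/-! ### K-linear maps out of the universal de Rham module. -/

section Tens

theorem tens_zsmul_left (n : ℤ) (ω : M.Forms p q U) (P : M.Diff U) :
    tens (n • ω) P = n • tens ω P := by
  let F : M.Forms p q U →+ M.UdR p q U :=
    { toFun := fun ω => tens ω P
      map_zero' := by simp [tens]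
      map_add' := fun ω η => tens_add_left ω η P }
  exact map_zsmul F n ω

theorem tens_zsmul_right (n : ℤ) (ω : M.Forms p q U) (P : M.Diff U) :
    tens ω (n • P) = n • tens ω P := by
  let F : M.Diff U →+ M.UdR p q U :=
    { toFun := fun P => tens ω P
      map_zero' := by simp [tens]
      map_add' := fun P Q => tens_add_right ω P Q }
  exact map_zsmul F n P

theorem tens_smul_right (r : K) (ω : M.Forms p q U) (P : M.Diff U) :
    tens ω (r • P) = r • tens ω P := rfl

theorem tens_smul_left (r : K) (ω : M.Forms p q U) (P : M.Diff U) :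
    tens (r • ω) P = r • tens ω P := by
  rw [← tens_smul_right, tens, tens, TensorProduct.smul_tmul]

theorem tens_neg_left (ω : M.Forms p q U) (P : M.Diff U) : tens (-ω) P = -tens ω P := by
  have := tens_zsmul_left (-1) ω P
  simpa using this

theorem tens_neg_right (ω : M.Forms p q U) (P : M.Diff U) : tens ω (-P) = -tens ω P := by
  have := tens_zsmul_right (-1) ω P
  simpa using this

theorem tens_sub_right (ω : M.Forms p q U) (P Q : M.Diff U) :
    tens ω (P - Q) = tens ω P - tens ω Q := by
  rw [sub_eq_add_neg, tens_add_right, tens_neg_right, ← sub_eq_add_neg]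

theorem tens_zero_left (P : M.Diff U) : tens (0 : M.Forms p q U) P = 0 := by simp [tens]

theorem tens_zero_right (ω : M.Forms p q U) : tens ω (0 : M.Diff U) = 0 := by simp [tens]

variable {A : Type*} [AddCommGroup A] [Module K A]

/-- F is not assumed D_M-linear. The set of defining relations is itself stable under right
multiplication, so their D_M-span is already their additive closure. -/
theorem relSubmodule_le_ker (F : M.Diff U ⊗[K] M.Forms p q U →ₗ[K] A)
    (hF : ∀ (ω : M.Forms p q U) (f : M.Sec U) (P : M.Diff U),
      F (P ⊗ₜ (ω * fn M p q U f)) = F ((M.fnOp U f * P) ⊗ₜ ω)) :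
    (relSubmodule p q U).restrictScalars K ≤ LinearMap.ker F := by
  intro t ht
  change t ∈ relSubmodule p q U at ht
  rw [LinearMap.mem_ker]
  induction ht using Submodule.closure_induction with
  | zero => exact map_zero F
  | add x y _ _ hx hy => rw [map_add, hx, hy, add_zero]
  | smul_mem r t h =>
    obtain ⟨ω, f, P, rfl⟩ := h
    have : r • (P ⊗ₜ[K] (ω * fn M p q U f) - (M.fnOp U f * P) ⊗ₜ[K] ω) =
        (P * r.unop) ⊗ₜ[K] (ω * fn M p q U f) - (M.fnOp U f * (P * r.unop)) ⊗ₜ[K] ω := by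
      rw [smul_sub, ← mul_assoc]
      rfl
    rw [this, map_sub, hF, sub_self]

/-- The universal property of the universal de Rham module. -/
def liftUdR (F : M.Diff U ⊗[K] M.Forms p q U →ₗ[K] A)
    (hF : ∀ (ω : M.Forms p q U) (f : M.Sec U) (P : M.Diff U),
      F (P ⊗ₜ (ω * fn M p q U f)) = F ((M.fnOp U f * P) ⊗ₜ ω)) : M.UdR p q U →ₗ[K] A :=
  ((relSubmodule p q U).restrictScalars K).liftQ F (relSubmodule_le_ker F hF) ∘ₗ
    (Submodule.Quotient.restrictScalarsEquiv K (relSubmodule p q U)).symm.toLinearMap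

end Tens

/-! ### The contracting homotopy. -/

theorem ad_fnOp_mul {n : ℕ} {x : M.Sec U} (hx : M.HasParity n x) (f : M.Sec U) (P : M.Diff U) :
    ad n x (M.fnOp U f * P) = M.fnOp U ((M.σ U ^ n) f) * ad n x P := by
  rw [ad_mul, ad_fnOp hx, zero_mul, zero_add, conjDiff_pow_fnOp]

namespace Coords

variable (c : M.Coords p q U)

/-- The differential of the universal de Rham complex as a `K`-linear map. -/
def DK : M.UdR p q U →ₗ[K] M.UdR p q U := c.D.restrictScalars K

theorem DK_apply (t : M.UdR p q U) : c.DK t = c.D t := rfl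

/-- The operator `ω ⊗ P ↦ ι_a σ^{|x_a|} ω ⊗ [x_a, P]`. -/
def homot (a : Fin p ⊕ Fin q) : M.UdR p q U →ₗ[K] M.UdR p q U :=
  liftUdR (((relSubmodule p q U).mkQ.restrictScalars K) ∘ₗ
    TensorProduct.map (ad (par a) (c.x a)) (c.contr a ∘ₗ (formσ M p q U ^ par a).toLinearMap))
    (fun ω f P => by
      change tens (c.contr a ((formσ M p q U ^ par a) (ω * fn M p q U f))) (ad (par a) (c.x a) P) =
        tens (c.contr a ((formσ M p q U ^ par a) ω)) (ad (par a) (c.x a) (M.fnOp U f * P))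
      -- Both factors twist f by the same power of the parity involution, so the operator is
      -- compatible with moving f across the tensor sign.
      rw [map_mul, formσ_pow_fn, contr_mul, contr_fn, mul_zero, add_zero, tens_fn,
        ad_fnOp_mul (c.x_parity a)])

theorem homot_tens (a : Fin p ⊕ Fin q) (ω : M.Forms p q U) (P : M.Diff U) :
    c.homot a (tens ω P) =
      tens (c.contr a ((formσ M p q U ^ par a) ω)) (ad (par a) (c.x a) P) := rfl

theorem DK_tens_of_closed {ω : M.Forms p q U} (hω : d M p q U ω = 0) (P : M.Diff U) :
    c.DK (tens ω P) =
      ∑ b, tens (df M p q U (c.x b) * (formσ M p q U ^ par b) ω) (c.delOp b * P) := by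
  rw [DK_apply, D_tens, hω, tens_zero_left, zero_add]

/-- The two commutation relations carry signs making the contributions with a ≠ b cancel; for a = b
only the δ-terms survive. -/
theorem homot_DK_add_DK_homot_term (a b : Fin p ⊕ Fin q) (ω : M.Forms p q U) (P : M.Diff U) :
    tens (c.contr a ((formσ M p q U ^ par a) (df M p q U (c.x b) * (formσ M p q U ^ par b) ω)))
        (ad (par a) (c.x a) (c.delOp b * P)) +
      tens (df M p q U (c.x b) *
        (formσ M p q U ^ par b) (c.contr a ((formσ M p q U ^ par a) ω)))
        (c.delOp b * ad (par a) (c.x a) P) =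
    if a = b then (-1 : ℤ) ^ (par a) • (tens ω (c.delOp a * ad (par a) (c.x a) P) - tens ω P) +
      tens (df M p q U (c.x a) * c.contr a ω) P else 0 := by
  have hσ : (formσ M p q U ^ par a) ((formσ M p q U ^ par b) ω) =
      (formσ M p q U ^ par b) ((formσ M p q U ^ par a) ω) := by
    rw [← AlgHom.mul_apply, ← AlgHom.mul_apply, ← pow_add, ← pow_add, add_comm]
  rw [map_mul, formσ_pow_dx, smul_mul_assoc, map_zsmul, contr_dx_mul, ad_delOp_mul,
    formσ_pow_contr, hσ, mul_smul_comm]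
  by_cases h : a = b
  · subst h
    rw [formσ_pow_formσ_pow]
    rcases a with i | i
    · simp [par, tens_add_left, tens_sub_right, tens_neg_left]
      abel
    · simp [par, tens_add_left, tens_sub_right]
      abel
  · simp only [if_neg h, zero_add, sub_zero, tens_zsmul_left, tens_zsmul_right]
    rcases a with i | i <;> rcases b with j | j <;> simp [par]

theorem homot_DK_add_DK_homot (a : Fin p ⊕ Fin q) {ω : M.Forms p q U} (hω : d M p q U ω = 0)
    (hω' : d M p q U (c.contr a ω) = 0) (P : M.Diff U) :
    c.homot a (c.DK (tens ω P)) + c.DK (c.homot a (tens ω P)) =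
      (-1 : ℤ) ^ (par a) • (tens ω (c.delOp a * ad (par a) (c.x a) P) - tens ω P) +
        tens (df M p q U (c.x a) * c.contr a ω) P := by
  -- Parity commutes with ι_a and d up to signs, so closedness of ι_a ω is inherited by its twist.
  have h1 : d M p q U (c.contr a ((formσ M p q U ^ par a) ω)) = 0 := by
    have h2 := c.formσ_pow_contr a (par a) ω
    have h3 : c.contr a ((formσ M p q U ^ par a) ω) =
        (-1 : ℤ) ^ ((par a + 1) * par a) • (formσ M p q U ^ par a) (c.contr a ω) := by
      rw [h2, neg_one_pow_smul_smul]
    have h4 := formσ_pow_d (par a) (c.contr a ω)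
    rw [hω', map_zero] at h4
    have h5 : d M p q U ((formσ M p q U ^ par a) (c.contr a ω)) = 0 := by
      rw [← neg_one_pow_smul_smul (par a) (d M p q U _), ← h4, smul_zero]
    rw [h3, map_zsmul, h5, smul_zero]
  rw [c.DK_tens_of_closed hω, map_sum, homot_tens, c.DK_tens_of_closed h1,
    ← Finset.sum_add_distrib]
  simp only [homot_tens, homot_DK_add_DK_homot_term, Finset.sum_ite_eq, Finset.mem_univ, if_true]

/-- The elements `dx_{a_1} … dx_{a_m} ⊗ ∂_{b_1} … ∂_{b_n} f`. -/
def mon (l m : List (Fin p ⊕ Fin q)) (f : M.Sec U) : M.UdR p q U :=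
  tens (c.dxMon l) (c.delMon m * M.fnOp U f)

/-- The eigenvalue of the homotopy operator. -/
def weight (l m : List (Fin p ⊕ Fin q)) : ℤ :=
  ∑ a : Fin p ⊕ Fin q, (1 + (-1) ^ (par a) * ((m.count a : ℤ) - l.count a))

/-- The contracting homotopy. -/
def homotopy : M.UdR p q U →ₗ[K] M.UdR p q U := ∑ a, -((-1 : ℤ) ^ (par a) • c.homot a)

/-- On a monomial, ∂_a [x_a, ·] and dx_a ι_a count the occurrences of a in m and in l; with the
constant δ-term they add up to the weight. -/
theorem homotopy_DK_add (l m : List (Fin p ⊕ Fin q)) (f : M.Sec U) :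
    c.homotopy (c.DK (c.mon l m f)) + c.DK (c.homotopy (c.mon l m f)) =
      weight l m • c.mon l m f := by
  simp only [homotopy, LinearMap.sum_apply, map_sum, LinearMap.neg_apply, LinearMap.smul_apply,
    map_neg, map_zsmul]
  rw [← Finset.sum_add_distrib, weight, Finset.sum_smul]
  refine Finset.sum_congr rfl fun a _ => ?_
  rw [← neg_add, ← smul_add, mon, c.homot_DK_add_DK_homot a (c.d_dxMon l) (c.d_contr_dxMon a l),
    delOp_mul_ad_delMon, dx_mul_contr_dxMon, ← natCast_zsmul, ← natCast_zsmul, tens_zsmul_left,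
    ← smul_neg, ← smul_neg, tens_zsmul_right, ← neg_smul, tens_zsmul_right]
  rcases a with i | i <;> simp only [par, Sum.elim_inl, Sum.elim_inr, pow_zero, pow_one] <;> module

end Coords

/-! ### Products of factors commuting up to sign, and multiplicities in index lists. -/

section Lists

variable {R ι : Type*} [Ring R] {f : ι → R}

theorem prod_map_perm (h : ∀ a b, f a * f b = f b * f a ∨ f a * f b = -(f b * f a))
    {l l' : List ι} (hl : l.Perm l') :
    (l.map f).prod = (l'.map f).prod ∨ (l.map f).prod = -(l'.map f).prod := by
  induction hl with
  | nil => exact Or.inl rfl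
  | cons a _ ih =>
    simp only [List.map_cons, List.prod_cons]
    rcases ih with ih | ih <;> rw [ih] <;> simp
  | swap a b l =>
    simp only [List.map_cons, List.prod_cons, ← mul_assoc]
    rcases h b a with h | h <;> rw [h] <;> simp
  | trans _ _ ih ih' =>
    rcases ih with ih | ih <;> rcases ih' with ih' | ih' <;> rw [ih, ih'] <;> simp

/-- Two copies of a can be brought to the front at the cost of a sign, where they multiply to zero.
-/
theorem prod_map_eq_zero [BEq ι] [LawfulBEq ι]
    (h : ∀ a b, f a * f b = f b * f a ∨ f a * f b = -(f b * f a))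
    {l : List ι} {a : ι} (ha : f a * f a = 0) (hl : 2 ≤ l.count a) : (l.map f).prod = 0 := by
  have h1 : a ∈ l := List.count_pos_iff.1 (by omega)
  have h2 : a ∈ l.erase a := List.count_pos_iff.1 (by rw [List.count_erase_self]; omega)
  have h3 : l.Perm (a :: a :: (l.erase a).erase a) :=
    (List.perm_cons_erase h1).trans ((List.perm_cons_erase h2).cons a)
  have h4 : ((a :: a :: (l.erase a).erase a).map f).prod = 0 := by
    rw [List.map_cons, List.prod_cons, List.map_cons, List.prod_cons, ← mul_assoc, ha, zero_mul]
  rcases prod_map_perm h h3 with h5 | h5 <;> rw [h5, h4]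
  exact neg_zero

end Lists

/-- The indices of the even coordinates. -/
def evenList (p q : ℕ) : List (Fin p ⊕ Fin q) := List.ofFn fun i => Sum.inl i

/-- The indices of the odd coordinates. -/
def oddList (p q : ℕ) : List (Fin p ⊕ Fin q) := List.ofFn fun j => Sum.inr j

theorem count_evenList (a : Fin p ⊕ Fin q) :
    (evenList p q).count a = Sum.elim (fun _ => 1) (fun _ => 0) a := by
  rcases a with i | j
  · exact List.count_eq_one_of_mem (List.nodup_ofFn.2 Sum.inl_injective)
      (List.mem_ofFn.2 ⟨i, rfl⟩)
  · exact List.count_eq_zero.2 fun h => by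
      obtain ⟨i, hi⟩ := List.mem_ofFn.1 h
      exact Sum.inl_ne_inr hi

theorem count_oddList (a : Fin p ⊕ Fin q) :
    (oddList p q).count a = Sum.elim (fun _ => 0) (fun _ => 1) a := by
  rcases a with i | j
  · exact List.count_eq_zero.2 fun h => by
      obtain ⟨i, hi⟩ := List.mem_ofFn.1 h
      exact Sum.inr_ne_inl hi
  · exact List.count_eq_one_of_mem (List.nodup_ofFn.2 Sum.inr_injective)
      (List.mem_ofFn.2 ⟨j, rfl⟩)

/-! ### Weight decomposition and exactness in nonzero weight. -/

namespace Coords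

variable (c : M.Coords p q U)

theorem dx_supercomm (a b : Fin p ⊕ Fin q) :
    df M p q U (c.x a) * df M p q U (c.x b) = df M p q U (c.x b) * df M p q U (c.x a) ∨
    df M p q U (c.x a) * df M p q U (c.x b) = -(df M p q U (c.x b) * df M p q U (c.x a)) := by
  rw [df_mul_df (c.x_parity a) (c.x_parity b)]
  rcases neg_one_pow_eq_or ℤ ((par a + 1) * (par b + 1)) with h | h <;> rw [h] <;> simp

theorem delOp_supercomm (a b : Fin p ⊕ Fin q) :
    c.delOp a * c.delOp b = c.delOp b * c.delOp a ∨
    c.delOp a * c.delOp b = -(c.delOp b * c.delOp a) := by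
  rw [c.delOp_mul_delOp a b]
  rcases neg_one_pow_eq_or ℤ (par a * par b) with h | h <;> rw [h] <;> simp

theorem count_le_one_of_dxMon_ne_zero {l : List (Fin p ⊕ Fin q)} (h : c.dxMon l ≠ 0) (i : Fin p) :
    l.count (Sum.inl i) ≤ 1 := by
  by_contra! h'
  exact h (prod_map_eq_zero c.dx_supercomm
    (eq_zero_of_eq_neg (K := K) (c.df_z_anticomm i i)) h')

theorem count_le_one_of_delMon_ne_zero {l : List (Fin p ⊕ Fin q)} (h : c.delMon l ≠ 0)
    (j : Fin q) : l.count (Sum.inr j) ≤ 1 := by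
  by_contra! h'
  exact h (prod_map_eq_zero c.delOp_supercomm
    (eq_zero_of_eq_neg (K := K) (c.delOp_θ_anticomm j j)) h')

theorem dxMon_evenList : c.dxMon (evenList p q) = c.dz := by
  rw [dxMon, evenList, List.map_ofFn]; rfl

theorem delMon_oddList : c.delMon (oddList p q) = c.delθ := by
  rw [delMon, oddList, List.map_ofFn]; rfl

/-- For nonzero factors every summand of the weight is nonnegative: 1 + m_i - l_i with l_i ≤ 1 for
even indices, 1 + l_j - m_j with m_j ≤ 1 for odd ones. A vanishing sum therefore fixes all
multiplicities. -/
theorem perm_of_weight_eq_zero {l m : List (Fin p ⊕ Fin q)} (hl : c.dxMon l ≠ 0)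
    (hm : c.delMon m ≠ 0) (h : weight l m = 0) :
    l.Perm (evenList p q) ∧ m.Perm (oddList p q) := by
  have h1 : ∀ a : Fin p ⊕ Fin q, 0 ≤ 1 + (-1) ^ (par a) * ((m.count a : ℤ) - l.count a) := by
    rintro (i | j)
    · have := c.count_le_one_of_dxMon_ne_zero hl i
      simp only [par, Sum.elim_inl, pow_zero, one_mul]
      omega
    · have := c.count_le_one_of_delMon_ne_zero hm j
      simp only [par, Sum.elim_inr, pow_one, neg_mul, one_mul]
      omega
  have h2 := (Finset.sum_eq_zero_iff_of_nonneg fun a _ => h1 a).1 h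
  refine ⟨List.perm_iff_count.2 ?_, List.perm_iff_count.2 ?_⟩ <;> rintro (i | j)
  · have := c.count_le_one_of_dxMon_ne_zero hl i
    have h3 := h2 (Sum.inl i) (Finset.mem_univ _)
    simp only [par, Sum.elim_inl, pow_zero, one_mul] at h3
    rw [count_evenList]
    simp only [Sum.elim_inl]
    omega
  · have := c.count_le_one_of_delMon_ne_zero hm j
    have h3 := h2 (Sum.inr j) (Finset.mem_univ _)
    simp only [par, Sum.elim_inr, pow_one, neg_mul, one_mul] at h3
    rw [count_evenList]
    simp only [Sum.elim_inr]
    omega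
  · have := c.count_le_one_of_dxMon_ne_zero hl i
    have h3 := h2 (Sum.inl i) (Finset.mem_univ _)
    simp only [par, Sum.elim_inl, pow_zero, one_mul] at h3
    rw [count_oddList]
    simp only [Sum.elim_inl]
    omega
  · have := c.count_le_one_of_delMon_ne_zero hm j
    have h3 := h2 (Sum.inr j) (Finset.mem_univ _)
    simp only [par, Sum.elim_inr, pow_one, neg_mul, one_mul] at h3
    rw [count_oddList]
    simp only [Sum.elim_inr]
    omega

/-- The cocycles `dz_1 … dz_p ⊗ ∂_{θ_1} … ∂_{θ_q} f`. -/
def genMap : M.Sec U →ₗ[K] M.UdR p q U where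
  toFun f := tens c.dz (c.delθ * M.fnOp U f)
  map_add' f g := by rw [map_add, mul_add, tens_add_right]
  map_smul' r f := by rw [map_smul, mul_smul_comm, tens_smul_right]; rfl

theorem genMap_apply (f : M.Sec U) : c.genMap f = tens c.dz (c.delθ * M.fnOp U f) := rfl

theorem mon_mem_range_genMap {l m : List (Fin p ⊕ Fin q)} (h : weight l m = 0) (f : M.Sec U) :
    c.mon l m f ∈ LinearMap.range c.genMap := by
  by_cases hl : c.dxMon l = 0
  · rw [mon, hl, tens_zero_left]; exact zero_mem _
  by_cases hm : c.delMon m = 0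
  · rw [mon, hm, zero_mul, tens_zero_right]; exact zero_mem _
  obtain ⟨h1, h2⟩ := c.perm_of_weight_eq_zero hl hm h
  have h3 : c.dxMon l = c.dz ∨ c.dxMon l = -c.dz := by
    rw [← dxMon_evenList]; exact prod_map_perm c.dx_supercomm h1
  have h4 : c.delMon m = c.delθ ∨ c.delMon m = -c.delθ := by
    rw [← delMon_oddList]; exact prod_map_perm c.delOp_supercomm h2
  have h0 : tens c.dz (c.delθ * M.fnOp U f) ∈ LinearMap.range c.genMap := ⟨f, rfl⟩
  rcases h3 with h3 | h3 <;> rcases h4 with h4 | h4 <;> rw [mon, h3, h4] <;>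
    simp only [neg_mul, tens_neg_left, tens_neg_right, neg_neg, neg_mem_iff, h0]

/-- The span of the monomials of a given weight. -/
def weightSpan (n : ℤ) : Submodule K (M.UdR p q U) :=
  Submodule.span K {t | ∃ (l m : List (Fin p ⊕ Fin q)) (f : M.Sec U),
    weight l m = n ∧ t = c.mon l m f}

/-- The homotopy operator. -/
def weightOp : Module.End K (M.UdR p q U) := c.homotopy ∘ₗ c.DK + c.DK ∘ₗ c.homotopy

theorem weightSpan_le (n : ℤ) : c.weightSpan n ≤ c.weightOp.eigenspace (n : K) := by
  refine Submodule.span_le.2 ?_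
  rintro _ ⟨l, m, f, rfl, rfl⟩
  rw [SetLike.mem_coe, Module.End.mem_eigenspace_iff, Int.cast_smul_eq_zsmul]
  exact c.homotopy_DK_add l m f

theorem weight_cons (a : Fin p ⊕ Fin q) (l m : List (Fin p ⊕ Fin q)) :
    weight (a :: l) (a :: m) = weight l m := by
  refine Finset.sum_congr rfl fun b _ => ?_
  rw [List.count_cons, List.count_cons]
  push_cast
  ring

/-- D adjoins the same index to both lists, and the weight sees only the difference of
multiplicities. -/
theorem DK_mem_weightSpan {n : ℤ} {t : M.UdR p q U} (ht : t ∈ c.weightSpan n) :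
    c.DK t ∈ c.weightSpan n := by
  induction ht using Submodule.span_induction with
  | mem t h =>
    obtain ⟨l, m, f, rfl, rfl⟩ := h
    rw [mon, c.DK_tens_of_closed (c.d_dxMon l)]
    refine sum_mem fun b _ => ?_
    have : c.mon (b :: l) (b :: m) f ∈ c.weightSpan (weight l m) :=
      Submodule.subset_span ⟨_, _, f, weight_cons b l m, rfl⟩
    rw [mon, dxMon_cons, delMon_cons] at this
    rcases c.formσ_pow_dxMon (par b) l with h | h <;> rw [h, ← mul_assoc]
    · exact this
    · rw [mul_neg, tens_neg_left]
      exact neg_mem this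
  | zero => rw [map_zero]; exact zero_mem _
  | add P Q _ _ h h' => rw [map_add]; exact add_mem h h'
  | smul r P _ h => rw [map_smul]; exact Submodule.smul_mem _ _ h

/-- For a cycle of weight n the homotopy identity reads D H t = n t, and n is invertible in K. -/
theorem eq_DK_of_weight_ne_zero {n : ℤ} (hn : n ≠ 0) {t : M.UdR p q U}
    (ht : t ∈ c.weightSpan n) (h : c.DK t = 0) : t ∈ LinearMap.range c.DK := by
  have h1 := Module.End.mem_eigenspace_iff.1 (c.weightSpan_le n ht)
  have h2 : c.DK (c.homotopy t) = (n : K) • t := by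
    rw [← h1, weightOp, LinearMap.add_apply, LinearMap.comp_apply, LinearMap.comp_apply, h,
      map_zero, zero_add]
  refine ⟨(n : K)⁻¹ • c.homotopy t, ?_⟩
  rw [map_smul, h2, smul_smul, inv_mul_cancel₀ (Int.cast_ne_zero.2 hn), one_smul]

theorem mem_range_of_DK_eq_zero {t : M.UdR p q U} (ht : t ∈ ⨆ n, c.weightSpan n)
    (h : c.DK t = 0) : t ∈ LinearMap.range c.genMap ⊔ LinearMap.range c.DK := by
  obtain ⟨v, hv, rfl⟩ := (Submodule.mem_iSup_iff_exists_finsupp _ _).1 ht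
  -- Distinct integers stay distinct in K, so D t = 0 forces every weight component of t to be a
  -- cycle.
  have hind : iSupIndep fun n : ℤ => c.weightOp.eigenspace (n : K) :=
    (Module.End.eigenspaces_iSupIndep c.weightOp).comp Int.cast_injective
  rw [Finsupp.sum, map_sum] at h
  have h1 := (iSupIndep_iff_finsetSum_eq_zero_imp_eq_zero _).1 hind v.support
    (fun n => c.DK (v n)) (fun n _ => c.weightSpan_le n (c.DK_mem_weightSpan (hv n))) h
  refine sum_mem fun n hn => ?_
  by_cases h0 : n = 0
  · refine Submodule.mem_sup_left ?_
    have := hv n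
    rw [h0] at this
    simp only [h0]
    refine Submodule.span_le.2 ?_ this
    rintro _ ⟨l, m, f, h, rfl⟩
    exact c.mon_mem_range_genMap h f
  · exact Submodule.mem_sup_right (c.eq_DK_of_weight_ne_zero h0 (hv n) (h1 n hn))

theorem mon_mem (l m : List (Fin p ⊕ Fin q)) (f : M.Sec U) :
    c.mon l m f ∈ ⨆ n, c.weightSpan n :=
  Submodule.mem_iSup_of_mem (weight l m) (Submodule.subset_span ⟨l, m, f, rfl, rfl⟩)

theorem tens_dxMon_mem (l : List (Fin p ⊕ Fin q)) {P : M.Diff U} (hP : P ∈ c.delSpan) :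
    tens (c.dxMon l) P ∈ ⨆ n, c.weightSpan n := by
  induction hP using Submodule.span_induction with
  | mem P h =>
    obtain ⟨m, f, rfl⟩ := h
    exact c.mon_mem l m f
  | zero => rw [tens_zero_right]; exact zero_mem _
  | add P Q _ _ h h' => rw [tens_add_right]; exact add_mem h h'
  | smul r P _ h => rw [tens_smul_right]; exact Submodule.smul_mem _ _ h

theorem tens_mem (ω : M.Forms p q U) {P : M.Diff U} (hP : P ∈ c.delSpan) :
    tens ω P ∈ ⨆ n, c.weightSpan n := by
  have := c.form_mem_span ω
  induction this using Submodule.span_induction with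
  | mem ω h =>
    obtain ⟨l, f, rfl⟩ := h
    rw [tens_fn]
    exact c.tens_dxMon_mem l (c.fnOp_mul_mem f hP)
  | zero => rw [tens_zero_left]; exact zero_mem _
  | add P Q _ _ h h' => rw [tens_add_left]; exact add_mem h h'
  | smul r P _ h => rw [tens_smul_left]; exact Submodule.smul_mem _ _ h

theorem weight_evenList_oddList : weight (evenList p q) (oddList p q) = 0 := by
  refine Finset.sum_eq_zero fun a _ => ?_
  rw [count_evenList, count_oddList]
  rcases a with i | j <;> simp [par]

theorem weight_append (l m : List (Fin p ⊕ Fin q)) (a : Fin p ⊕ Fin q) :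
    weight l (m ++ [a]) = weight l m + (-1) ^ par a := by
  have : ∀ b : Fin p ⊕ Fin q, (1 + (-1) ^ (par b) * (((m ++ [a]).count b : ℤ) - l.count b)) =
      (1 + (-1) ^ (par b) * ((m.count b : ℤ) - l.count b)) +
        if a = b then (-1) ^ par a else 0 := by
    intro b
    rw [List.count_append, List.count_singleton]
    by_cases h : a = b
    · subst h
      simp
      ring
    · simp [h]
  rw [weight, Finset.sum_congr rfl fun b _ => this b, Finset.sum_add_distrib, ← weight]
  simp

end Coords

/-! ### From monomials to homology classes. -/

theorem resForm_self (h : U ≤ U) (ω : M.Forms p q U) : resForm h ω = ω := by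
  induction ω using form_induction with
  | fn_hom n f _ => rw [resForm_fn, res_self]
  | df_hom n f _ => rw [resForm_df, res_self]
  | mul a b ha hb => rw [map_mul, ha, hb]
  | add a b ha hb => rw [map_add, ha, hb]

theorem resUdR_self (h : U ≤ U) (t : M.UdR p q U) : resUdR h t = t := by
  induction t using UdR_induction with
  | zero => exact map_zero _
  | h ω Q => rw [resUdR_tens, resForm_self, resDiff_self]
  | add s t hs ht => rw [map_add, hs, ht]

namespace Coords

variable (c : M.Coords p q U)

/-- One coordinate system on U tests all others, as D is independent of coordinates and commutes
with restriction. -/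
theorem mem_cocycles_iff (t : M.UdR p q U) : t ∈ M.cocycles p q U ↔ c.DK t = 0 := by
  refine ⟨fun h => ?_, fun h V hV c' => ?_⟩
  · have := h U le_rfl c
    rwa [resUdR_self] at this
  · rw [D_eq c' (c.restrict hV), ← resUdR_D, ← DK_apply, h, map_zero]

theorem mem_boundaries_iff (t : M.UdR p q U) :
    t ∈ M.boundaries p q U ↔ t ∈ LinearMap.range c.DK := by
  refine ⟨?_, ?_⟩
  · rintro ⟨s, hs⟩
    have := hs U le_rfl c
    rw [resUdR_self, resUdR_self] at this
    exact ⟨s, this.symm⟩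
  · rintro ⟨s, rfl⟩
    refine ⟨s, fun V hV c' => ?_⟩
    rw [D_eq c' (c.restrict hV), ← resUdR_D, DK_apply]

end Coords

theorem Homology.mk_eq_iff {s t : M.UdR p q U} (hs : s ∈ M.cocycles p q U)
    (ht : t ∈ M.cocycles p q U) :
    Homology.mk s hs = Homology.mk t ht ↔ s - t ∈ M.boundaries p q U := by
  rw [Homology.mk, Homology.mk, Submodule.Quotient.eq]
  rfl

theorem Homology.mk_eq_zero_iff {t : M.UdR p q U} (ht : t ∈ M.cocycles p q U) :
    Homology.mk t ht = 0 ↔ t ∈ M.boundaries p q U := by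
  rw [Homology.mk, Submodule.Quotient.mk_eq_zero]
  rfl

theorem Homology.exists_rep (η : M.Homology p q U) :
    ∃ (t : M.UdR p q U) (ht : t ∈ M.cocycles p q U), η = Homology.mk t ht := by
  obtain ⟨⟨t, ht⟩, rfl⟩ := Submodule.Quotient.mk_surjective _ η
  exact ⟨t, ht, rfl⟩

theorem Homology.op_smul_mk (P : M.Diff U) {t : M.UdR p q U} (ht : t ∈ M.cocycles p q U) :
    MulOpposite.op P • Homology.mk t ht =
      Homology.mk (MulOpposite.op P • t) (Submodule.smul_mem _ _ ht) := rfl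

namespace Coords

variable (c : M.Coords p q U)

/-- Appending ∂_a to the generator, which has weight 0, produces a cycle of weight (-1)^{|x_a|},
hence a boundary. -/
theorem delOp_smul_genClass (a : Fin p ⊕ Fin q) : MulOpposite.op (c.delOp a) • c.genClass = 0 := by
  rw [genClass, Homology.op_smul_mk, Homology.mk_eq_zero_iff, op_smul_tens, c.mem_boundaries_iff]
  have h1 : tens c.dz (c.delθ * c.delOp a) =
      c.mon (evenList p q) (oddList p q ++ [a]) 1 := by
    rw [mon, dxMon_evenList, delMon_append, delMon_oddList, map_one, mul_one, delMon_cons,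
      delMon_nil, mul_one]
  refine c.eq_DK_of_weight_ne_zero (n := (-1) ^ par a) (by simp) ?_ ?_
  · rw [h1]
    refine Submodule.subset_span ⟨_, _, 1, ?_, rfl⟩
    rw [weight_append, weight_evenList_oddList, zero_add]
  · rw [← c.mem_cocycles_iff, ← op_smul_tens]
    exact Submodule.smul_mem _ _ c.dz_tens_delθ_mem

theorem exists_eq_genClass_smul {t : M.UdR p q U} (ht : t ∈ M.cocycles p q U)
    (h : t ∈ ⨆ n, c.weightSpan n) :
    ∃ f : M.Sec U, Homology.mk t ht = MulOpposite.op (M.fnOp U f) • c.genClass := by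
  obtain ⟨_, ⟨f, rfl⟩, s, hs, hfs⟩ := Submodule.mem_sup.1
    (c.mem_range_of_DK_eq_zero h ((c.mem_cocycles_iff t).1 ht))
  refine ⟨f, ?_⟩
  rw [genClass, Homology.op_smul_mk, Homology.mk_eq_iff, c.mem_boundaries_iff, op_smul_tens,
    ← genMap_apply, ← hfs, add_sub_cancel_left]
  exact hs

/-- The conclusion is asked for all smaller open sets so that, for sums, it can be transferred to
the intersection of two neighbourhoods. -/
theorem resUdR_mem_iSup (t : M.UdR p q U) {x : M.space} (hx : x ∈ U) :
    ∃ (V : Opens M.space) (h : V ≤ U), x ∈ V ∧ ∀ (W : Opens M.space) (h' : W ≤ V),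
      resUdR (h'.trans h) t ∈ ⨆ n, (c.restrict (h'.trans h)).weightSpan n := by
  induction t using UdR_induction with
  | zero => exact ⟨U, le_rfl, hx, fun W h' => by rw [map_zero]; exact zero_mem _⟩
  | h ω Q =>
    obtain ⟨V, hV, hxV, hP⟩ := exists_genDiff_nhd Q hx
    refine ⟨V, hV, hxV, fun W h' => ?_⟩
    rw [resUdR_tens]
    exact tens_mem _ _ (mem_delSpan _ (M.genDiff_res h' hP))
  | add s t hs ht =>
    obtain ⟨V, hV, hxV, h⟩ := hs
    obtain ⟨V', hV', hxV', h'⟩ := ht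
    refine ⟨V ⊓ V', inf_le_left.trans hV, ⟨hxV, hxV'⟩, fun W hW => ?_⟩
    rw [map_add]
    exact add_mem (h W (hW.trans inf_le_left)) (h' W (hW.trans inf_le_right))

theorem resHomology_eq_genClass_smul (η : M.Homology p q U) {x : M.space} (hx : x ∈ U) :
    ∃ (V : Opens M.space) (h : V ≤ U), x ∈ V ∧ ∃ f : M.Sec V,
      resHomology h η = MulOpposite.op (M.fnOp V f) • (c.restrict h).genClass := by
  obtain ⟨t, ht, rfl⟩ := Homology.exists_rep η
  obtain ⟨V, h, hxV, h'⟩ := c.resUdR_mem_iSup t hx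
  obtain ⟨f, hf⟩ := (c.restrict h).exists_eq_genClass_smul (resUdR_mem_cocycles h ht)
    (h' V le_rfl)
  exact ⟨V, h, hxV, f, hf⟩

end Coords

/-! ### Iterated odd derivations and determinants. -/

section IteratedDerivations

variable {k R C : Type*} [CommRing k] [Ring R] [Algebra k R]

/-- The composition `δ_{n-1} … δ_0`. -/
def iterDer : (n : ℕ) → (Fin n → R →ₗ[k] R) → R →ₗ[k] R
  | 0, _ => LinearMap.id
  | n + 1, δ => iterDer n (fun i => δ i.succ) ∘ₗ δ 0

theorem iterDer_zero (δ : Fin 0 → R →ₗ[k] R) (x : R) : iterDer 0 δ x = x := rfl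

theorem iterDer_succ {n : ℕ} (δ : Fin (n + 1) → R →ₗ[k] R) (x : R) :
    iterDer (n + 1) δ x = iterDer n (fun i => δ i.succ) (δ 0 x) := rfl

theorem iterDer_map {R' : Type*} [Ring R'] [Algebra k R'] {n : ℕ} {δ : Fin n → R →ₗ[k] R}
    {δ' : Fin n → R' →ₗ[k] R'} (F : R → R') (h : ∀ i x, F (δ i x) = δ' i (F x)) (x : R) :
    F (iterDer n δ x) = iterDer n δ' (F x) := by
  induction n generalizing x with
  | zero => rfl
  | succ n ih => rw [iterDer_succ, iterDer_succ, ih fun i x => h i.succ x, h]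

theorem iterDer_mem {n : ℕ} {δ : Fin n → R →ₗ[k] R} {S : Submodule k R}
    (h : ∀ i, ∀ x ∈ S, δ i x ∈ S) {x : R} (hx : x ∈ S) : iterDer n δ x ∈ S := by
  induction n generalizing x with
  | zero => exact hx
  | succ n ih => exact ih (fun i x hx => h i.succ x hx) (h 0 x hx)

variable [CommRing C] {S : R →ₐ[k] R} {j : C →+* R}

/-- Either y survives all derivations, or exactly one δ_i hits it after y has passed the i preceding
ones, each with a sign. The resulting constant then passes through the remaining derivations. -/
theorem iterDer_mul {n : ℕ} {δ : Fin (n + 1) → R →ₗ[k] R}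
    (hδ : ∀ i x y, δ i (x * y) = δ i x * y + S x * δ i y) (hj : ∀ r, S (j r) = j r)
    (hδj : ∀ i r, δ i (j r) = 0) {y : R} (hy : S y = -y) {a : Fin (n + 1) → C}
    (ha : ∀ i, δ i y = j (a i)) (Y : R) :
    iterDer (n + 1) δ (y * Y) = (-1 : ℤ) ^ (n + 1) • (y * iterDer (n + 1) δ Y) +
      ∑ i : Fin (n + 1), (-1 : ℤ) ^ (i : ℕ) •
        (j (a i) * iterDer n (fun l => δ (i.succAbove l)) Y) := by
  induction n generalizing Y with
  | zero =>
    rw [iterDer_succ, iterDer_succ, iterDer_zero, iterDer_zero, hδ, ha, hy]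
    simp [iterDer_zero, add_comm]
  | succ n ih =>
    have h1 : ∀ r Y, iterDer (n + 1) (fun i => δ i.succ) (j r * Y) =
        j r * iterDer (n + 1) (fun i => δ i.succ) Y := fun r Y =>
      (iterDer_map (fun x => j r * x) (fun i x => by
        rw [hδ, hδj, zero_mul, zero_add, hj]) Y).symm
    rw [iterDer_succ, hδ, ha, hy, map_add, h1, neg_mul, map_neg,
      ih (fun i => hδ i.succ) (fun i => hδj i.succ) (fun i => ha i.succ), Fin.sum_univ_succ (n := n + 1),
      iterDer_succ δ Y]
    have h2 : ∀ i : Fin (n + 1), iterDer (n + 1) (fun l => δ (i.succ.succAbove l)) Y =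
        iterDer n (fun l => δ (i.succAbove l).succ) (δ 0 Y) := fun i => by
      rw [iterDer_succ, Fin.succ_succAbove_zero]
      simp only [Fin.succ_succAbove_succ]
    simp only [h2, Fin.val_zero, pow_zero, one_smul, Fin.zero_succAbove, Fin.val_succ, pow_succ,
      mul_neg, mul_one, neg_smul, Finset.sum_neg_distrib]
    abel

/-- There are more derivations than factors, so some derivation must hit a constant. -/
theorem iterDer_prod_eq_zero {n : ℕ} {δ : Fin n → R →ₗ[k] R}
    (hδ : ∀ i x y, δ i (x * y) = δ i x * y + S x * δ i y) (hj : ∀ r, S (j r) = j r)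
    (hδj : ∀ i r, δ i (j r) = 0) {l : List R} (hl : ∀ y ∈ l, S y = -y)
    (ha : ∀ y ∈ l, ∀ i, ∃ a, δ i y = j a) (hn : l.length < n) : iterDer n δ l.prod = 0 := by
  induction l generalizing n with
  | nil =>
    obtain ⟨n, rfl⟩ := Nat.exists_eq_succ_of_ne_zero hn.ne'
    rw [List.prod_nil, iterDer_succ, ← map_one j, hδj, map_zero]
  | cons y l ih =>
    obtain ⟨n, rfl⟩ := Nat.exists_eq_succ_of_ne_zero (Nat.ne_zero_of_lt hn)
    rw [List.length_cons] at hn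
    choose a ha' using ha y List.mem_cons_self
    have hl' := fun z hz => hl z (List.mem_cons_of_mem _ hz)
    have hal := fun z hz => ha z (List.mem_cons_of_mem _ hz)
    rw [List.prod_cons, iterDer_mul hδ hj hδj (hl y List.mem_cons_self) ha',
      ih hδ hδj hl' hal (by omega), mul_zero, smul_zero, zero_add]
    refine Finset.sum_eq_zero fun i _ => ?_
    rw [ih (fun l => hδ _) (fun l => hδj _) hl' (fun z hz l => hal z hz _) (by omega), mul_zero,
      smul_zero]

/-- The composition of `n` odd derivations applied to a product of `n` odd elements is the
determinant of their values, if these values are constants. -/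
theorem iterDer_prod_ofFn {n : ℕ} {δ : Fin n → R →ₗ[k] R}
    (hδ : ∀ i x y, δ i (x * y) = δ i x * y + S x * δ i y) (hj : ∀ r, S (j r) = j r)
    (hδj : ∀ i r, δ i (j r) = 0) {y : Fin n → R} (hy : ∀ i, S (y i) = -y i)
    {A : Matrix (Fin n) (Fin n) C} (hA : ∀ i l, δ i (y l) = j (A i l)) :
    iterDer n δ (List.ofFn y).prod = j A.det := by
  induction n with
  | zero => rw [List.ofFn_zero, List.prod_nil, iterDer_zero, Matrix.det_fin_zero, map_one]
  | succ n ih =>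
    rw [List.ofFn_succ, List.prod_cons, iterDer_mul hδ hj hδj (hy 0) fun i => hA i 0,
      -- If the first factor survives, n + 1 derivations act on n factors and give zero; the
      -- remaining sum is the Laplace expansion along the first column.
      iterDer_prod_eq_zero hδ hj hδj
        (fun z hz => by obtain ⟨i, rfl⟩ := List.mem_ofFn.1 hz; exact hy _)
        (fun z hz i => by obtain ⟨l, rfl⟩ := List.mem_ofFn.1 hz; exact ⟨_, hA i _⟩)
        (by rw [List.length_ofFn]; exact Nat.lt_succ_self n),
      mul_zero, smul_zero, zero_add, Matrix.det_succ_column_zero, map_sum]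
    refine Finset.sum_congr rfl fun i _ => ?_
    rw [ih (fun l => hδ _) (fun l => hδj _) (fun l => hy l.succ)
      (A := A.submatrix i.succAbove Fin.succ) (fun l m => hA _ _), map_mul, map_mul, map_pow,
      map_neg, map_one, zsmul_eq_mul, mul_assoc]
    push_cast
    rfl

end IteratedDerivations

/-! ### The coefficient of the generator. -/

section Even

variable (M U) in
/-- The inclusion of the even functions into all functions. -/
def EvenSec.valHom : M.EvenSec U →+* M.Sec U where
  toFun := EvenSec.val
  map_one' := rfl
  map_mul' _ _ := rfl
  map_zero' := rfl
  map_add' _ _ := rfl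

theorem EvenSec.valHom_injective : Function.Injective (EvenSec.valHom M U) := fun _ _ h =>
  Subtype.ext h

theorem EvenSec.valHom_apply (f : M.EvenSec U) : EvenSec.valHom M U f = f.val := rfl

theorem EvenSec.σ_val (f : M.EvenSec U) : M.σ U f.val = f.val := f.2

theorem val_evenPart {f : M.Sec U} (hf : M.σ U f = f) : (evenPart f).val = f := by
  change (2 : K)⁻¹ • (f + M.σ U f) = f
  rw [hf, ← two_smul K f, smul_smul, inv_mul_cancel₀ two_ne_zero, one_smul]

end Even

namespace Coords

variable (c c' : M.Coords p q U)

/-- The coefficient of `dz_1 … dz_p` in a differential form. -/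
def topCoeff : M.Forms p q U →ₗ[K] M.Sec U :=
  (aug M p q U).toLinearMap ∘ₗ iterDer p fun i => c.contr (Sum.inl i)

/-- The coefficient of `∂_{θ_1} … ∂_{θ_q}` in a differential operator, with coefficients written
on the right. -/
def oddCoeff : M.Diff U →ₗ[K] M.Sec U :=
  c.red ∘ₗ iterDer q fun j => ad 1 (c.x (Sum.inr j))

theorem contr_mul_fn (a : Fin p ⊕ Fin q) (ω : M.Forms p q U) (f : M.Sec U) :
    c.contr a (ω * fn M p q U f) = c.contr a ω * fn M p q U f := by
  rw [contr_mul, contr_fn, mul_zero, add_zero]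

theorem topCoeff_mul_fn (ω : M.Forms p q U) (f : M.Sec U) :
    c.topCoeff (ω * fn M p q U f) = c.topCoeff ω * f := by
  have := iterDer_map (δ := fun i : Fin p => c.contr (Sum.inl i)) (fun ω => ω * fn M p q U f)
    (fun i x => (c.contr_mul_fn _ x f).symm) ω
  rw [topCoeff, LinearMap.comp_apply, ← this]
  change aug M p q U (_ * _) = _
  rw [map_mul, aug_fn]
  rfl

theorem oddCoeff_mul_fnOp (P : M.Diff U) (f : M.Sec U) :
    c.oddCoeff (P * M.fnOp U f) = c.oddCoeff P * f := by
  have := iterDer_map (δ := fun j : Fin q => ad 1 (c.x (Sum.inr j)))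
    (δ' := fun j : Fin q => ad 1 (c.x (Sum.inr j))) (fun P => P * M.fnOp U f)
    (fun j x => by
      have := ad_fnOp (c.x_parity (Sum.inr j)) f
      simp only [par, Sum.elim_inr] at this
      rw [ad_mul, this, mul_zero, add_zero]) P
  rw [oddCoeff, LinearMap.comp_apply, ← this, red_mul_fnOp]
  rfl

/-- Supercommutators with θ_j commute with left multiplication by ∂_{z_i}, which therefore stays in
front, where `red` kills it. -/
theorem oddCoeff_delOp_mul (i : Fin p) (P : M.Diff U) :
    c.oddCoeff (c.delOp (Sum.inl i) * P) = 0 := by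
  have := iterDer_map (δ := fun j : Fin q => ad 1 (c.x (Sum.inr j)))
    (fun P => c.delOp (Sum.inl i) * P)
    (fun j x => by
      have := c.ad_delOp_mul (Sum.inr j) (Sum.inl i) x
      simp only [par, Sum.elim_inl, Sum.elim_inr, mul_zero, pow_zero, one_smul, reduceCtorEq,
        if_false, sub_zero] at this
      exact this.symm) P
  rw [oddCoeff, LinearMap.comp_apply, ← this, red_delOp_mul]

/-- The form dθ_j is even and is killed by ι_{∂_{z_i}}, so it stays in front of all contractions,
where the augmentation kills it. -/
theorem topCoeff_dxMon_inr (j : Fin q) (ω : M.Forms p q U) :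
    c.topCoeff (df M p q U (c.x (Sum.inr j)) * ω) = 0 := by
  have := iterDer_map (δ := fun i : Fin p => c.contr (Sum.inl i))
    (fun ω => df M p q U (c.x (Sum.inr j)) * ω)
    (fun i x => by
      have := c.contr_dx_mul (Sum.inl i) (Sum.inr j) x
      simp only [par, Sum.elim_inl, Sum.elim_inr, reduceCtorEq, if_false, zero_add, one_mul] at this
      rw [this]
      simp) ω
  rw [topCoeff, LinearMap.comp_apply, ← this]
  change aug M p q U (_ * _) = _
  rw [map_mul, aug_df, zero_mul]

/-- Contractions preserve the K-span of the coordinate monomials. Constancy matters in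
`genCoeff_dxMon_cons`: a scalar can be pulled in front of ∂_{z_i} without a correction term. -/
theorem topCoeff_dxMon (l : List (Fin p ⊕ Fin q)) :
    ∃ r : K, c.topCoeff (c.dxMon l) = algebraMap K _ r := by
  set S := Submodule.span K (Set.range c.dxMon) with hS
  have hdx : ∀ b, ∀ ω ∈ S, df M p q U (c.x b) * ω ∈ S := by
    intro b ω hω
    induction hω using Submodule.span_induction with
    | mem ω h =>
      obtain ⟨l, rfl⟩ := h
      rw [← dxMon_cons]
      exact Submodule.subset_span ⟨_, rfl⟩
    | zero => rw [mul_zero]; exact zero_mem _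
    | add P Q _ _ h h' => rw [mul_add]; exact add_mem h h'
    | smul r P _ h => rw [mul_smul_comm]; exact Submodule.smul_mem _ _ h
  have hmon : ∀ a l, c.contr a (c.dxMon l) ∈ S := by
    intro a l
    induction l with
    | nil => rw [dxMon_nil, ← map_one (fn M p q U), contr_fn]; exact zero_mem _
    | cons b l ih =>
      rw [dxMon_cons, contr_dx_mul]
      refine add_mem ?_ (zsmul_mem (hdx _ _ ih) _)
      split
      · exact Submodule.subset_span ⟨_, rfl⟩
      · exact zero_mem _
  have hcontr : ∀ a, ∀ ω ∈ S, c.contr a ω ∈ S := by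
    intro a ω hω
    have : S ≤ S.comap (c.contr a) := Submodule.span_le.2 (by rintro _ ⟨l, rfl⟩; exact hmon a l)
    exact this hω
  have h1 : iterDer p (fun i => c.contr (Sum.inl i)) (c.dxMon l) ∈ S :=
    iterDer_mem (fun i => hcontr _) (Submodule.subset_span ⟨l, rfl⟩)
  have h2 : S ≤ (Subalgebra.toSubmodule (⊥ : Subalgebra K (M.Sec U))).comap
      (aug M p q U).toLinearMap := by
    refine Submodule.span_le.2 ?_
    rintro _ ⟨l, rfl⟩
    change aug M p q U (c.dxMon l) ∈ (⊥ : Subalgebra K (M.Sec U))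
    cases l with
    | nil => rw [dxMon_nil, map_one]; exact one_mem _
    | cons b l => rw [dxMon_cons, map_mul, aug_df, zero_mul]; exact zero_mem _
  obtain ⟨r, hr⟩ := Algebra.mem_bot.1 (h2 h1)
  exact ⟨r, hr.symm⟩

/-- The coefficient of `dz_1 … dz_p ⊗ ∂_{θ_1} … ∂_{θ_q}` in an element of the universal de Rham
complex. -/
def genCoeff : M.UdR p q U →ₗ[K] M.Sec U :=
  liftUdR (c.oddCoeff ∘ₗ LinearMap.mul' K (M.Diff U) ∘ₗ
    (TensorProduct.comm K (M.Diff U) (M.Diff U)).toLinearMap ∘ₗ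
    TensorProduct.map LinearMap.id ((M.fnOp U).toLinearMap ∘ₗ c.topCoeff))
    (fun ω f P => by
      change c.oddCoeff (M.fnOp U (c.topCoeff (ω * fn M p q U f)) * P) =
        c.oddCoeff (M.fnOp U (c.topCoeff ω) * (M.fnOp U f * P))
      rw [topCoeff_mul_fn, map_mul (M.fnOp U), mul_assoc])

theorem genCoeff_tens (ω : M.Forms p q U) (P : M.Diff U) :
    c.genCoeff (tens ω P) = c.oddCoeff (M.fnOp U (c.topCoeff ω) * P) := rfl

theorem genCoeff_op_smul (f : M.Sec U) (t : M.UdR p q U) :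
    c.genCoeff (MulOpposite.op (M.fnOp U f) • t) = c.genCoeff t * f := by
  induction t using UdR_induction with
  | zero => rw [smul_zero, map_zero, zero_mul]
  | h ω P => rw [op_smul_tens, genCoeff_tens, genCoeff_tens, ← mul_assoc, oddCoeff_mul_fnOp]
  | add s t hs ht => rw [smul_add, map_add, map_add, hs, ht, add_mul]

theorem genCoeff_dxMon_cons (b : Fin p ⊕ Fin q) (l : List (Fin p ⊕ Fin q)) (P : M.Diff U) :
    c.genCoeff (tens (c.dxMon (b :: l)) (c.delOp b * P)) = 0 := by
  rw [genCoeff_tens]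
  rcases b with i | j
  · obtain ⟨r, hr⟩ := c.topCoeff_dxMon (Sum.inl i :: l)
    rw [hr, AlgHom.commutes, ← Algebra.smul_def, map_smul, oddCoeff_delOp_mul, smul_zero]
  · rw [dxMon_cons, topCoeff_dxMon_inr, map_zero, zero_mul, map_zero]

/-- D of a monomial is a sum of terms having dx_b and ∂_b in front. For even b the factor ∂_b is
killed on the operator side, for odd b the factor dx_b on the form side. -/
theorem genCoeff_DK (t : M.UdR p q U) : c.genCoeff (c.DK t) = 0 := by
  induction t using UdR_induction with
  | zero => rw [map_zero, map_zero]
  | h ω P =>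
    have := c.form_mem_span ω
    induction this using Submodule.span_induction with
    | mem ω h =>
      obtain ⟨l, f, rfl⟩ := h
      rw [tens_fn, c.DK_tens_of_closed (c.d_dxMon l), map_sum]
      refine Finset.sum_eq_zero fun b _ => ?_
      rcases c.formσ_pow_dxMon (par b) l with h | h <;> rw [h]
      · rw [← dxMon_cons, genCoeff_dxMon_cons]
      · rw [mul_neg, ← dxMon_cons, tens_neg_left, map_neg, genCoeff_dxMon_cons, neg_zero]
    | zero => rw [tens_zero_left, map_zero, map_zero]
    | add _ _ _ _ h h' => rw [tens_add_left, map_add, map_add, h, h', add_zero]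
    | smul r _ _ h => rw [tens_smul_left, map_smul, map_smul, h, smul_zero]
  | add s t hs ht => rw [map_add, map_add, hs, ht, add_zero]

theorem res_genCoeff (h : V ≤ U) (t : M.UdR p q U) :
    M.res h (c.genCoeff t) = (c.restrict h).genCoeff (resUdR h t) := by
  induction t using UdR_induction with
  | zero => rw [map_zero, map_zero, map_zero, map_zero]
  | h ω P =>
    have h1 : M.res h (c.topCoeff ω) = (c.restrict h).topCoeff (resForm h ω) := by
      change M.res h (aug M p q U _) = aug M p q V _
      rw [res_aug]
      exact congrArg _ (iterDer_map (resForm h) (fun i x => resForm_contr _ h x) ω)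
    have h2 : ∀ Q, M.res h (c.oddCoeff Q) = (c.restrict h).oddCoeff (M.resDiff h Q) := by
      intro Q
      change M.res h (c.red _) = (c.restrict h).red _
      rw [res_red]
      exact congrArg _ (iterDer_map (M.resDiff h) (fun j x => resDiff_ad h _ _ x) Q)
    rw [resUdR_tens, genCoeff_tens, genCoeff_tens, h2, map_mul, resDiff_fnOp, h1]
  | add s t hs ht => rw [map_add, map_add, hs, ht, map_add, map_add]

/-! ### Change of coordinates and the Berezinian. -/

/-- The even-even block of the Jacobian. -/
def jacEven : Matrix (Fin p) (Fin p) (M.EvenSec U) := (jacobian c c').toBlocks₁₁.map evenPart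

/-- The odd-odd block of the Jacobian. -/
def jacOdd : Matrix (Fin q) (Fin q) (M.EvenSec U) := (jacobian c c').toBlocks₂₂.map evenPart

theorem σ_jacobian (a b : Fin p ⊕ Fin q) :
    M.σ U (jacobian c c' a b) = (-1 : ℤ) ^ (par a + par b) • jacobian c c' a b :=
  (c.del_isDerivation a).ev_hasParity (c'.x_parity b)

theorem val_jacEven (i l : Fin p) :
    (jacEven c c' i l).val = (c.del (Sum.inl i)).ev (c'.x (Sum.inl l)) :=
  val_evenPart ((c.σ_jacobian c' (Sum.inl i) (Sum.inl l)).trans (by simp [par]; rfl))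

theorem val_jacOdd (i l : Fin q) :
    (jacOdd c c' i l).val = (c.del (Sum.inr i)).ev (c'.x (Sum.inr l)) :=
  val_evenPart ((c.σ_jacobian c' (Sum.inr i) (Sum.inr l)).trans (by simp [par]; rfl))

theorem topCoeff_dz : c.topCoeff c'.dz = (jacEven c c').det.val := by
  have := iterDer_prod_ofFn (k := K) (S := formσ M p q U)
    (j := (fn M p q U).toRingHom.comp (EvenSec.valHom M U))
    (δ := fun i => c.contr (Sum.inl i)) (y := fun i => df M p q U (c'.x (Sum.inl i)))
    (A := jacEven c c')
    (fun i x y => by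
      exact (contr_mul _ x y).trans (by simp [par]; rfl))
    (fun r => (formσ_fn _).trans (congrArg _ r.σ_val))
    (fun i r => contr_fn _ _)
    (fun i => (formσ_df_hom (c'.x_parity (Sum.inl i))).trans (by simp [par]))
    (fun i l => (contr_df _ _).trans (congrArg _ (val_jacEven c c' i l).symm))
  rw [topCoeff, LinearMap.comp_apply, dz, this]
  exact aug_fn _

theorem iterDer_delθ : iterDer q (fun j => ad 1 (c.x (Sum.inr j))) c'.delθ =
    M.fnOp U (jacOdd c' c).det.val := by
  have := iterDer_prod_ofFn (k := K) (S := conjDiff M U)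
    (j := (M.fnOp U).toRingHom.comp (EvenSec.valHom M U))
    (δ := fun i => ad 1 (c.x (Sum.inr i))) (y := fun i => c'.delOp (Sum.inr i))
    -- The supercommutator of θ_i with ∂_{θ'_l} is ∂θ_i/∂θ'_l, so rows and columns are exchanged
    -- with respect to the Jacobian.
    (A := (jacOdd c' c).transpose)
    (fun i x y => by rw [ad_mul, pow_one])
    (fun r => (conjDiff_fnOp _).trans (congrArg _ r.σ_val))
    (fun i r => ad_fnOp (c.x_parity (Sum.inr i)) _)
    (fun i => (conjDiff_vecOp _).trans (by simp [par]; rfl))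
    (fun i l => by
      have h1 := ad_vecOp (c.x_parity (Sum.inr i)) (c'.del_isDerivation (Sum.inr l))
      have h2 : (M.fnOp U).toRingHom.comp (EvenSec.valHom M U) ((jacOdd c' c).transpose i l) =
          M.fnOp U ((c'.del (Sum.inr l)).ev (c.x (Sum.inr i))) :=
        congrArg (M.fnOp U) (val_jacOdd c' c l i)
      rw [h2]
      change ad 1 (c.x (Sum.inr i)) (c'.delOp (Sum.inr l)) = _ at h1
      rw [h1]
      simp [par])
  rw [delθ, this, Matrix.det_transpose]
  rfl

theorem genCoeff_gen : c.genCoeff (tens c'.dz c'.delθ) =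
    ((jacEven c c').det * (jacOdd c' c).det).val := by
  -- The determinant from the even block is an even function, hence passes through all
  -- supercommutators without a sign.
  have h1 := iterDer_map (δ := fun j : Fin q => ad 1 (c.x (Sum.inr j)))
    (δ' := fun j : Fin q => ad 1 (c.x (Sum.inr j)))
    (fun P => M.fnOp U (jacEven c c').det.val * P)
    (fun j x => by
      have := ad_fnOp_mul (c.x_parity (Sum.inr j)) (jacEven c c').det.val x
      simp only [par, Sum.elim_inr, pow_one, EvenSec.σ_val] at this
      exact this.symm) c'.delθ
  rw [genCoeff_tens, topCoeff_dz, oddCoeff, LinearMap.comp_apply, ← h1, iterDer_delθ, ← map_mul,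
    red_fnOp]
  rfl

/-- The coefficient with respect to `[dz_1 … dz_p ⊗ ∂_{θ_1} … ∂_{θ_q}]` of a homology class. -/
def homCoeff : M.Homology p q U →ₗ[K] M.Sec U :=
  (((M.boundaries p q U).submoduleOf (M.cocycles p q U)).restrictScalars K).liftQ
      (c.genCoeff ∘ₗ (M.cocycles p q U).subtype.restrictScalars K) (fun t ht => by
        obtain ⟨s, hs⟩ := (c.mem_boundaries_iff _).1 ht
        change c.genCoeff t.1 = 0
        change c.DK s = t.1 at hs
        rw [← hs, genCoeff_DK]) ∘ₗ
    (Submodule.Quotient.restrictScalarsEquiv K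
      ((M.boundaries p q U).submoduleOf (M.cocycles p q U))).symm.toLinearMap

theorem homCoeff_mk {t : M.UdR p q U} (ht : t ∈ M.cocycles p q U) :
    c.homCoeff (Homology.mk t ht) = c.genCoeff t := rfl

theorem homCoeff_op_smul (f : M.Sec U) (η : M.Homology p q U) :
    c.homCoeff (MulOpposite.op (M.fnOp U f) • η) = c.homCoeff η * f := by
  obtain ⟨t, ht, rfl⟩ := Homology.exists_rep η
  rw [Homology.op_smul_mk, homCoeff_mk, homCoeff_mk, genCoeff_op_smul]

theorem res_homCoeff (h : V ≤ U) (η : M.Homology p q U) :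
    M.res h (c.homCoeff η) = (c.restrict h).homCoeff (resHomology h η) := by
  obtain ⟨t, ht, rfl⟩ := Homology.exists_rep η
  rw [resHomology_mk, homCoeff_mk, homCoeff_mk, res_genCoeff]

theorem homCoeff_genClass : c.homCoeff c'.genClass =
    ((jacEven c c').det * (jacOdd c' c).det).val := genCoeff_gen c c'

theorem jacEven_self : jacEven c c = 1 := by
  ext i l
  refine EvenSec.valHom_injective ?_
  rw [EvenSec.valHom_apply, val_jacEven, c.del_x, Matrix.one_apply]
  simp only [Sum.inl.injEq]
  split <;> simp

theorem jacOdd_self : jacOdd c c = 1 := by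
  ext i l
  refine EvenSec.valHom_injective ?_
  rw [EvenSec.valHom_apply, val_jacOdd, c.del_x, Matrix.one_apply]
  simp only [Sum.inr.injEq]
  split <;> simp

theorem homCoeff_genClass_self : c.homCoeff c.genClass = 1 := by
  rw [homCoeff_genClass, jacEven_self, jacOdd_self, Matrix.det_one, Matrix.det_one, mul_one]
  rfl

theorem delθ_mem_delSpan : c'.delθ ∈ c.delSpan := by
  have : ∀ l : List (M.Diff U), (∀ P ∈ l, P ∈ c.delSpan) → l.prod ∈ c.delSpan := by
    intro l hl
    induction l with
    | nil => rw [List.prod_nil, ← map_one (M.fnOp U)]; exact c.fnOp_mem 1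
    | cons P l ih =>
      rw [List.prod_cons]
      exact c.delSpan_mul_mem (hl P List.mem_cons_self)
        (ih fun Q hQ => hl Q (List.mem_cons_of_mem _ hQ))
  refine this _ fun P hP => ?_
  obtain ⟨j, rfl⟩ := List.mem_ofFn.1 hP
  exact c.mem_delSpan (Algebra.subset_adjoin (Or.inr ⟨_, c'.del_isDerivation _⟩))

/-- No shrinking of U is needed: the operator ∂_{θ'_1}…∂_{θ'_q} is a product of vector fields over
all of U, hence already in normal form there. -/
theorem genClass_eq : c'.genClass =
    MulOpposite.op (M.fnOp U (c.homCoeff c'.genClass)) • c.genClass := by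
  obtain ⟨f, hf⟩ := c.exists_eq_genClass_smul c'.dz_tens_delθ_mem
    (c.tens_mem _ (c.delθ_mem_delSpan c'))
  change c'.genClass = _ at hf
  have := congrArg c.homCoeff hf
  rw [homCoeff_op_smul, homCoeff_genClass_self, one_mul] at this
  rw [this]
  exact hf

/-- The transition factors in the two directions are mutually inverse because both generators are
free. This also supplies the invertibility of det(∂θ'/∂θ). -/
theorem jac_det_mul : (jacEven c' c).det * (jacOdd c c').det *
    ((jacEven c c').det * (jacOdd c' c).det) = 1 := by
  have := congrArg c'.homCoeff (c.genClass_eq c')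
  rw [homCoeff_op_smul, homCoeff_genClass_self, homCoeff_genClass, homCoeff_genClass] at this
  exact EvenSec.valHom_injective this.symm

theorem jacobian_mul : jacobian c c' * jacobian c' c = 1 := by
  ext a d
  rw [Matrix.mul_apply, Matrix.one_apply, ← c.del_x]
  exact (c'.ev_eq_sum (c.del_isDerivation a) (c.x d)).symm

/-- The Berezinian of the Jacobian is the coefficient of the change of coordinates in homology. -/
theorem berezinian_jacobian : (berezinian (jacobian c c')).val = c.homCoeff c'.genClass := by
  rw [homCoeff_genClass]
  congr 1
  have hdet := jac_det_mul c c'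
  have hD : (jacOdd c c').det *
      ((jacEven c' c).det * ((jacEven c c').det * (jacOdd c' c).det)) = 1 := by
    rw [← hdet]; ring
  have hunit : IsUnit (jacOdd c c').det := IsUnit.of_mul_eq_one _ hD
  set J := jacobian c c' with hJ
  set J' := jacobian c' c with hJ'
  set N : Matrix (Fin q) (Fin q) (M.Sec U) := ((jacOdd c c')⁻¹).map EvenSec.val with hN
  have hJ22 : J.toBlocks₂₂ = (jacOdd c c').map EvenSec.val := by
    ext i l
    exact (val_jacOdd c c' i l).symm
  have hJ11' : J'.toBlocks₁₁ = (jacEven c' c).map EvenSec.val := by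
    ext i l
    exact (val_jacEven c' c i l).symm
  have hNJ : N * J.toBlocks₂₂ = 1 := by
    have := congrArg (fun A => A.map (EvenSec.valHom M U))
      (Matrix.nonsing_inv_mul (jacOdd c c') hunit)
    rw [Matrix.map_mul, Matrix.map_one _ (map_zero _) (map_one _)] at this
    rw [hJ22]
    exact this
  have hmul : Matrix.fromBlocks J.toBlocks₁₁ J.toBlocks₁₂ J.toBlocks₂₁ J.toBlocks₂₂ *
      Matrix.fromBlocks J'.toBlocks₁₁ J'.toBlocks₁₂ J'.toBlocks₂₁ J'.toBlocks₂₂ =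
      Matrix.fromBlocks 1 0 0 1 := by
    rw [Matrix.fromBlocks_toBlocks, Matrix.fromBlocks_toBlocks, Matrix.fromBlocks_one]
    exact c.jacobian_mul c'
  rw [Matrix.fromBlocks_multiply] at hmul
  obtain ⟨h11, -, h21, -⟩ := Matrix.fromBlocks_inj.1 hmul
  -- The Schur complement is inverted by the corresponding block of the inverse matrix: the lower
  -- left block of J J' = 1 eliminates the lower left block of J'.
  have hS : (J.toBlocks₁₁ - J.toBlocks₁₂ * N * J.toBlocks₂₁) * J'.toBlocks₁₁ = 1 := by
    have h1 : N * (J.toBlocks₂₁ * J'.toBlocks₁₁) = -J'.toBlocks₂₁ := by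
      rw [eq_neg_of_add_eq_zero_left h21, Matrix.mul_neg, ← Matrix.mul_assoc, hNJ, Matrix.one_mul]
    rw [Matrix.sub_mul, Matrix.mul_assoc, Matrix.mul_assoc, h1, Matrix.mul_neg, sub_neg_eq_add,
      h11]
  have hodd12 : J.toBlocks₁₂.map (M.σ U) = -J.toBlocks₁₂ := by
    ext i l
    exact (c.σ_jacobian c' (Sum.inl i) (Sum.inr l)).trans (by simp [par]; rfl)
  have hodd21 : J.toBlocks₂₁.map (M.σ U) = -J.toBlocks₂₁ := by
    ext i l
    exact (c.σ_jacobian c' (Sum.inr i) (Sum.inl l)).trans (by simp [par]; rfl)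
  have heven11 : J.toBlocks₁₁.map (M.σ U) = J.toBlocks₁₁ := by
    ext i l
    exact (c.σ_jacobian c' (Sum.inl i) (Sum.inl l)).trans (by simp [par]; rfl)
  have hNeven : N.map (M.σ U) = N := by
    ext i l
    exact EvenSec.σ_val _
  -- The two odd blocks contribute two signs, so the Schur complement is even and `evenPart` does
  -- not change it.
  have hSeven : (J.toBlocks₁₁ - J.toBlocks₁₂ * N * J.toBlocks₂₁).map (M.σ U) =
      J.toBlocks₁₁ - J.toBlocks₁₂ * N * J.toBlocks₂₁ := by
    rw [Matrix.map_sub _ (map_sub (M.σ U)), Matrix.map_mul, Matrix.map_mul, hodd12, hodd21,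
      heven11, hNeven, Matrix.neg_mul, Matrix.neg_mul, Matrix.mul_neg, neg_neg]
  have hS' : (J.toBlocks₁₁ - J.toBlocks₁₂ * N * J.toBlocks₂₁).map evenPart * jacEven c' c = 1 := by
    refine Matrix.map_injective EvenSec.valHom_injective ?_
    change Matrix.map _ (EvenSec.valHom M U) = Matrix.map 1 (EvenSec.valHom M U)
    rw [Matrix.map_mul, Matrix.map_one _ (map_zero _) (map_one _), ← hS, hJ11']
    congr 1
    ext i l
    exact val_evenPart (congrFun (congrFun hSeven i) l)
  have hSdet := congrArg Matrix.det hS'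
  rw [Matrix.det_mul, Matrix.det_one] at hSdet
  -- Both factors of the Berezinian now involve J': the Schur determinant is inverse to that of the
  -- even block of J', which cancels the first factor of this inverse.
  have hinv : Ring.inverse (jacOdd c c').det =
      (jacEven c' c).det * ((jacEven c c').det * (jacOdd c' c).det) := by
    obtain ⟨w, hw⟩ := hunit
    rw [← hw, Ring.inverse_unit]
    rw [← hw] at hD
    exact (Units.inv_eq_of_mul_eq_one_right hD)
  change ((J.toBlocks₁₁ - J.toBlocks₁₂ * N * J.toBlocks₂₁).map evenPart).det *
    Ring.inverse (jacOdd c c').det = _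
  rw [hinv, ← mul_assoc, hSdet, one_mul]

end Coords

/-! ### Restriction of classes and coordinate dependence of the reduction. -/

theorem resHomology_resHomology (h : V ≤ U) (h' : W ≤ V) (η : M.Homology p q U) :
    resHomology h' (resHomology h η) = resHomology (h'.trans h) η := by
  obtain ⟨t, ht, rfl⟩ := Homology.exists_rep η
  simp only [resHomology_mk, resUdR_resUdR]

theorem resHomology_self (η : M.Homology p q U) : resHomology le_rfl η = η := by
  obtain ⟨t, ht, rfl⟩ := Homology.exists_rep η
  simp only [resHomology_mk, resUdR_self]

theorem resHomology_op_smul (h : V ≤ U) (P : M.Diff U) (η : M.Homology p q U) :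
    resHomology h (MulOpposite.op P • η) = MulOpposite.op (M.resDiff h P) • resHomology h η :=
  LinearMap.map_smulₛₗ (resHomology h) (MulOpposite.op P) η

namespace Coords

variable (c c' : M.Coords p q U)

theorem resForm_dz (h : V ≤ U) : resForm h c.dz = (c.restrict h).dz := by
  rw [dz, dz, map_list_prod, List.map_ofFn]
  congr 2
  exact funext fun i => resForm_df h _

theorem resDiff_delθ (h : V ≤ U) : M.resDiff h c.delθ = (c.restrict h).delθ := by
  rw [delθ, delθ, map_list_prod, List.map_ofFn]
  rfl

theorem resHomology_genClass (h : V ≤ U) : resHomology h c.genClass = (c.restrict h).genClass := by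
  rw [genClass, resHomology_mk, genClass]
  simp only [resUdR_tens, resForm_dz, resDiff_delθ]

theorem homCoeff_eq_mul (η : M.Homology p q U) :
    c.homCoeff η = c.homCoeff c'.genClass * c'.homCoeff η := by
  refine sec_eq_of_locally_eq fun x hx => ?_
  obtain ⟨V, h, hxV, f, hf⟩ := c'.resHomology_eq_genClass_smul η hx
  refine ⟨V, h, hxV, ?_⟩
  rw [map_mul, res_homCoeff, res_homCoeff, res_homCoeff, hf, homCoeff_op_smul, homCoeff_op_smul,
    homCoeff_genClass_self, one_mul, resHomology_genClass]

/-- The generator is annihilated by the right ideal Σ ∂_a D_M, so only the reduction of P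
contributes. -/
theorem homCoeff_op_smul_genClass (P : M.Diff U) :
    c.homCoeff (MulOpposite.op P • c.genClass) = c.red P := by
  refine sec_eq_of_locally_eq fun x hx => ?_
  obtain ⟨V, h, hxV, Q, hQ⟩ := c.reduces_red P x hx
  refine ⟨V, h, hxV, ?_⟩
  rw [res_homCoeff, resHomology_op_smul, hQ, resHomology_genClass, MulOpposite.op_add, add_smul,
    map_add, homCoeff_op_smul, homCoeff_genClass_self, one_mul, Finset.op_sum,
    Finset.sum_smul, Finset.sum_eq_zero, map_zero, add_zero]
  intro a _
  rw [MulOpposite.op_mul, mul_smul, delOp_smul_genClass, smul_zero]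

/-- Both sides are the coefficient of the class of x' times P. The behaviour of `red` under
coordinate change is thus read off from homology, without differentiating a Berezinian. -/
theorem red_fnOp_mul_eq (P : M.Diff U) :
    c.red (M.fnOp U (c.homCoeff c'.genClass) * P) = c.homCoeff c'.genClass * c'.red P := by
  rw [← homCoeff_op_smul_genClass, MulOpposite.op_mul, mul_smul, ← genClass_eq,
    homCoeff_eq_mul c c', homCoeff_op_smul_genClass]

theorem red_fnOp_mul_delOp (a : Fin p ⊕ Fin q) {k : ℕ} {f : M.Sec U} (hf : M.HasParity k f) :
    c.red (M.fnOp U f * c.delOp a) = -((-1 : ℤ) ^ (k * par a) • (c.del a).ev f) := by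
  rw [fnOp_mul_delOp, map_sub, red_delOp_mul, red_fnOp, zero_sub, σ_pow_hom hf, map_zsmul]

end Coords

theorem HasParity.mul {m n : ℕ} {f g : M.Sec U} (hf : M.HasParity m f) (hg : M.HasParity n g) :
    M.HasParity (m + n) (f * g) := by
  rw [HasParity, map_mul, hf, hg, smul_mul_smul_comm, pow_add]

/-! ### The isomorphism between homology and the Berezinian sheaf. -/

section BerezinianSheaf

/-- One coordinate system near each point suffices, because the transition rule determines the
coefficients in all others. -/
theorem Ber.ext_of_locally {s t : M.Ber p q U}
    (h : ∀ x ∈ U, ∃ (V : Opens M.space) (h : V ≤ U), x ∈ V ∧ ∃ c : M.Coords p q V,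
      coeff c (resBer h s) = coeff c (resBer h t)) : s = t := by
  refine Subtype.ext (funext fun ⟨V, hV, c⟩ => sec_eq_of_locally_eq fun x hx => ?_)
  obtain ⟨W, hW, hxW, c', hc'⟩ := h x (hV hx)
  refine ⟨V ⊓ W, inf_le_left, ⟨hx, hxW⟩, ?_⟩
  have h1 := congrArg (M.res (inf_le_right : V ⊓ W ≤ W)) hc'
  change M.res _ (s.1 ⟨W, hW, c'⟩) = M.res _ (t.1 ⟨W, hW, c'⟩) at h1
  rw [s.2.1, t.2.1] at h1
  rw [s.2.1, t.2.1, s.2.2 _ _ (c'.restrict inf_le_right), t.2.2 _ _ (c'.restrict inf_le_right), h1]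

theorem coeff_injective (c : M.Coords p q U) : Function.Injective (coeff c) := fun _ _ h =>
  Ber.ext_of_locally fun _ hx => ⟨U, le_rfl, hx, c, h⟩

theorem coeff_mulFn (c : M.Coords p q U) (s : M.Ber p q U) (f : M.Sec U) :
    coeff c (mulFn s f) = coeff c s * f := by
  change s.1 ⟨U, le_rfl, c⟩ * M.res _ f = s.1 ⟨U, le_rfl, c⟩ * f
  rw [res_self]

theorem res_coeff (h : V ≤ U) (c : M.Coords p q U) (s : M.Ber p q U) :
    M.res h (coeff c s) = coeff (c.restrict h) (resBer h s) := s.2.1 le_rfl h c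

variable (M p q) in
/-- The morphism from homology to the Berezinian sheaf, which sends a class to its coefficients in
all coordinate systems. -/
def homologyToBer : M.HomologyToBer p q where
  app U :=
    { toFun := fun η => ⟨fun i => i.coords.homCoeff (resHomology i.le η),
        fun hV hW c => by
          rw [Coords.res_homCoeff, resHomology_resHomology],
        fun hV c c' => by
          rw [Coords.berezinian_jacobian, ← Coords.homCoeff_eq_mul]⟩
      map_zero' := Subtype.ext (funext fun i => by
        change i.coords.homCoeff (resHomology i.le 0) = 0
        rw [map_zero, map_zero])
      map_add' := fun η η' => Subtype.ext (funext fun i => by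
        change i.coords.homCoeff (resHomology i.le (η + η')) =
          i.coords.homCoeff (resHomology i.le η) + i.coords.homCoeff (resHomology i.le η')
        rw [map_add, map_add]) }
  app_fn U η f := Subtype.ext (funext fun i => by
    change i.coords.homCoeff (resHomology i.le (_ • η)) =
      i.coords.homCoeff (resHomology i.le η) * M.res i.le f
    rw [resHomology_op_smul, resDiff_fnOp, Coords.homCoeff_op_smul])
  app_res h η := Subtype.ext (funext fun i => by
    change i.coords.homCoeff (resHomology _ η) =
      i.coords.homCoeff (resHomology i.le (resHomology h η))
    rw [resHomology_resHomology])

theorem coeff_homologyToBer (c : M.Coords p q U) (η : M.Homology p q U) :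
    coeff c ((homologyToBer M p q).app U η) = c.homCoeff η := by
  change c.homCoeff (resHomology le_rfl η) = _
  rw [resHomology_self]

theorem homologyToBer_normalized : (homologyToBer M p q).Normalized := fun U c => by
  rw [coeff_homologyToBer, Coords.homCoeff_genClass_self]

theorem IsSupermanifold.exists_coords (hM : M.IsSupermanifold p q) {x : M.space} (hx : x ∈ U) :
    ∃ (V : Opens M.space) (_ : V ≤ U), x ∈ V ∧ Nonempty (M.Coords p q V) := by
  obtain ⟨W, hxW, ⟨c⟩⟩ := hM x
  exact ⟨U ⊓ W, inf_le_left, ⟨hx, hxW⟩, ⟨c.restrict inf_le_right⟩⟩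

theorem IsSupermanifold.exists_eq_genClass_smul (hM : M.IsSupermanifold p q)
    (η : M.Homology p q U) {x : M.space} (hx : x ∈ U) :
    ∃ (V : Opens M.space) (h : V ≤ U), x ∈ V ∧ ∃ (c : M.Coords p q V) (f : M.Sec V),
      resHomology h η = MulOpposite.op (M.fnOp V f) • c.genClass := by
  obtain ⟨V, hV, hxV, ⟨c⟩⟩ := hM.exists_coords hx
  obtain ⟨W, hW, hxW, f, hf⟩ := c.resHomology_eq_genClass_smul (resHomology hV η) hxV
  rw [resHomology_resHomology] at hf
  exact ⟨W, hW.trans hV, hxW, _, f, hf⟩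

theorem HomologyToBer.Normalized.coeff_app {Φ : M.HomologyToBer p q} (hΦ : Φ.Normalized)
    (c : M.Coords p q U) (f : M.Sec U) :
    coeff c (Φ.app U (MulOpposite.op (M.fnOp U f) • c.genClass)) = f := by
  rw [Φ.app_fn, coeff_mulFn, hΦ, one_mul]

/-- Locally every class is the generator times a function, and O_M-linearity leaves no freedom once
the generator is normalized. -/
theorem HomologyToBer.Normalized.unique (hM : M.IsSupermanifold p q) {Φ Φ' : M.HomologyToBer p q}
    (hΦ : Φ.Normalized) (hΦ' : Φ'.Normalized) : Φ = Φ' := by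
  have : Φ.app = Φ'.app := funext fun U => AddMonoidHom.ext fun η =>
    Ber.ext_of_locally fun x hx => by
      obtain ⟨V, h, hxV, c, f, hf⟩ := hM.exists_eq_genClass_smul η hx
      refine ⟨V, h, hxV, c, ?_⟩
      rw [Φ.app_res, Φ'.app_res, hf, hΦ.coeff_app, hΦ'.coeff_app]
  obtain ⟨_, _, _⟩ := Φ
  obtain ⟨_, _, _⟩ := Φ'
  congr

theorem HomologyToBer.Normalized.isIso (hM : M.IsSupermanifold p q) {Φ : M.HomologyToBer p q}
    (hΦ : Φ.Normalized) : Φ.IsIso := by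
  refine ⟨fun U η hη x hx => ?_, fun U s x hx => ?_⟩
  · obtain ⟨V, h, hxV, c, f, hf⟩ := hM.exists_eq_genClass_smul η hx
    refine ⟨V, h, hxV, ?_⟩
    have h1 := hΦ.coeff_app c f
    rw [← hf, ← Φ.app_res, hη, map_zero] at h1
    change 0 = f at h1
    rw [hf, ← h1, map_zero, MulOpposite.op_zero, zero_smul]
  · obtain ⟨V, h, hxV, ⟨c⟩⟩ := hM.exists_coords hx
    exact ⟨V, h, hxV, _, coeff_injective c (hΦ.coeff_app c (coeff c (resBer h s)))⟩

/-! ### The right action of differential operators. -/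

/-- The product of a section of the Berezinian sheaf with a differential operator. -/
def actDiff (s : M.Ber p q U) (P : M.Diff U) : M.Ber p q U :=
  ⟨fun i => i.coords.red (M.fnOp i.dom (s.1 i) * M.resDiff i.le P),
    fun hV hW c => by
      rw [Coords.res_red, map_mul, resDiff_fnOp, s.2.1, resDiff_resDiff],
    fun {V} hV c c' => by
      change c.red (M.fnOp V (s.1 ⟨_, hV, c⟩) * M.resDiff hV P) =
        (berezinian (jacobian c c')).val * c'.red (M.fnOp V (s.1 ⟨_, hV, c'⟩) * M.resDiff hV P)
      rw [s.2.2 hV c c', Coords.berezinian_jacobian, map_mul (M.fnOp V), mul_assoc, Coords.red_fnOp_mul_eq]⟩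

theorem actDiff_val (s : M.Ber p q U) (P : M.Diff U) (i : M.Chart p q U) :
    (actDiff s P).1 i = i.coords.red (M.fnOp i.dom (s.1 i) * M.resDiff i.le P) := rfl

variable (M p q) in
/-- The right `D_M`-module structure on the Berezinian sheaf. -/
def berAction : M.RightAction p q where
  act U := LinearMap.mk₂ K actDiff
    (fun s t P => Subtype.ext (funext fun i => by
      change i.coords.red (M.fnOp i.dom (s.1 i + t.1 i) * _) = i.coords.red _ + i.coords.red _
      rw [map_add, add_mul, map_add]))
    (fun r s P => Subtype.ext (funext fun i => by
      change i.coords.red (M.fnOp i.dom (r • s.1 i) * _) = r • i.coords.red _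
      rw [map_smul, smul_mul_assoc, map_smul]))
    (fun s P Q => Subtype.ext (funext fun i => by
      change i.coords.red (_ * M.resDiff i.le (P + Q)) = i.coords.red _ + i.coords.red _
      rw [map_add, mul_add, map_add]))
    (fun r s P => Subtype.ext (funext fun i => by
      change i.coords.red (_ * M.resDiff i.le (r • P)) = r • i.coords.red _
      rw [map_smul, mul_smul_comm, map_smul]))
  act_mul U s P Q := Subtype.ext (funext fun i => by
    change i.coords.red (_ * M.resDiff i.le (P * Q)) =
      i.coords.red (M.fnOp i.dom (i.coords.red _) * M.resDiff i.le Q)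
    rw [Coords.red_red_mul, map_mul (M.resDiff i.le), mul_assoc])
  act_fn U s f := Subtype.ext (funext fun i => by
    change i.coords.red (_ * M.resDiff i.le (M.fnOp U f)) = s.1 i * M.res i.le f
    rw [resDiff_fnOp, Coords.red_mul_fnOp, Coords.red_fnOp])
  act_res _ _ _ := rfl

theorem berAction_act (s : M.Ber p q U) (P : M.Diff U) :
    (berAction M p q).act U s P = actDiff s P := rfl

theorem coeff_actDiff (c : M.Coords p q U) (s : M.Ber p q U) (P : M.Diff U) :
    coeff c (actDiff s P) = c.red (M.fnOp U (coeff c s) * P) := rfl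

theorem homologyToBer_op_smul (hM : M.IsSupermanifold p q) (η : M.Homology p q U) (P : M.Diff U) :
    (homologyToBer M p q).app U (MulOpposite.op P • η) =
      (berAction M p q).act U ((homologyToBer M p q).app U η) P := by
  refine Ber.ext_of_locally fun x hx => ?_
  obtain ⟨V, h, hxV, c, f, hf⟩ := hM.exists_eq_genClass_smul η hx
  refine ⟨V, h, hxV, c, ?_⟩
  rw [(berAction M p q).act_res, (homologyToBer M p q).app_res, (homologyToBer M p q).app_res,
    resHomology_op_smul, hf, berAction_act, coeff_actDiff, homologyToBer_normalized.coeff_app,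
    coeff_homologyToBer, ← mul_smul, ← MulOpposite.op_mul, Coords.homCoeff_op_smul_genClass]

/-- With s = s₀ f, the product s·P equals s₀·(fP), and the part of fP in Σ ∂_a D_M acts by zero. So
the vanishing of s₀·∂_a determines the action. -/
theorem RightAction.act_eq (ρ : M.RightAction p q) {c : M.Coords p q U} {s₀ : M.Ber p q U}
    (hs₀ : coeff c s₀ = 1) (h : ∀ a, ρ.act U s₀ (c.delOp a) = 0) {s : M.Ber p q U} {P : M.Diff U}
    {g : M.Sec U} {Q : Fin p ⊕ Fin q → M.Diff U}
    (hQ : M.fnOp U (coeff c s) * P = M.fnOp U g + ∑ a, c.delOp a * Q a) :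
    ρ.act U s P = mulFn s₀ g := by
  have hs : s = ρ.act U s₀ (M.fnOp U (coeff c s)) := by
    rw [ρ.act_fn]
    exact coeff_injective c (by rw [coeff_mulFn, hs₀, one_mul])
  rw [hs, ← ρ.act_mul, hQ, map_add, ρ.act_fn, map_sum, Finset.sum_eq_zero, add_zero]
  intro a _
  rw [ρ.act_mul, h, map_zero, LinearMap.zero_apply]

theorem RightAction.unique {Φ : M.HomologyToBer p q} (hΦ : Φ.Normalized)
    {ρ ρ' : M.RightAction p q}
    (h : ∀ (U : Opens M.space) (c : M.Coords p q U) (a : Fin p ⊕ Fin q),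
      ρ.act U (Φ.app U c.genClass) (c.delOp a) = 0)
    (h' : ∀ x : M.space, ∃ U : Opens M.space, x ∈ U ∧ ∃ c : M.Coords p q U,
      ∀ a, ρ'.act U (Φ.app U c.genClass) (c.delOp a) = 0) : ρ' = ρ := by
  have : ρ'.act = ρ.act := funext fun U => LinearMap.ext fun s => LinearMap.ext fun P =>
    Ber.ext_of_locally fun x hx => by
      obtain ⟨W, hxW, c, hc⟩ := h' x
      have hU : U ⊓ W ≤ U := inf_le_left
      have hW : U ⊓ W ≤ W := inf_le_right
      obtain ⟨V, hV, hxV, Q, hQ⟩ := (c.restrict hW).reduces_red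
        (M.fnOp _ (coeff (c.restrict hW) (resBer hU s)) * M.resDiff hU P) x ⟨hx, hxW⟩
      rw [map_mul, resDiff_fnOp, res_coeff, resDiff_resDiff, Coords.restrict_restrict] at hQ
      have hρ' : ∀ a, ρ'.act V (Φ.app V (c.restrict (hV.trans hW)).genClass)
          ((c.restrict (hV.trans hW)).delOp a) = 0 := fun a => by
        have := congrArg (resBer (hV.trans hW)) (hc a)
        rwa [ρ'.act_res, Φ.app_res, Coords.resHomology_genClass, map_zero] at this
      -- Both actions are evaluated on the same local reduction, in a chart of the atlas given for
      -- ρ'.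
      refine ⟨V, hV.trans hU, hxV, c.restrict (hV.trans hW), congrArg _ ?_⟩
      rw [ρ.act_res, ρ'.act_res]
      exact (ρ'.act_eq (hΦ V _) hρ' hQ).trans (ρ.act_eq (hΦ V _) (h V _) hQ).symm
  obtain ⟨_, _, _, _⟩ := ρ
  obtain ⟨_, _, _, _⟩ := ρ'
  congr

/-- Writing X = Σ X^a ∂_a, the reduction of f X^a ∂_a is, up to sign, -∂_a(f X^a), by moving the
function past ∂_a. -/
theorem actDiff_vecOp {m n : ℕ} {X : M.Endo U} (hX : M.IsDerivation m X) {s : M.Ber p q U}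
    (hs : BerHasParity n s) :
    (actDiff s (M.vecOp X hX)).1 = -((-1 : ℤ) ^ (n * m) • lieDerivative m n X s) := by
  funext i
  have hX' : M.IsDerivation m (M.resEndo i.le X) := hX.restrict i.le
  have h1 : M.resDiff i.le (M.vecOp X hX) = M.vecOp (M.resEndo i.le X) hX' := rfl
  rw [actDiff_val, h1, i.coords.vecOp_eq_sum, Finset.mul_sum, map_sum]
  change _ = -((-1 : ℤ) ^ (n * m) • lieDerivative m n X s i)
  rw [lieDerivative, smul_smul, Finset.smul_sum, ← Finset.sum_neg_distrib]
  refine Finset.sum_congr rfl fun a _ => ?_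
  rw [← mul_assoc, ← map_mul, i.coords.red_fnOp_mul_delOp a
    ((hs i).mul (hX'.ev_hasParity (i.coords.x_parity a))), smul_smul, ← pow_add, ← pow_add]
  refine congrArg Neg.neg (congrArg₂ (· • ·) (neg_one_pow_eq ?_) rfl)
  -- The witness is half the sum of the two sign exponents, which therefore have the same parity.
  exact ⟨(n + (p + q)) * (m + par a) + (m + par a) * par a, by ring⟩

end BerezinianSheaf

end SuperSpace

end

theorem mainTheorem9 {K : Type*} [Field K] [CharZero K] {p q : ℕ} (M : SuperSpace K)
    (hM : M.IsSupermanifold p q) :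
    (∀ (U : TopologicalSpace.Opens M.space) (c : M.Coords p q U) (a : Fin p ⊕ Fin q),
      MulOpposite.op (c.delOp a) • c.genClass = 0) ∧
    ∃ Φ : M.HomologyToBer p q,
      Φ.Normalized ∧ (∀ Φ' : M.HomologyToBer p q, Φ'.Normalized → Φ' = Φ) ∧ Φ.IsIso ∧
      ∃ ρ : M.RightAction p q,
        (∀ (U : TopologicalSpace.Opens M.space) (η : M.Homology p q U) (P : M.Diff U),
          Φ.app U (MulOpposite.op P • η) = ρ.act U (Φ.app U η) P) ∧
        (∀ (U : TopologicalSpace.Opens M.space) (c : M.Coords p q U) (a : Fin p ⊕ Fin q),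
          ρ.act U (Φ.app U c.genClass) (c.delOp a) = 0) ∧
        (∀ ρ' : M.RightAction p q,
          (∀ x : M.space, ∃ U : TopologicalSpace.Opens M.space, x ∈ U ∧ ∃ c : M.Coords p q U,
            ∀ a, ρ'.act U (Φ.app U c.genClass) (c.delOp a) = 0) → ρ' = ρ) ∧
        (∀ (U : TopologicalSpace.Opens M.space) (m n : ℕ) (X : M.Endo U)
          (hX : M.IsDerivation m X) (s : M.Ber p q U), SuperSpace.BerHasParity n s →
          SuperSpace.lieDerivative m n X s ∈ M.Ber p q U ∧
          (ρ.act U s (M.vecOp X hX)).1 =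
            -((-1 : ℤ) ^ (n * m) • SuperSpace.lieDerivative m n X s)) := by
  have hΦ : (SuperSpace.homologyToBer M p q).Normalized := SuperSpace.homologyToBer_normalized
  have hρ : ∀ (U : TopologicalSpace.Opens M.space) (c : M.Coords p q U) (a : Fin p ⊕ Fin q),
      (SuperSpace.berAction M p q).act U ((SuperSpace.homologyToBer M p q).app U c.genClass)
        (c.delOp a) = 0 := fun U c a => by
    rw [← SuperSpace.homologyToBer_op_smul hM, c.delOp_smul_genClass, map_zero]
  refine ⟨fun U c a => c.delOp_smul_genClass a, SuperSpace.homologyToBer M p q, hΦ,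
    fun Φ' hΦ' => hΦ'.unique hM hΦ, hΦ.isIso hM, SuperSpace.berAction M p q,
    fun U η P => SuperSpace.homologyToBer_op_smul hM η P, hρ,
    fun ρ' h' => SuperSpace.RightAction.unique hΦ hρ h', fun U m n X hX s hs => ?_⟩
  have h := SuperSpace.actDiff_vecOp hX hs
  refine ⟨?_, h⟩
  -- Coordinate independence of the Lie derivative comes for free: up to sign it is the section s·X.
  have h1 : SuperSpace.lieDerivative m n X s =
      -((-1 : ℤ) ^ (n * m) • (SuperSpace.actDiff s (M.vecOp X hX)).1) := by
    rw [h, smul_neg, neg_neg, SuperSpace.neg_one_pow_smul_smul]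
  rw [h1]
  exact neg_mem (zsmul_mem (SuperSpace.actDiff s (M.vecOp X hX)).2 _)
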